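/- Let $l>0$, let $V\in L^2[0,l]$ be real-valued, $\beta\in\mathbb R\setminus\{0\}$, and let $\theta$ be an integer. For $\alpha\in\mathbb R$ consider the following operators. - $D=-\frac{d^2}{dt^2}+V$ in $L^2[0,l]$ with domain $\{f\in H^2[0,l]: f(0)=f(l)=0\}$; its eigenvalues are $\mu_0<\mu_1<\mu_2<\dots$ (an infinite strictly increasing sequence of real numbers). - $\Lambda=\Lambda_\alpha$ in $\bigoplus_{(m,n)\in\mathbb Z^2}\big(L^2[0,l]\oplus L^2[0,l]\big)$, acting on $\phi=(\phi_{m,n,r},\phi_{m,n,u})$ as $\phi_{m,n,j}\mapsto-\phi_{m,n,j}''+V\phi_{m,n,j}$ ($j=r,u$) on functions with $H^2[0,l]$ components satisfying, for all $m,n\in\mathbb Z$, $$\phi_{m,n,r}(0)=\tfrac1\beta\phi_{m,n,u}(0)=e^{-i\pi n\theta}\phi_{m-1,n,r}(l)=\tfrac1\beta e^{i\pi m\theta}\phi_{m,n-1,u}(l)=:\phi_{m,n},$$ $$\phi_{m,n,r}'(0)+\beta\phi_{m,n,u}'(0)-e^{-i\pi n\theta}\phi_{m-1,n,r}'(l)-\beta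 e^{i\pi m\theta}\phi_{m,n-1,u}'(l)=\alpha\,\phi_{m,n}.$$ - The Kronig–Penney Hamiltonian $P=P_\alpha=-\frac{d^2}{dt^2}+W+\frac{\alpha}{1+\beta^2}\sum_{k\in\mathbb Z}\delta(\cdot-kl)$ in $L^2(\mathbb R)$, where $W$ is the $l$-periodic extension of $V$; that is, $f\mapsto-f''+Wf$ on $f\in H^2(\mathbb R\setminus l\mathbb Z)$ with $f(kl+)=f(kl-)$ and $f'(kl+)=f'(kl-)+\frac{\alpha}{1+\beta^2}f(kl-)$ for all $k\in\mathbb Z$. - $M(\theta,\beta)$ in $\ell^2(\mathbb Z^2)$, $(M(\theta,\beta)g)_{m,n}=e^{i\pi n\theta}g_{m+1,n}+e^{-i\pi n\theta}g_{m-1,n}+\beta^2\big(e^{-i\pi m\theta}g_{m,n+1}+e^{i\pi m\theta}g_{m,n-1}\big)$. For $z\in\mathbb C$ let $u_1(\cdot;z),u_2(\cdot;z)$ be the solutions of $-u''+Vu=zu$ on $[0,l]$ with $u_1(0)=0,\ u_1'(0)=1,\ u_2(0)=1,\ u_2'(0)=0$, put $\eta(z)=(1+\beta^2)\big(u_1'(l;z)+u_2(l;z)\big)+\alpha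 u_1(l;z)$ and $\Sigma=\eta^{-1}\big(\operatorname{spec}M(\theta,\beta)\big)$. A gap of a closed set $S\subset\mathbb R$ is a bounded connected component of $\mathbb R\setminus S$. The gap of $P$ near $\mu_k$ is called open if $\mu_k$ lies in the closure of some gap of $\operatorname{spec}P$, and closed otherwise. A point $x$ is a band edge of $S$ if in some neighbourhood of $x$ the set $S$ is a one-sided interval that has $x$ as its end point and contains it. The continuous spectrum of $\Lambda$ is the spectrum of the part of $\Lambda$ in the orthogonal complement of all its eigenvectors; an eigenvalue is embedded if it belongs to the continuous spectrum. Then: (A) For every $\alpha$, $\Sigma\subset\operatorname{spec}\Lambda$ and $\Sigma=\operatorname{spec}P$. In particular, if $\operatorname{spec}P$ has infinitely many gaps, then so has $\operatorname{spec}\Lambda$. (B) If $V$ is smooth and convex on $[0,l]$ and $V'(t)\ne0$ for all $t\in(0,l)$, then for every $\alpha$ all gaps of $P$ are open (that is, the gap near $\mu_k$ is open for every $k$), $\operatorname{spec}P$ and $\operatorname{spec}\Lambda$ have infinitely many gaps, and every $\mu_k$ is an isolated point of $\operatorname{spec}\Lambda$. (C) If the gap of $P_0$ near $\mu_k$ is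 closed, then $\mu_k$ is an embedded eigenvalue of $\Lambda_\alpha$ for every $\alpha\in\mathbb R$, and for $\alpha\neq0$ it is a band edge of $\operatorname{spec}P_\alpha$ and of $\operatorname{spec}\Lambda_\alpha$. If $V=0$, then for $\alpha=0$ all gaps of $P_0$ are closed and every $\mu_k$ is an eigenvalue of $\Lambda_0$ embedded into its continuous spectrum. -/

import Mathlib

open MeasureTheory
open scoped ENNReal ContDiff

noncomputable section

namespace QuantumGraph

/-! ### Unbounded operators: eigenvalues, spectrum, continuous spectrum -/

section Operators

variable {E : Type*} [NormedAddCommGroup E] [InnerProductSpace ℂ E]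

/-- `z` is an eigenvalue of the (unbounded) operator `T`. -/
def IsEigenvalue (T : E →ₗ.[ℂ] E) (z : ℂ) : Prop :=
  ∃ x : T.domain, (x : E) ≠ 0 ∧ T x = z • (x : E)

/-- The resolvent set: those `z` for which `T - z` is a bijection of the domain of `T` onto the
whole space with a bounded inverse `R`. -/
def resolventSet (T : E →ₗ.[ℂ] E) : Set ℂ :=
  {z | ∃ R : E →L[ℂ] E,
    (∀ y : E, ∃ h : R y ∈ T.domain, T ⟨R y, h⟩ - z • R y = y) ∧
    (∀ x : T.domain, R (T x - z • (x : E)) = x)}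

/-- The spectrum of an unbounded operator. -/
def spec (T : E →ₗ.[ℂ] E) : Set ℂ := (resolventSet T)ᶜ

/-- The real points of the spectrum. -/
def realSpec (T : E →ₗ.[ℂ] E) : Set ℝ := {x | (x : ℂ) ∈ spec T}

/-- The part of `T` in the subspace `K`: its domain consists of the `x ∈ K ∩ dom T` with
`T x ∈ K`. -/
def partIn (T : E →ₗ.[ℂ] E) (K : Submodule ℂ E) : K →ₗ.[ℂ] K :=
  (T.graph.comap (K.subtype.prodMap K.subtype)).toLinearPMap

/-- The linear span of all eigenvectors of `T`. -/
def eigenSpan (T : E →ₗ.[ℂ] E) : Submodule ℂ E :=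
  Submodule.span ℂ {x : E | ∃ (z : ℂ) (h : x ∈ T.domain), T ⟨x, h⟩ = z • x}

/-- The continuous spectrum of a self-adjoint operator: the spectrum of its part in the orthogonal
complement of all eigenvectors. -/
def continuousSpec (T : E →ₗ.[ℂ] E) : Set ℂ := spec (partIn T (eigenSpan T)ᗮ)

/-- An eigenvalue that is embedded into the continuous spectrum. -/
def IsEmbeddedEigenvalue (T : E →ₗ.[ℂ] E) (z : ℂ) : Prop :=
  IsEigenvalue T z ∧ z ∈ continuousSpec T

end Operators

/-! ### Gaps and bands of a closed set of real numbers -/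

/-- `(a, b)` is a gap (a bounded component of the complement) of the closed set `S`. -/
def IsGap (S : Set ℝ) (a b : ℝ) : Prop :=
  a < b ∧ a ∈ S ∧ b ∈ S ∧ ∀ x, a < x → x < b → x ∉ S

/-- `S` has infinitely many gaps. -/
def HasInfinitelyManyGaps (S : Set ℝ) : Prop := {p : ℝ × ℝ | IsGap S p.1 p.2}.Infinite

/-- The gap near `x` is open: `x` belongs to the closure of some gap `(a, b)`. -/
def GapOpenNear (S : Set ℝ) (x : ℝ) : Prop := ∃ a b, IsGap S a b ∧ a ≤ x ∧ x ≤ b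

/-- The gap near `x` is closed. -/
def GapClosedNear (S : Set ℝ) (x : ℝ) : Prop := ¬ GapOpenNear S x

/-- `x` is a band edge of `S`: near `x`, the set `S` is a one-sided interval with end point `x`. -/
def IsBandEdge (S : Set ℝ) (x : ℝ) : Prop :=
  ∃ ε > 0, S ∩ Set.Ioo (x - ε) (x + ε) = Set.Ico x (x + ε) ∨
    S ∩ Set.Ioo (x - ε) (x + ε) = Set.Ioc (x - ε) x

/-- `z` is an isolated point of `S`. -/
def IsIsolatedPoint (S : Set ℂ) (z : ℂ) : Prop := ∃ ε > 0, S ∩ Metric.ball z ε = {z}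

/-! ### The Sobolev space `H²` of an interval -/

/-- `f` belongs to `H²[a, b]`, with first derivative `g` and second derivative `h`: `f` and `g` are
absolutely continuous on `[a, b]`, `f' = g`, `g' = h`, and `h` is square integrable. -/
structure IsH2 (a b : ℝ) (f g h : ℝ → ℂ) : Prop where
  memLp : MemLp h 2 (volume.restrict (Set.Icc a b))
  eq_fst : ∀ t ∈ Set.Icc a b, f t = f a + ∫ s in a..t, g s
  eq_snd : ∀ t ∈ Set.Icc a b, g t = g a + ∫ s in a..t, h s

namespace IsH2

variable {a b : ℝ} {f g h f₁ g₁ h₁ : ℝ → ℂ}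

theorem zero : IsH2 a b 0 0 0 := by
  refine ⟨MemLp.zero, fun t _ => ?_, fun t _ => ?_⟩ <;> simp

theorem integrableOn (H : IsH2 a b f g h) : IntegrableOn h (Set.Icc a b) :=
  H.memLp.integrable (by norm_num)

theorem continuousOn_of_eq {u v : ℝ → ℂ} (hv : IntegrableOn v (Set.Icc a b))
    (hu : ∀ t ∈ Set.Icc a b, u t = u a + ∫ s in a..t, v s) : ContinuousOn u (Set.Icc a b) := by
  rcases le_or_gt a b with hab | hab
  · have h1 : ContinuousOn (fun t => ∫ s in a..t, v s) (Set.uIcc a b) :=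
      intervalIntegral.continuousOn_primitive_interval (by rwa [Set.uIcc_of_le hab])
    rw [Set.uIcc_of_le hab] at h1
    exact (continuousOn_const.add h1).congr hu
  · simp [Set.Icc_eq_empty (not_le.mpr hab)]

theorem continuousOn_snd (H : IsH2 a b f g h) : ContinuousOn g (Set.Icc a b) :=
  continuousOn_of_eq H.integrableOn H.eq_snd

theorem integrableOn_snd (H : IsH2 a b f g h) : IntegrableOn g (Set.Icc a b) :=
  H.continuousOn_snd.integrableOn_Icc

theorem continuousOn_fst (H : IsH2 a b f g h) : ContinuousOn f (Set.Icc a b) :=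
  continuousOn_of_eq H.integrableOn_snd H.eq_fst

theorem intervalIntegrable_of {v : ℝ → ℂ} (hv : IntegrableOn v (Set.Icc a b)) {t : ℝ}
    (ht : t ∈ Set.Icc a b) : IntervalIntegrable v volume a t := by
  rw [intervalIntegrable_iff_integrableOn_Icc_of_le ht.1]
  exact hv.mono_set (Set.Icc_subset_Icc_right ht.2)

theorem add (H : IsH2 a b f g h) (H₁ : IsH2 a b f₁ g₁ h₁) :
    IsH2 a b (f + f₁) (g + g₁) (h + h₁) := by
  refine ⟨H.memLp.add H₁.memLp, fun t ht => ?_, fun t ht => ?_⟩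
  · have := intervalIntegral.integral_add (intervalIntegrable_of H.integrableOn_snd ht)
      (intervalIntegrable_of H₁.integrableOn_snd ht)
    simp only [Pi.add_apply, this, H.eq_fst t ht, H₁.eq_fst t ht]
    ring
  · have := intervalIntegral.integral_add (intervalIntegrable_of H.integrableOn ht)
      (intervalIntegrable_of H₁.integrableOn ht)
    simp only [Pi.add_apply, this, H.eq_snd t ht, H₁.eq_snd t ht]
    ring

theorem smul (c : ℂ) (H : IsH2 a b f g h) : IsH2 a b (c • f) (c • g) (c • h) := by
  refine ⟨H.memLp.const_smul c, fun t ht => ?_, fun t ht => ?_⟩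
  · simp only [Pi.smul_apply, intervalIntegral.integral_smul, H.eq_fst t ht, smul_add]
  · simp only [Pi.smul_apply, intervalIntegral.integral_smul, H.eq_snd t ht, smul_add]

theorem ae_zero_of_primitive {v : ℝ → ℂ} (hv : IntegrableOn v (Set.Icc a b))
    (h0 : ∀ t ∈ Set.Icc a b, ∫ s in a..t, v s = 0) :
    v =ᵐ[volume.restrict (Set.Icc a b)] 0 := by
  rcases le_or_gt a b with hab | hab
  · have hi : IntervalIntegrable v volume a b :=
      (intervalIntegrable_iff_integrableOn_Icc_of_le hab).mpr hv
    rw [← restrict_Ioo_eq_restrict_Icc]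
    refine (ae_restrict_iff' measurableSet_Ioo).mpr ?_
    filter_upwards [hi.ae_hasDerivAt_integral] with x hx hxab
    rw [Set.uIcc_of_le hab] at hx
    have h1 := hx ⟨hxab.1.le, hxab.2.le⟩ a ⟨le_rfl, hab⟩
    have h2 : HasDerivAt (fun t => ∫ s in a..t, v s) 0 x := by
      refine (hasDerivAt_const x (0 : ℂ)).congr_of_eventuallyEq ?_
      filter_upwards [Ioo_mem_nhds hxab.1 hxab.2] with t ht
      exact h0 t ⟨ht.1.le, ht.2.le⟩
    exact h1.unique h2
  · simp [Set.Icc_eq_empty (not_le.mpr hab), Filter.EventuallyEq]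

theorem ae_zero (hab : a < b) (H : IsH2 a b f g h)
    (hf : f =ᵐ[volume.restrict (Set.Icc a b)] 0) :
    h =ᵐ[volume.restrict (Set.Icc a b)] 0 := by
  have f0 : Set.EqOn f 0 (Set.Icc a b) :=
    Measure.eqOn_Icc_of_ae_eq volume hab.ne hf H.continuousOn_fst continuousOn_const
  have ha : a ∈ Set.Icc a b := ⟨le_rfl, hab.le⟩
  have g0 : Set.EqOn g 0 (Set.Icc a b) := by
    refine Measure.eqOn_Icc_of_ae_eq volume hab.ne (ae_zero_of_primitive H.integrableOn_snd
      fun t ht => ?_) H.continuousOn_snd continuousOn_const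
    have := H.eq_fst t ht
    rw [f0 ht, f0 ha] at this
    simpa using this.symm
  refine ae_zero_of_primitive H.integrableOn fun t ht => ?_
  have := H.eq_snd t ht
  rw [g0 ht, g0 ha] at this
  simpa using this.symm

end IsH2

/-! ### The Dirichlet operator `D` on one edge -/

/-- The Hilbert space `L²[0, l]`. -/
abbrev EdgeSpace (l : ℝ) : Type := Lp ℂ 2 (volume.restrict (Set.Icc (0 : ℝ) l))

/-- The graph of the Dirichlet operator. -/
def dirichletGraph (l : ℝ) (V : ℝ → ℝ) : Submodule ℂ (EdgeSpace l × EdgeSpace l) where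
  carrier := {p | ∃ f g h : ℝ → ℂ, IsH2 0 l f g h ∧
    p.1 =ᵐ[volume.restrict (Set.Icc 0 l)] f ∧
    p.2 =ᵐ[volume.restrict (Set.Icc 0 l)] (fun t => -h t + (V t : ℂ) * f t) ∧
    f 0 = 0 ∧ f l = 0}
  zero_mem' := ⟨0, 0, 0, IsH2.zero, Lp.coeFn_zero _ _ _,
    (Lp.coeFn_zero _ _ _).trans (by simp [Filter.EventuallyEq]), rfl, rfl⟩
  add_mem' := by
    rintro p q ⟨f, g, h, H, h1, h2, h3, h4⟩ ⟨f', g', h', H', h1', h2', h3', h4'⟩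
    refine ⟨f + f', g + g', h + h', H.add H', ?_, ?_, by simp [h3, h3'], by simp [h4, h4']⟩
    · exact (Lp.coeFn_add _ _).trans (h1.add h1')
    · refine (Lp.coeFn_add _ _).trans ((h2.add h2').trans (Filter.Eventually.of_forall fun t => ?_))
      simp only [Pi.add_apply]; ring
  smul_mem' := by
    rintro c p ⟨f, g, h, H, h1, h2, h3, h4⟩
    refine ⟨c • f, c • g, c • h, H.smul c, ?_, ?_, by simp [h3], by simp [h4]⟩
    · exact (Lp.coeFn_smul _ _).trans (h1.const_smul c)
    · refine (Lp.coeFn_smul _ _).trans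
        ((h2.const_smul c).trans (Filter.Eventually.of_forall fun t => ?_))
      simp only [Pi.smul_apply, smul_eq_mul]; ring

/-- The operator `D = -d²/dt² + V` in `L²[0, l]` with Dirichlet conditions at `0` and `l`. -/
def dirichletOp (l : ℝ) (V : ℝ → ℝ) : EdgeSpace l →ₗ.[ℂ] EdgeSpace l :=
  (dirichletGraph l V).toLinearPMap

theorem ae_potential {a b : ℝ} (hab : a < b) {V : ℝ → ℝ} {f g h : ℝ → ℂ} {φ ψ : ℝ → ℂ}
    (H : IsH2 a b f g h) (h0 : φ =ᵐ[volume.restrict (Set.Icc a b)] 0)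
    (h1 : φ =ᵐ[volume.restrict (Set.Icc a b)] f)
    (h2 : ψ =ᵐ[volume.restrict (Set.Icc a b)] (fun t => -h t + (V t : ℂ) * f t)) :
    ψ =ᵐ[volume.restrict (Set.Icc a b)] 0 := by
  have hf := h1.symm.trans h0
  filter_upwards [h2, hf, H.ae_zero hab hf] with t e1 e2 e3
  simp [e1, e2, e3]

theorem dirichletOp_graph {l : ℝ} (hl : 0 < l) (V : ℝ → ℝ) :
    (dirichletOp l V).graph = dirichletGraph l V := by
  refine Submodule.toLinearPMap_graph_eq _ ?_
  rintro ⟨x, y⟩ ⟨f, g, h, H, h1, h2, -, -⟩ rfl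
  exact Lp.ext ((ae_potential hl H (Lp.coeFn_zero _ _ _) h1 h2).trans (Lp.coeFn_zero _ _ _).symm)

/-- The eigenvalues `μ₀ < μ₁ < μ₂ < …` of the Dirichlet operator, in increasing order. -/
def dirichletEigenvalue (l : ℝ) (V : ℝ → ℝ) : ℕ → ℝ
  | 0 => sInf {x : ℝ | IsEigenvalue (dirichletOp l V) x}
  | k + 1 => sInf {x : ℝ | IsEigenvalue (dirichletOp l V) x ∧ dirichletEigenvalue l V k < x}

/-! ### The Hamiltonian `Λ` on the square lattice -/

/-- The edge `(m, n, right)` joins the node `(m, n)` to `(m + 1, n)`, the edge `(m, n, up)` joins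
`(m, n)` to `(m, n + 1)`. -/
inductive Dir
  | right
  | up

/-- The edges of the square lattice, labelled by their initial node and direction. -/
abbrev Edge : Type := ℤ × ℤ × Dir

/-- The Hilbert space of the lattice, the orthogonal sum of `L²[0, l]` over all edges. -/
abbrev LatticeSpace (l : ℝ) : Type := lp (fun _ : Edge => EdgeSpace l) 2

/-- The phase `exp (i π k θ)`. -/
def phase (θ : ℝ) (k : ℤ) : ℂ := Complex.exp (((Real.pi * k * θ : ℝ) : ℂ) * Complex.I)

/-- The conditions at all the nodes: `f e`, `g e` are the component on the edge `e` and its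
derivative. -/
structure NodeConditions (l θ α β : ℝ) (f g : Edge → ℝ → ℂ) : Prop where
  up_zero : ∀ m n, f (m, n, .right) 0 = (β : ℂ)⁻¹ * f (m, n, .up) 0
  right_end : ∀ m n, f (m, n, .right) 0 = phase θ (-n) * f (m - 1, n, .right) l
  up_end : ∀ m n, f (m, n, .right) 0 = (β : ℂ)⁻¹ * (phase θ m * f (m, n - 1, .up) l)
  deriv : ∀ m n, g (m, n, .right) 0 + β * g (m, n, .up) 0
      - phase θ (-n) * g (m - 1, n, .right) l - β * (phase θ m * g (m, n - 1, .up) l)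
    = α * f (m, n, .right) 0

/-- The graph of `Λ`. -/
def latticeGraph (l : ℝ) (V : ℝ → ℝ) (θ α β : ℝ) :
    Submodule ℂ (LatticeSpace l × LatticeSpace l) where
  carrier := {p | ∃ f g h : Edge → ℝ → ℂ, (∀ e, IsH2 0 l (f e) (g e) (h e)) ∧
    (∀ e, p.1 e =ᵐ[volume.restrict (Set.Icc 0 l)] f e) ∧
    (∀ e, p.2 e =ᵐ[volume.restrict (Set.Icc 0 l)] (fun t => -h e t + (V t : ℂ) * f e t)) ∧
    NodeConditions l θ α β f g}
  zero_mem' := ⟨0, 0, 0, fun _ => IsH2.zero, fun _ => Lp.coeFn_zero _ _ _,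
    fun _ => (Lp.coeFn_zero _ _ _).trans (by simp [Filter.EventuallyEq]),
    ⟨by simp, by simp, by simp, by simp⟩⟩
  add_mem' := by
    rintro p q ⟨f, g, h, H, h1, h2, h3⟩ ⟨f', g', h', H', h1', h2', h3'⟩
    refine ⟨f + f', g + g', h + h', fun e => (H e).add (H' e), fun e => ?_, fun e => ?_, ?_⟩
    · exact (Lp.coeFn_add _ _).trans ((h1 e).add (h1' e))
    · refine (Lp.coeFn_add _ _).trans
        (((h2 e).add (h2' e)).trans (Filter.Eventually.of_forall fun t => ?_))
      simp only [Pi.add_apply]; ring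
    · refine ⟨fun m n => ?_, fun m n => ?_, fun m n => ?_, fun m n => ?_⟩ <;>
        simp only [Pi.add_apply]
      · linear_combination h3.up_zero m n + h3'.up_zero m n
      · linear_combination h3.right_end m n + h3'.right_end m n
      · linear_combination h3.up_end m n + h3'.up_end m n
      · linear_combination h3.deriv m n + h3'.deriv m n
  smul_mem' := by
    rintro c p ⟨f, g, h, H, h1, h2, h3⟩
    refine ⟨c • f, c • g, c • h, fun e => (H e).smul c, fun e => ?_, fun e => ?_, ?_⟩
    · exact (Lp.coeFn_smul _ _).trans ((h1 e).const_smul c)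
    · refine (Lp.coeFn_smul _ _).trans
        (((h2 e).const_smul c).trans (Filter.Eventually.of_forall fun t => ?_))
      simp only [Pi.smul_apply, smul_eq_mul]; ring
    · refine ⟨fun m n => ?_, fun m n => ?_, fun m n => ?_, fun m n => ?_⟩ <;>
        simp only [Pi.smul_apply, smul_eq_mul]
      · linear_combination c * h3.up_zero m n
      · linear_combination c * h3.right_end m n
      · linear_combination c * h3.up_end m n
      · linear_combination c * h3.deriv m n

/-- The Hamiltonian `Λ`: it acts as `-d²/dt² + V` on each edge, on the functions that satisfy the
magnetic `δ`-like conditions at the nodes. -/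
def latticeOp (l : ℝ) (V : ℝ → ℝ) (θ α β : ℝ) : LatticeSpace l →ₗ.[ℂ] LatticeSpace l :=
  (latticeGraph l V θ α β).toLinearPMap

theorem latticeOp_graph {l : ℝ} (hl : 0 < l) (V : ℝ → ℝ) (θ α β : ℝ) :
    (latticeOp l V θ α β).graph = latticeGraph l V θ α β := by
  refine Submodule.toLinearPMap_graph_eq _ ?_
  rintro ⟨x, y⟩ ⟨f, g, h, H, h1, h2, -⟩ rfl
  refine lp.ext (funext fun e => Lp.ext ?_)
  exact (ae_potential hl (H e) (Lp.coeFn_zero _ _ _) (h1 e) (h2 e)).trans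
    (Lp.coeFn_zero _ _ _).symm

/-! ### The Kronig–Penney Hamiltonian `P` -/

/-- The `l`-periodic extension of the restriction of `V` to `[0, l)`. -/
def periodicExtension (l : ℝ) (V : ℝ → ℝ) (t : ℝ) : ℝ := V (l * Int.fract (t / l))

/-- The Hilbert space `L²(ℝ)`. -/
abbrev LineSpace : Type := Lp ℂ 2 (volume : Measure ℝ)

/-- The period cell `[k l, (k + 1) l]`. -/
abbrev cell (l : ℝ) (k : ℤ) : Set ℝ := Set.Icc (k * l) ((k + 1) * l)

/-- The graph of `P`. On each cell the function is `f k ∈ H²`, with derivative `g k`; at the point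
`k l` the function is continuous and its derivative jumps by `α / (1 + β²)` times its value. (As
the function and its image are in `L²(ℝ)` and `V` is square integrable, the second derivative is
then globally square integrable.) -/
def kronigPenneyGraph (l : ℝ) (V : ℝ → ℝ) (α β : ℝ) : Submodule ℂ (LineSpace × LineSpace) where
  carrier := {p | ∃ f g h : ℤ → ℝ → ℂ, (∀ k : ℤ, IsH2 (k * l) ((k + 1) * l) (f k) (g k) (h k)) ∧
    (∀ k : ℤ, p.1 =ᵐ[volume.restrict (cell l k)] f k) ∧
    (∀ k : ℤ, p.2 =ᵐ[volume.restrict (cell l k)]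
      (fun t => -h k t + (periodicExtension l V t : ℂ) * f k t)) ∧
    (∀ k : ℤ, f k (k * l) = f (k - 1) (k * l)) ∧
    (∀ k : ℤ, g k (k * l) = g (k - 1) (k * l) + (α / (1 + β ^ 2) : ℝ) * f (k - 1) (k * l))}
  zero_mem' := ⟨0, 0, 0, fun _ => IsH2.zero, fun _ => ae_restrict_of_ae (Lp.coeFn_zero _ _ _),
    fun _ => (Filter.EventuallyEq.restrict (Lp.coeFn_zero _ _ _)).trans (by simp [Filter.EventuallyEq]),
    by simp, by simp⟩
  add_mem' := by
    rintro p q ⟨f, g, h, H, h1, h2, h3, h4⟩ ⟨f', g', h', H', h1', h2', h3', h4'⟩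
    refine ⟨f + f', g + g', h + h', fun e => (H e).add (H' e), fun e => ?_, fun e => ?_,
      fun e => ?_, fun e => ?_⟩
    · exact (Filter.EventuallyEq.restrict (Lp.coeFn_add _ _)).trans ((h1 e).add (h1' e))
    · refine (Filter.EventuallyEq.restrict (Lp.coeFn_add _ _)).trans
        (((h2 e).add (h2' e)).trans (Filter.Eventually.of_forall fun t => ?_))
      simp only [Pi.add_apply]; ring
    · simp only [Pi.add_apply]; linear_combination h3 e + h3' e
    · simp only [Pi.add_apply]; linear_combination h4 e + h4' e
  smul_mem' := by
    rintro c p ⟨f, g, h, H, h1, h2, h3, h4⟩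
    refine ⟨c • f, c • g, c • h, fun e => (H e).smul c, fun e => ?_, fun e => ?_,
      fun e => ?_, fun e => ?_⟩
    · exact (Filter.EventuallyEq.restrict (Lp.coeFn_smul _ _)).trans ((h1 e).const_smul c)
    · refine (Filter.EventuallyEq.restrict (Lp.coeFn_smul _ _)).trans
        (((h2 e).const_smul c).trans (Filter.Eventually.of_forall fun t => ?_))
      simp only [Pi.smul_apply, smul_eq_mul]; ring
    · simp only [Pi.smul_apply, smul_eq_mul]; linear_combination c * h3 e
    · simp only [Pi.smul_apply, smul_eq_mul]; linear_combination c * h4 e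

/-- The Kronig–Penney Hamiltonian `P = -d²/dt² + W + α / (1 + β²) ∑ₖ δ(t - k l)` in `L²(ℝ)`, with
`W` the periodic extension of `V`. -/
def kronigPenneyOp (l : ℝ) (V : ℝ → ℝ) (α β : ℝ) : LineSpace →ₗ.[ℂ] LineSpace :=
  (kronigPenneyGraph l V α β).toLinearPMap

theorem iUnion_cell {l : ℝ} (hl : 0 < l) : ⋃ k : ℤ, cell l k = Set.univ := by
  refine Set.eq_univ_of_forall fun t => Set.mem_iUnion.mpr ⟨⌊t / l⌋, ?_, ?_⟩
  · exact (le_div_iff₀ hl).mp (Int.floor_le _)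
  · exact (div_le_iff₀ hl).mp (Int.lt_floor_add_one _).le

theorem kronigPenneyOp_graph {l : ℝ} (hl : 0 < l) (V : ℝ → ℝ) (α β : ℝ) :
    (kronigPenneyOp l V α β).graph = kronigPenneyGraph l V α β := by
  refine Submodule.toLinearPMap_graph_eq _ ?_
  rintro ⟨x, y⟩ ⟨f, g, h, H, h1, h2, -, -⟩ rfl
  refine Lp.ext (Filter.EventuallyEq.trans ?_ (Lp.coeFn_zero _ _ _).symm)
  have key : y =ᵐ[volume.restrict (⋃ k : ℤ, cell l k)] (0 : ℝ → ℂ) := by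
    refine (ae_restrict_iUnion_iff _ _).mpr fun k => ?_
    exact ae_potential (V := periodicExtension l V) (by nlinarith) (H k)
      (ae_restrict_of_ae (Lp.coeFn_zero _ _ _)) (h1 k) (h2 k)
  rwa [iUnion_cell hl, Measure.restrict_univ] at key

/-! ### The discrete magnetic Laplacian -/

/-- The Hilbert space `ℓ²(ℤ²)`. -/
abbrev NodeSpace : Type := lp (fun _ : ℤ × ℤ => ℂ) 2

theorem memℓp_weightedShift (c : ℤ × ℤ → ℂ) (hc : ∀ x, ‖c x‖ = 1) (e : ℤ × ℤ ≃ ℤ × ℤ)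
    (g : NodeSpace) : Memℓp (fun x => c x * g (e x)) 2 := by
  refine memℓp_gen ?_
  have h := (lp.memℓp g).summable (by norm_num)
  simpa [hc, Function.comp_def] using e.summable_iff.mpr h

/-- The unitary operator `(T g)ₓ = c x * g (e x)`, for a bijection `e` and phases `c`. -/
def weightedShift (c : ℤ × ℤ → ℂ) (hc : ∀ x, ‖c x‖ = 1) (e : ℤ × ℤ ≃ ℤ × ℤ) :
    NodeSpace →L[ℂ] NodeSpace :=
  LinearMap.mkContinuous
    { toFun := fun g => ⟨fun x => c x * g (e x), memℓp_weightedShift c hc e g⟩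
      map_add' := by
        intro g g'
        exact lp.ext (funext fun x => mul_add _ _ _)
      map_smul' := by
        intro a g
        exact lp.ext (funext fun x => mul_left_comm _ _ _) } 1 (by
    intro g
    have h2 : 0 < (2 : ℝ≥0∞).toReal := by norm_num
    rw [one_mul, lp.norm_eq_tsum_rpow h2, lp.norm_eq_tsum_rpow h2]
    refine le_of_eq (congrArg (· ^ (1 / (2 : ℝ≥0∞).toReal)) ?_)
    simpa [hc] using e.tsum_eq (fun x => ‖g x‖ ^ (2 : ℝ≥0∞).toReal))

theorem norm_phase (θ : ℝ) (k : ℤ) : ‖phase θ k‖ = 1 := Complex.norm_exp_ofReal_mul_I _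

/-- Translation of `ℤ²` by `(a, b)`. -/
def translate (a b : ℤ) : ℤ × ℤ ≃ ℤ × ℤ := Equiv.addRight (a, b)

/-- The discrete magnetic Laplacian `M(θ, β)` in `ℓ²(ℤ²)`. -/
def magneticLaplacian (θ β : ℝ) : NodeSpace →L[ℂ] NodeSpace :=
  weightedShift (fun x => phase θ x.2) (fun _ => norm_phase _ _) (translate 1 0)
    + weightedShift (fun x => phase θ (-x.2)) (fun _ => norm_phase _ _) (translate (-1) 0)
    + ((β ^ 2 : ℝ) : ℂ) •
      (weightedShift (fun x => phase θ (-x.1)) (fun _ => norm_phase _ _) (translate 0 1)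
        + weightedShift (fun x => phase θ x.1) (fun _ => norm_phase _ _) (translate 0 (-1)))

theorem magneticLaplacian_apply (θ β : ℝ) (g : NodeSpace) (m n : ℤ) :
    magneticLaplacian θ β g (m, n) =
      phase θ n * g (m + 1, n) + phase θ (-n) * g (m - 1, n)
        + ((β ^ 2 : ℝ) : ℂ) * (phase θ (-m) * g (m, n + 1) + phase θ m * g (m, n - 1)) := by
  change phase θ n * g ((m, n) + (1, 0)) + phase θ (-n) * g ((m, n) + (-1, 0))
    + ((β ^ 2 : ℝ) : ℂ) * (phase θ (-m) * g ((m, n) + (0, 1)) + phase θ m * g ((m, n) + (0, -1))) = _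
  simp [sub_eq_add_neg]

/-! ### The function `η` and the set `Σ` -/

/-- The solution `u` of `-u'' + V u = z u` on `[0, l]` with `u(0) = c₀`, `u'(0) = c₁`, as the pair
`(u, u')`. -/
def cauchySolution (l : ℝ) (V : ℝ → ℝ) (z c₀ c₁ : ℂ) : (ℝ → ℂ) × (ℝ → ℂ) :=
  Classical.epsilon fun p =>
    IsH2 0 l p.1 p.2 (fun t => ((V t : ℂ) - z) * p.1 t) ∧ p.1 0 = c₀ ∧ p.2 0 = c₁

/-- The entire function `η(z) = (1 + β²) (u₁'(l; z) + u₂(l; z)) + α u₁(l; z)`, where `u₁`, `u₂` are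
the solutions with `u₁(0) = 0`, `u₁'(0) = 1` and `u₂(0) = 1`, `u₂'(0) = 0`. -/
def eta (l : ℝ) (V : ℝ → ℝ) (α β : ℝ) (z : ℂ) : ℂ :=
  (1 + (β : ℂ) ^ 2) * ((cauchySolution l V z 0 1).2 l + (cauchySolution l V z 1 0).1 l)
    + α * (cauchySolution l V z 0 1).1 l

/-- The part `Σ = η⁻¹(spec M(θ, β))` of the spectrum of `Λ`. -/
def sigmaPart (l : ℝ) (V : ℝ → ℝ) (θ α β : ℝ) : Set ℂ :=
  eta l V α β ⁻¹' spectrum ℂ (magneticLaplacian θ β)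

end QuantumGraph

end

noncomputable section

set_option linter.unusedSectionVars false

namespace QuantumGraph

/-! ### Products of primitives -/

section Primitive

variable {a b : ℝ} {F G φ γ : ℝ → ℂ}

/-! Everything is read off one entire function, the discriminant `discC v a z`, which is u₁'(l; z) +
u₂(l; z) + a u₁(l; z) with a = α/(1+β²); η is 1+β² times it.

For the Kronig–Penney operator, passing from one cell to the next multiplies the pair (value,
derivative) by a monodromy matrix whose determinant is one (`wronskian_eq_one`) and whose trace is
the discriminant. Bloch waves with slowly decaying weights give spectrum when the trace is real and
lies in [-2, 2]; otherwise the recursion over the cells can be inverted by Cayley–Hamilton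
(`mem_spec_kronigPenneyOp_iff`).

For integer θ the phases of M(θ, β) are removed by the gauge factors exp(±iπθmn), and M becomes
multiplication by 2 cos + 2β² cos on the torus. Its spectrum is [-2(1+β²), 2(1+β²)], so Σ is
described by the same condition on the discriminant (`mem_sigmaPart_iff`). It has no eigenvectors,
because the level sets of the symbol are null (`eq_zero_of_magneticLaplacian_eq`).

On the lattice, as long as u₁(l; z) ≠ 0, a solution is determined by its values g at the nodes, and
the condition on the derivatives turns into (M - η(z)) g = data (`node_defect`). Hence outside the
zeros of u₁(l; ·) the spectrum of Λ is Σ. At a zero there is an eigenvector living on a single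
plaquette (`exists_loop_eigenvector`). All eigenvectors vanish at the nodes since M has none, so by
Green's formula they are orthogonal to the solutions built from node values; the Weyl sequences for
Σ therefore live in the complement of the eigenvectors and show that limits of points of Σ off the
Dirichlet spectrum are in the continuous spectrum (`mem_continuousSpec_latticeOp`). Adding the
locally finite Dirichlet spectrum to a set does not destroy the infinitude of its gaps.

At μₖ the discriminant is s + 1/s with s = u₁'(l), whatever α is. So its modulus is at least 2, and
if it exceeds 2 then μₖ is interior to a gap. Equality means s = ±1; then u₁'² - (V - μₖ) u₁² has
equal values at both ends while its derivative -V' u₁² has a fixed sign, which forces u₁ = 0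
(`two_lt_abs_disc`). This is (B).

If the gap of P₀ at μₖ is closed, the discriminant for a = 0 equals ±2 there and has a critical
point (`critical_of_gapClosed`). Adding a u₁(l; ·), which has a simple zero at μₖ, makes the
derivative nonzero, so the discriminant crosses the level ±2 and μₖ is a band edge. For V = 0 the
discriminant is 2 cos(√x l), which never exceeds 2 in modulus for x > 0. This is (C). -/

theorem absolutelyContinuous_primitive (hab : a ≤ b) (hφ : IntegrableOn φ (Set.Icc a b)) :
    AbsolutelyContinuousOnInterval (fun x => ∫ v in a..x, φ v) a b := by
  have hi : IntervalIntegrable φ volume a b :=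
    (intervalIntegrable_iff_integrableOn_Icc_of_le hab).mpr hφ
  -- The increments of the primitive of `φ` are dominated by those of the primitive of `‖φ‖`, so
  -- absolute continuity passes over by squeezing.
  have h := hi.norm.absolutelyContinuousOnInterval_intervalIntegral (c := a) Set.left_mem_uIcc
  refine squeeze_zero' (Filter.Eventually.of_forall fun _ =>
    Finset.sum_nonneg fun _ _ => dist_nonneg) ?_ h
  rw [Filter.eventually_inf_principal]
  refine Filter.Eventually.of_forall fun E hE => Finset.sum_le_sum fun i hi' => ?_
  obtain ⟨h1, h2⟩ := hE.1 i hi'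
  have key : ∀ {x}, x ∈ Set.uIcc a b → IntervalIntegrable φ volume a x := fun hx =>
    hi.mono_set (Set.uIcc_subset_uIcc Set.left_mem_uIcc hx)
  rw [dist_comm, dist_eq_norm, dist_comm, dist_eq_norm,
    intervalIntegral.integral_interval_sub_left (key h2) (key h1),
    intervalIntegral.integral_interval_sub_left (key h2).norm (key h1).norm]
  exact intervalIntegral.norm_integral_le_abs_integral_norm

/-- The product rule for absolutely continuous functions, in integrated form. -/
theorem mul_eq_of_primitive (hφ : IntegrableOn φ (Set.Icc a b)) (hγ : IntegrableOn γ (Set.Icc a b))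
    (hF : ∀ t ∈ Set.Icc a b, F t = F a + ∫ s in a..t, φ s)
    (hG : ∀ t ∈ Set.Icc a b, G t = G a + ∫ s in a..t, γ s) {t : ℝ} (ht : t ∈ Set.Icc a b) :
    F t * G t = F a * G a + ∫ s in a..t, (φ s * G s + F s * γ s) := by
  have hab : a ≤ b := ht.1.trans ht.2
  have cF := IsH2.continuousOn_of_eq hφ hF
  have cG := IsH2.continuousOn_of_eq hγ hG
  have hint : IntegrableOn (fun s => φ s * G s + F s * γ s) (Set.Icc a b) := by
    refine IntegrableOn.add ?_ ?_
    · exact hφ.mul_continuousOn cG isCompact_Icc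
    · exact hγ.continuousOn_mul cF isCompact_Icc
  set F' : ℝ → ℂ := fun t => F a + ∫ s in a..t, φ s with hF'
  set G' : ℝ → ℂ := fun t => G a + ∫ s in a..t, γ s with hG'
  have cst : ∀ c : ℂ, AbsolutelyContinuousOnInterval (fun _ : ℝ => c) a b := fun c =>
    (LipschitzOnWith.of_dist_le_mul (K := 0) (by simp)).absolutelyContinuousOnInterval
  have aF : AbsolutelyContinuousOnInterval F' a b :=
    (cst _).add (absolutelyContinuous_primitive hab hφ)
  have aG : AbsolutelyContinuousOnInterval G' a b :=
    (cst _).add (absolutelyContinuous_primitive hab hγ)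
  have aH := (aF.smul aG).sub (absolutelyContinuous_primitive hab hint)
  have ii : ∀ {v : ℝ → ℂ}, IntegrableOn v (Set.Icc a b) → IntervalIntegrable v volume a b :=
    fun hv => (intervalIntegrable_iff_integrableOn_Icc_of_le hab).mpr hv
  have hl : a ∈ Set.uIcc a b := Set.left_mem_uIcc
  -- The product minus the candidate integral is absolutely continuous with derivative zero almost
  -- everywhere, hence constant.
  obtain ⟨C, hC⟩ := aH.const_of_ae_hasDerivAt_zero (by
    filter_upwards [(ii hφ).ae_hasDerivAt_integral, (ii hγ).ae_hasDerivAt_integral,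
      (ii hint).ae_hasDerivAt_integral] with x h1 h2 h3 hx
    have e1 := (h1 hx a hl).const_add (F a)
    have e2 := (h2 hx a hl).const_add (G a)
    have e3 := (e1.mul e2).sub (h3 hx a hl)
    rw [Set.uIcc_of_le hab] at hx
    refine e3.congr_deriv ?_
    rw [← hF x hx, ← hG x hx]; ring)
  have ha : a ∈ Set.Icc a b := ⟨le_rfl, hab⟩
  rw [Set.uIcc_of_le hab] at hC
  have h1 := hC t ht
  have h2 := hC a ha
  change F' t * G' t - ∫ v in a..t, (φ v * G v + F v * γ v) = C at h1
  change F' a * G' a - ∫ v in a..a, (φ v * G v + F v * γ v) = C at h2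
  rw [show F' t = F t from (hF t ht).symm, show G' t = G t from (hG t ht).symm] at h1
  rw [show F' a = F a from (hF a ha).symm, show G' a = G a from (hG a ha).symm,
    intervalIntegral.integral_same, sub_zero] at h2
  rw [← h2] at h1
  linear_combination h1

end Primitive

namespace IsH2

variable {a b : ℝ} {f g h f₁ g₁ h₁ : ℝ → ℂ}

theorem congr_third (H : IsH2 a b f g h) (e : h =ᵐ[volume.restrict (Set.Icc a b)] h₁) :
    IsH2 a b f g h₁ := by
  refine ⟨(memLp_congr_ae e).mp H.memLp, H.eq_fst, fun t ht => ?_⟩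
  rw [H.eq_snd t ht]
  congr 1
  refine intervalIntegral.integral_congr_ae_restrict ?_
  rw [Set.uIoc_of_le ht.1]
  exact ae_restrict_of_ae_restrict_of_subset
    (Set.Ioc_subset_Icc_self.trans (Set.Icc_subset_Icc_right ht.2)) e

theorem conj (H : IsH2 a b f g h) : IsH2 a b (fun t => (starRingEnd ℂ) (f t))
    (fun t => (starRingEnd ℂ) (g t)) (fun t => (starRingEnd ℂ) (h t)) := by
  refine ⟨H.memLp.star, fun t ht => ?_, fun t ht => ?_⟩
  · rw [H.eq_fst t ht, map_add]
    congr 1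
    simp only [intervalIntegral, map_sub, integral_conj]
  · rw [H.eq_snd t ht, map_add]
    congr 1
    simp only [intervalIntegral, map_sub, integral_conj]

/-- Green's formula. -/
theorem integral_wronskian (H : IsH2 a b f g h) (H₁ : IsH2 a b f₁ g₁ h₁) (hab : a ≤ b) :
    ∫ s in a..b, (f s * h₁ s - h s * f₁ s)
      = (f b * g₁ b - g b * f₁ b) - (f a * g₁ a - g a * f₁ a) := by
  have hb : b ∈ Set.Icc a b := ⟨hab, le_rfl⟩
  have e1 := mul_eq_of_primitive H.integrableOn_snd H₁.integrableOn H.eq_fst H₁.eq_snd hb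
  have e2 := mul_eq_of_primitive H.integrableOn H₁.integrableOn_snd H.eq_snd H₁.eq_fst hb
  have i1 : IntervalIntegrable (fun s => g s * g₁ s + f s * h₁ s) volume a b := by
    rw [intervalIntegrable_iff_integrableOn_Icc_of_le hab]
    exact (H.integrableOn_snd.mul_continuousOn H₁.continuousOn_snd isCompact_Icc).add
      (H₁.integrableOn.continuousOn_mul H.continuousOn_fst isCompact_Icc)
  have i2 : IntervalIntegrable (fun s => h s * f₁ s + g s * g₁ s) volume a b := by
    rw [intervalIntegrable_iff_integrableOn_Icc_of_le hab]
    exact (H.integrableOn.mul_continuousOn H₁.continuousOn_fst isCompact_Icc).add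
      (H₁.integrableOn_snd.continuousOn_mul H.continuousOn_snd isCompact_Icc)
  rw [e1, e2, show (fun s => f s * h₁ s - h s * f₁ s) =
    fun s => (g s * g₁ s + f s * h₁ s) - (h s * f₁ s + g s * g₁ s) by funext s; ring,
    intervalIntegral.integral_sub i1 i2]
  ring

end IsH2

/-! ### Primitives of square integrable functions -/

/-- Lebesgue measure on `[0, l]`. -/
abbrev edgeMeasure (l : ℝ) : Measure ℝ := volume.restrict (Set.Icc (0 : ℝ) l)

section Edge

variable {l : ℝ} [hl : Fact (0 < l)]

theorem EdgeSpace.integrableOn (h : EdgeSpace l) : IntegrableOn h (Set.Icc 0 l) :=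
  (Lp.memLp h).integrable (by norm_num)

theorem EdgeSpace.intervalIntegrable (h : EdgeSpace l) {t : ℝ} (ht : t ∈ Set.Icc 0 l) :
    IntervalIntegrable h volume 0 t :=
  IsH2.intervalIntegrable_of h.integrableOn ht

theorem memLp_of_continuousOn {F : ℝ → ℂ} (hF : ContinuousOn F (Set.Icc 0 l)) {p : ℝ≥0∞} :
    MemLp F p (edgeMeasure l) := by
  obtain ⟨C, hC⟩ := isCompact_Icc.exists_bound_of_continuousOn hF
  refine MemLp.of_bound (hF.aestronglyMeasurable measurableSet_Icc) C ?_
  exact (ae_restrict_iff' measurableSet_Icc).mpr (Filter.Eventually.of_forall hC)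

theorem memLp_mul_continuousOn {w F : ℝ → ℂ} (hw : MemLp w 2 (edgeMeasure l))
    (hF : ContinuousOn F (Set.Icc 0 l)) : MemLp (fun t => w t * F t) 2 (edgeMeasure l) :=
  (memLp_of_continuousOn hF (p := ∞)).mul' hw

theorem EdgeSpace.norm_sq_eq (h : EdgeSpace l) : ‖h‖ ^ 2 = ∫ s in Set.Icc 0 l, ‖h s‖ ^ 2 := by
  have h1 : ‖h‖ ^ 2 = RCLike.re (inner ℂ h h) := norm_sq_eq_re_inner h
  rw [h1, L2.inner_def, ← integral_re (L2.integrable_inner (𝕜 := ℂ) h h)]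
  refine integral_congr_ae (Filter.Eventually.of_forall fun s => ?_)
  exact (norm_sq_eq_re_inner (𝕜 := ℂ) (h s)).symm

/-- The Cauchy–Schwarz inequality on `[0, t]`. -/
theorem integral_mul_norm_le (w : EdgeSpace l) {F : ℝ → ℂ} (hF : ContinuousOn F (Set.Icc 0 l))
    {t : ℝ} (ht : t ∈ Set.Icc 0 l) :
    ∫ s in 0..t, ‖w s‖ * ‖F s‖ ≤ ‖w‖ * √(∫ s in 0..t, ‖F s‖ ^ 2) := by
  have hsub : Set.Ioc 0 t ⊆ Set.Icc 0 l :=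
    Set.Ioc_subset_Icc_self.trans (Set.Icc_subset_Icc_right ht.2)
  have hle : volume.restrict (Set.Ioc 0 t) ≤ edgeMeasure l := Measure.restrict_mono hsub le_rfl
  have h2 : ENNReal.ofReal 2 = 2 := by norm_num
  have hw : MemLp w (ENNReal.ofReal 2) (volume.restrict (Set.Ioc 0 t)) := by
    rw [h2]; exact (Lp.memLp w).mono_measure hle
  have hF' : MemLp F (ENNReal.ofReal 2) (volume.restrict (Set.Ioc 0 t)) := by
    rw [h2]; exact (memLp_of_continuousOn hF).mono_measure hle
  have key := integral_mul_norm_le_Lp_mul_Lq Real.HolderConjugate.two_two hw hF'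
  rw [intervalIntegral.integral_of_le ht.1, intervalIntegral.integral_of_le ht.1]
  refine key.trans ?_
  simp only [Real.rpow_ofNat, ← Real.sqrt_eq_rpow]
  gcongr
  refine Real.sqrt_le_iff.mpr ⟨norm_nonneg _, ?_⟩
  rw [w.norm_sq_eq]
  refine setIntegral_mono_set ?_ (Filter.Eventually.of_forall fun _ => sq_nonneg _) hsub.eventuallyLE
  exact (Lp.memLp w).integrable_norm_pow (p := 2) (by norm_num)

/-- The primitive of `h` that vanishes at `0`. -/
def primitive (h : EdgeSpace l) (t : ℝ) : ℂ := ∫ s in 0..t, h s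

/-- The second primitive of `h`, vanishing at `0` with its derivative. -/
def primitive₂ (h : EdgeSpace l) (t : ℝ) : ℂ := ∫ s in 0..t, primitive h s

theorem continuousOn_primitive (h : EdgeSpace l) : ContinuousOn (primitive h) (Set.Icc 0 l) :=
  IsH2.continuousOn_of_eq h.integrableOn fun t _ => by simp [primitive]

theorem continuousOn_primitive₂ (h : EdgeSpace l) : ContinuousOn (primitive₂ h) (Set.Icc 0 l) :=
  IsH2.continuousOn_of_eq (continuousOn_primitive h).integrableOn_Icc
    fun t _ => by simp [primitive₂]

theorem intervalIntegrable_primitive (h : EdgeSpace l) {t : ℝ} (ht : t ∈ Set.Icc 0 l) :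
    IntervalIntegrable (primitive h) volume 0 t :=
  IsH2.intervalIntegrable_of (continuousOn_primitive h).integrableOn_Icc ht

theorem isH2_primitive₂ (h : EdgeSpace l) : IsH2 0 l (primitive₂ h) (primitive h) h :=
  ⟨Lp.memLp h, fun t _ => by simp [primitive₂], fun t _ => by simp [primitive]⟩

theorem integral_congr_edge {f g : ℝ → ℂ} (e : f =ᵐ[edgeMeasure l] g) {t : ℝ}
    (ht : t ∈ Set.Icc 0 l) : ∫ s in 0..t, f s = ∫ s in 0..t, g s := by
  refine intervalIntegral.integral_congr_ae_restrict ?_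
  rw [Set.uIoc_of_le ht.1]
  exact ae_restrict_of_ae_restrict_of_subset
    (Set.Ioc_subset_Icc_self.trans (Set.Icc_subset_Icc_right ht.2)) e

theorem primitive_add (h h' : EdgeSpace l) {t : ℝ} (ht : t ∈ Set.Icc 0 l) :
    primitive (h + h') t = primitive h t + primitive h' t := by
  rw [primitive, integral_congr_edge (Lp.coeFn_add h h') ht]
  exact intervalIntegral.integral_add (h.intervalIntegrable ht) (h'.intervalIntegrable ht)

theorem primitive_smul (c : ℂ) (h : EdgeSpace l) {t : ℝ} (ht : t ∈ Set.Icc 0 l) :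
    primitive (c • h) t = c * primitive h t := by
  rw [primitive, integral_congr_edge (Lp.coeFn_smul c h) ht]
  exact intervalIntegral.integral_smul c h

theorem primitive₂_add (h h' : EdgeSpace l) {t : ℝ} (ht : t ∈ Set.Icc 0 l) :
    primitive₂ (h + h') t = primitive₂ h t + primitive₂ h' t := by
  rw [primitive₂, primitive₂, primitive₂, ← intervalIntegral.integral_add
    (intervalIntegrable_primitive h ht) (intervalIntegrable_primitive h' ht)]
  refine intervalIntegral.integral_congr fun s hs => primitive_add h h' ?_
  rw [Set.uIcc_of_le ht.1] at hs
  exact ⟨hs.1, hs.2.trans ht.2⟩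

theorem primitive₂_smul (c : ℂ) (h : EdgeSpace l) {t : ℝ} (ht : t ∈ Set.Icc 0 l) :
    primitive₂ (c • h) t = c * primitive₂ h t := by
  rw [primitive₂, primitive₂, ← smul_eq_mul, ← intervalIntegral.integral_smul]
  refine intervalIntegral.integral_congr fun s hs => primitive_smul c h ?_
  rw [Set.uIcc_of_le ht.1] at hs
  exact ⟨hs.1, hs.2.trans ht.2⟩

/-- A primitive of `w F` is controlled by the `L²` norm of `F` on `[0, t]`. -/
theorem norm_primitive₂_le_of_ae (h w : EdgeSpace l) {F : ℝ → ℂ}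
    (hF : ContinuousOn F (Set.Icc 0 l)) (e : h =ᵐ[edgeMeasure l] fun s => w s * F s) {t : ℝ}
    (ht : t ∈ Set.Icc 0 l) :
    ‖primitive₂ h t‖ ≤ l * (‖w‖ * √(∫ s in 0..t, ‖F s‖ ^ 2)) := by
  have h1 : ∀ s ∈ Set.uIoc 0 t, ‖primitive h s‖ ≤ ‖w‖ * √(∫ s in 0..t, ‖F s‖ ^ 2) := by
    intro s hs
    rw [Set.uIoc_of_le ht.1] at hs
    have hs' : s ∈ Set.Icc 0 l := ⟨hs.1.le, hs.2.trans ht.2⟩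
    rw [primitive, integral_congr_edge e hs']
    refine (intervalIntegral.norm_integral_le_integral_norm hs'.1).trans ?_
    simp only [norm_mul]
    refine (integral_mul_norm_le w hF hs').trans ?_
    gcongr
    refine intervalIntegral.integral_mono_interval le_rfl hs'.1 hs.2
      (Filter.Eventually.of_forall fun _ => sq_nonneg _) ?_
    refine ContinuousOn.intervalIntegrable ?_
    rw [Set.uIcc_of_le ht.1]
    exact ((hF.mono (Set.Icc_subset_Icc_right ht.2)).norm.pow 2)
  have h2 := intervalIntegral.norm_integral_le_of_norm_le_const h1
  refine h2.trans ?_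
  rw [sub_zero, abs_of_nonneg ht.1, mul_comm]
  have := ht.2
  gcongr

theorem norm_primitive_le (h : EdgeSpace l) {t : ℝ} (ht : t ∈ Set.Icc 0 l) :
    ‖primitive h t‖ ≤ √l * ‖h‖ := by
  refine (intervalIntegral.norm_integral_le_integral_norm ht.1).trans ?_
  have := integral_mul_norm_le h (F := fun _ => 1) continuousOn_const ht
  simp only [norm_one, mul_one, one_pow, intervalIntegral.integral_const, sub_zero, smul_eq_mul]
    at this
  refine this.trans ?_
  rw [mul_comm]
  have := ht.2
  gcongr

theorem norm_primitive₂_le (h : EdgeSpace l) {t : ℝ} (ht : t ∈ Set.Icc 0 l) :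
    ‖primitive₂ h t‖ ≤ l * √l * ‖h‖ := by
  have := norm_primitive₂_le_of_ae h h (F := fun _ => 1) continuousOn_const
    (Filter.Eventually.of_forall fun s => by simp) ht
  simp only [norm_one, mul_one, one_pow, intervalIntegral.integral_const, sub_zero, smul_eq_mul]
    at this
  refine this.trans ?_
  have h1 : √t ≤ √l := Real.sqrt_le_sqrt ht.2
  have h0 := hl.out.le
  calc l * (‖h‖ * √t) ≤ l * (‖h‖ * √l) := by gcongr
    _ = _ := by ring

/-- Evaluation of the primitive at the end point. -/
def primitiveEnd : EdgeSpace l →L[ℂ] ℂ :=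
  LinearMap.mkContinuous
    { toFun := fun h => primitive h l
      map_add' := fun h h' => primitive_add h h' ⟨hl.out.le, le_rfl⟩
      map_smul' := fun c h => primitive_smul c h ⟨hl.out.le, le_rfl⟩ } (√l)
    fun h => norm_primitive_le h ⟨hl.out.le, le_rfl⟩

/-- Evaluation of the second primitive at the end point. -/
def primitiveEnd₂ : EdgeSpace l →L[ℂ] ℂ :=
  LinearMap.mkContinuous
    { toFun := fun h => primitive₂ h l
      map_add' := fun h h' => primitive₂_add h h' ⟨hl.out.le, le_rfl⟩
      map_smul' := fun c h => primitive₂_smul c h ⟨hl.out.le, le_rfl⟩ } (l * √l)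
    fun h => norm_primitive₂_le h ⟨hl.out.le, le_rfl⟩

theorem ae_edge {p : ℝ → Prop} (h : ∀ t ∈ Set.Icc 0 l, p t) : ∀ᵐ t ∂edgeMeasure l, p t :=
  (ae_restrict_iff' measurableSet_Icc).mpr (Filter.Eventually.of_forall h)

/-- The element `w F` of `L²`, for `w` in `L²` and `F` the second primitive of `h`. -/
def mulPrimitive₂ (w h : EdgeSpace l) : EdgeSpace l :=
  (memLp_mul_continuousOn (Lp.memLp w) (continuousOn_primitive₂ h)).toLp

theorem coeFn_mulPrimitive₂ (w h : EdgeSpace l) :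
    mulPrimitive₂ w h =ᵐ[edgeMeasure l] fun t => w t * primitive₂ h t :=
  MemLp.coeFn_toLp _

theorem norm_mulPrimitive₂_le (w h : EdgeSpace l) {C : ℝ}
    (hC : ∀ t ∈ Set.Icc 0 l, ‖primitive₂ h t‖ ≤ C) : ‖mulPrimitive₂ w h‖ ≤ C * ‖w‖ := by
  refine Lp.norm_le_mul_norm_of_ae_le_mul ?_
  filter_upwards [coeFn_mulPrimitive₂ w h, ae_edge hC] with t h1 h2
  rw [h1, norm_mul, mul_comm]
  gcongr

/-- The Volterra operator `h ↦ w · primitive₂ h`. -/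
def volterra (w : EdgeSpace l) : EdgeSpace l →L[ℂ] EdgeSpace l :=
  LinearMap.mkContinuous
    { toFun := mulPrimitive₂ w
      map_add' := fun h h' => by
        refine Lp.ext ?_
        filter_upwards [coeFn_mulPrimitive₂ w (h + h'), coeFn_mulPrimitive₂ w h,
          coeFn_mulPrimitive₂ w h', Lp.coeFn_add (mulPrimitive₂ w h) (mulPrimitive₂ w h'),
          ae_edge (l := l) fun t ht => primitive₂_add h h' ht] with t h1 h2 h3 h4 h5
        rw [h1, h4, Pi.add_apply, h2, h3, h5, mul_add]
      map_smul' := fun c h => by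
        refine Lp.ext ?_
        filter_upwards [coeFn_mulPrimitive₂ w (c • h), coeFn_mulPrimitive₂ w h,
          Lp.coeFn_smul c (mulPrimitive₂ w h),
          ae_edge (l := l) fun t ht => primitive₂_smul c h ht] with t h1 h2 h3 h4
        rw [h1, RingHom.id_apply, h3, Pi.smul_apply, h2, h4, smul_eq_mul]
        ring } (l * √l * ‖w‖)
    fun h => (norm_mulPrimitive₂_le w h fun t ht => norm_primitive₂_le h ht).trans_eq (by ring)

theorem coeFn_volterra (w h : EdgeSpace l) :
    volterra w h =ᵐ[edgeMeasure l] fun t => w t * primitive₂ h t :=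
  coeFn_mulPrimitive₂ w h

/-- Linearity in the potential makes `1 - volterra (v - z)` affine in `z`; this is the source of the
analytic dependence of the solutions on `z`. -/
theorem volterra_add_smul (w w' : EdgeSpace l) (c : ℂ) :
    volterra (w + c • w') = volterra w + c • volterra w' := by
  ext1 h
  refine Lp.ext ?_
  have e : (volterra w + c • volterra w') h = volterra w h + c • volterra w' h := rfl
  rw [e]
  filter_upwards [coeFn_volterra (w + c • w') h, coeFn_volterra w h, coeFn_volterra w' h,
    Lp.coeFn_add (volterra w h) (c • volterra w' h), Lp.coeFn_smul c (volterra w' h),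
    Lp.coeFn_add w (c • w'), Lp.coeFn_smul c w'] with t h1 h2 h3 h4 h5 h6 h7
  simp only [h1, h4, h6, Pi.add_apply, h2, h5, h7, Pi.smul_apply, h3, smul_eq_mul]
  ring

/-- By Cauchy–Schwarz on `[0, t]`, one application of `volterra w` costs a factor `l * ‖w‖` and
replaces the function by the square root of the integral of its square. The squares are thus bounded
by multiples of `t ^ n / n!`, and integration produces the next power. The square root of a
factorial in the denominator still beats every geometric growth. -/
theorem norm_primitive₂_volterra_pow_le (w h : EdgeSpace l) (n : ℕ) {t : ℝ}
    (ht : t ∈ Set.Icc 0 l) :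
    ‖primitive₂ ((volterra w ^ n) h) t‖ ≤
      l * √l * ‖h‖ * √(((l * ‖w‖) ^ 2 * t) ^ n / n.factorial) := by
  induction n generalizing t with
  | zero => simpa using norm_primitive₂_le h ht
  | succ n ih =>
    have h0 := hl.out.le
    rw [pow_succ', mul_apply_eq_comp]
    have h1 := norm_primitive₂_le_of_ae (volterra w ((volterra w ^ n) h)) w
      (continuousOn_primitive₂ _) (coeFn_volterra w _) ht
    refine h1.trans ?_
    have h2 : ∫ s in 0..t, ‖primitive₂ ((volterra w ^ n) h) s‖ ^ 2 ≤
        ∫ s in 0..t, (l * √l * ‖h‖) ^ 2 * ((l * ‖w‖) ^ 2) ^ n / n.factorial * s ^ n := by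
      refine intervalIntegral.integral_mono_on ht.1 ?_ ?_ fun s hs => ?_
      · refine ContinuousOn.intervalIntegrable ?_
        rw [Set.uIcc_of_le ht.1]
        exact ((continuousOn_primitive₂ _).mono (Set.Icc_subset_Icc_right ht.2)).norm.pow 2
      · exact (by fun_prop : Continuous _).intervalIntegrable _ _
      · have h3 := ih (t := s) ⟨hs.1, hs.2.trans ht.2⟩
        have h4 : 0 ≤ ((l * ‖w‖) ^ 2 * s) ^ n / n.factorial := by have := hs.1; positivity
        calc _ ≤ (l * √l * ‖h‖ * √(((l * ‖w‖) ^ 2 * s) ^ n / n.factorial)) ^ 2 := by gcongr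
          _ = _ := by rw [mul_pow, Real.sq_sqrt h4, mul_pow (_ ^ 2)]; ring
    have h5 : ∫ s in 0..t, (l * √l * ‖h‖) ^ 2 * ((l * ‖w‖) ^ 2) ^ n / n.factorial * s ^ n
        = (l * √l * ‖h‖) ^ 2 * (((l * ‖w‖) ^ 2) ^ n * t ^ (n + 1) / (n + 1).factorial) := by
      rw [intervalIntegral.integral_const_mul, integral_pow, Nat.factorial_succ]
      push_cast
      field_simp
      simp
    rw [h5] at h2
    have hA : 0 ≤ l * √l * ‖h‖ := by positivity
    calc l * (‖w‖ * √(∫ s in 0..t, ‖primitive₂ ((volterra w ^ n) h) s‖ ^ 2))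
        ≤ l * (‖w‖ * √((l * √l * ‖h‖) ^ 2
          * (((l * ‖w‖) ^ 2) ^ n * t ^ (n + 1) / (n + 1).factorial))) := by gcongr
      _ = (l * √l * ‖h‖) * ((l * ‖w‖) *
          √(((l * ‖w‖) ^ 2) ^ n * t ^ (n + 1) / (n + 1).factorial)) := by
        rw [Real.sqrt_mul (sq_nonneg _), Real.sqrt_sq hA]; ring
      _ = _ := by
        rw [← Real.sqrt_sq (show 0 ≤ l * ‖w‖ by positivity), ← Real.sqrt_mul (sq_nonneg _)]
        congr 2
        rw [Real.sqrt_sq (show 0 ≤ l * ‖w‖ by positivity)]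
        ring

/-- The operator `T = volterra w` need not be a contraction, but a high power of it is. Then `1 - T
^ (n + 1)` is invertible, and it is the product of `1 - T` with a commuting geometric sum. -/
theorem isUnit_one_sub_volterra (w : EdgeSpace l) : IsUnit (1 - volterra w) := by
  have h0 := hl.out.le
  have lim : Filter.Tendsto (fun n : ℕ => l * √l * ‖w‖ *
      √(((l * ‖w‖) ^ 2 * l) ^ n / n.factorial)) Filter.atTop (nhds 0) := by
    have := (FloorSemiring.tendsto_pow_div_factorial_atTop ((l * ‖w‖) ^ 2 * l)).sqrt.const_mul
      (l * √l * ‖w‖)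
    simpa using this
  obtain ⟨n, hn⟩ := (lim.eventually (gt_mem_nhds one_pos)).exists
  have hlt : ‖volterra w ^ (n + 1)‖ < 1 := by
    refine lt_of_le_of_lt (ContinuousLinearMap.opNorm_le_bound _ (by positivity) fun h => ?_) hn
    rw [pow_succ', mul_apply_eq_comp]
    have hb : ∀ t ∈ Set.Icc 0 l, ‖primitive₂ ((volterra w ^ n) h) t‖ ≤
        l * √l * ‖h‖ * √(((l * ‖w‖) ^ 2 * l) ^ n / n.factorial) := fun t ht => by
      refine (norm_primitive₂_volterra_pow_le w h n ht).trans ?_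
      have := ht.2
      have := ht.1
      gcongr
    exact (norm_mulPrimitive₂_le w _ hb).trans_eq (by ring)
  have hu := isUnit_one_sub_of_norm_lt_one hlt
  rw [← mul_neg_geom_sum] at hu
  have hc : Commute (1 - volterra w) (∑ i ∈ Finset.range (n + 1), volterra w ^ i) := by
    rw [Commute, SemiconjBy, mul_neg_geom_sum, geom_sum_mul_neg]
  exact (hc.isUnit_mul_iff.mp hu).1

end Edge

/-! ### Solutions of `-f'' + v f = z f + y` on an edge -/

section Edge

variable {l : ℝ} [hl : Fact (0 < l)]

/-- The constant function `1`. -/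
def oneFn : EdgeSpace l := (memLp_of_continuousOn (F := fun _ => 1) continuousOn_const).toLp

theorem coeFn_oneFn : (oneFn : EdgeSpace l) =ᵐ[edgeMeasure l] fun _ => 1 := MemLp.coeFn_toLp _

theorem memLp_mul_id (w : EdgeSpace l) : MemLp (fun t => w t * (t : ℂ)) 2 (edgeMeasure l) :=
  memLp_mul_continuousOn (Lp.memLp w) Complex.continuous_ofReal.continuousOn

/-- Multiplication by the independent variable. -/
def mulId : EdgeSpace l →L[ℂ] EdgeSpace l :=
  LinearMap.mkContinuous
    { toFun := fun w => (memLp_mul_id w).toLp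
      map_add' := fun w w' => by
        refine Lp.ext ?_
        filter_upwards [(memLp_mul_id (w + w')).coeFn_toLp, (memLp_mul_id w).coeFn_toLp,
          (memLp_mul_id w').coeFn_toLp, Lp.coeFn_add w w',
          Lp.coeFn_add (memLp_mul_id w).toLp (memLp_mul_id w').toLp] with t h1 h2 h3 h4 h5
        rw [h1, h5, Pi.add_apply, h2, h3, h4, Pi.add_apply, add_mul]
      map_smul' := fun c w => by
        refine Lp.ext ?_
        filter_upwards [(memLp_mul_id (c • w)).coeFn_toLp, (memLp_mul_id w).coeFn_toLp,
          Lp.coeFn_smul c w, Lp.coeFn_smul c (memLp_mul_id w).toLp] with t h1 h2 h3 h4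
        rw [h1, RingHom.id_apply, h4, Pi.smul_apply, h2, h3, Pi.smul_apply, smul_eq_mul,
          smul_eq_mul, mul_assoc] } l
    fun w => by
      refine Lp.norm_le_mul_norm_of_ae_le_mul ?_
      filter_upwards [(memLp_mul_id w).coeFn_toLp, ae_edge (l := l) (p := fun t => |t| ≤ l)
        fun t ht => by rw [abs_of_nonneg ht.1]; exact ht.2] with t h1 h2
      change ‖(memLp_mul_id w).toLp _ t‖ ≤ _
      rw [h1, norm_mul, mul_comm, Complex.norm_real, Real.norm_eq_abs]
      gcongr

theorem coeFn_mulId (w : EdgeSpace l) : mulId w =ᵐ[edgeMeasure l] fun t => w t * (t : ℂ) :=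
  (memLp_mul_id w).coeFn_toLp

variable (v : EdgeSpace l)

/-- The potential `v - z`. -/
def shifted (z : ℂ) : EdgeSpace l := v + (-z) • oneFn

theorem coeFn_shifted (z : ℂ) : shifted v z =ᵐ[edgeMeasure l] fun t => v t - z := by
  filter_upwards [Lp.coeFn_add v ((-z) • oneFn), Lp.coeFn_smul (-z) (oneFn : EdgeSpace l),
    coeFn_oneFn (l := l)] with t h1 h2 h3
  rw [shifted, h1, Pi.add_apply, h2, Pi.smul_apply, h3, smul_eq_mul]; ring

/-- The inverse of `1 - volterra (v - z)`. -/
def volterraInv (z : ℂ) : EdgeSpace l →L[ℂ] EdgeSpace l :=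
  Ring.inverse (1 - volterra (shifted v z))

theorem volterraInv_apply_eq_iff (z : ℂ) (x y : EdgeSpace l) :
    x = volterraInv v z y ↔ x = y + volterra (shifted v z) x := by
  have hu := isUnit_one_sub_volterra (shifted v z)
  constructor
  · rintro rfl
    have := congrArg (· y) (Ring.mul_inverse_cancel _ hu)
    simp only [mul_apply_eq_comp, sub_apply, one_apply_eq_self] at this
    exact sub_eq_iff_eq_add.mp this
  · intro h
    have := congrArg (· x) (Ring.inverse_mul_cancel _ hu)
    simp only [mul_apply_eq_comp, sub_apply, one_apply_eq_self] at this
    rw [← this, volterraInv, sub_eq_iff_eq_add.mpr h]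

theorem hasDerivAt_volterraInv (z : ℂ) : HasDerivAt (volterraInv v)
    (-(volterraInv v z * volterra oneFn * volterraInv v z)) z := by
  obtain ⟨u, hu⟩ := isUnit_one_sub_volterra (shifted v z)
  have h1 : HasDerivAt (fun z => 1 - volterra (shifted v z)) (volterra (oneFn : EdgeSpace l)) z := by
    have h2 : (fun z => 1 - volterra (shifted v z)) =
        fun z => 1 - volterra v + z • volterra (oneFn : EdgeSpace l) := by
      funext z
      rw [shifted, volterra_add_smul, neg_smul]; abel
    rw [h2]
    simpa using ((hasDerivAt_id z).smul_const (volterra (oneFn : EdgeSpace l))).const_add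
      (1 - volterra v)
  have h3 := hasFDerivAt_ringInverse (𝕜 := ℂ) u
  rw [hu] at h3
  have h4 := h3.comp_hasDerivAt z h1
  have h5 : ((u⁻¹ : (EdgeSpace l →L[ℂ] EdgeSpace l)ˣ) : EdgeSpace l →L[ℂ] EdgeSpace l)
      = volterraInv v z := by rw [volterraInv, ← hu, Ring.inverse_unit]
  rw [h5] at h4
  exact h4

/-- The second derivative of the solution with `f 0 = a`, `f' 0 = b`. -/
def solution₂ (z a b : ℂ) (y : EdgeSpace l) : EdgeSpace l :=
  volterraInv v z (a • shifted v z + b • mulId (shifted v z) - y)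

theorem isH2_affine_add (a b : ℂ) (h : EdgeSpace l) :
    IsH2 0 l (fun t => a + b * t + primitive₂ h t) (fun t => b + primitive h t) h := by
  have h1 : IsH2 0 l (fun t => a + b * t) (fun _ => b) 0 := by
    refine ⟨MemLp.zero, fun t ht => ?_, fun t ht => by simp⟩
    simp [mul_comm]
  have := h1.add (isH2_primitive₂ h)
  rwa [zero_add] at this

theorem coeFn_affine (a b : ℂ) (w h : EdgeSpace l) :
    (a • w + b • mulId w + volterra w h : EdgeSpace l) =ᵐ[edgeMeasure l]
      fun t => w t * (a + b * t + primitive₂ h t) := by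
  filter_upwards [Lp.coeFn_add (a • w + b • mulId w) (volterra w h),
    Lp.coeFn_add (a • w) (b • mulId w), Lp.coeFn_smul a w, Lp.coeFn_smul b (mulId w),
    coeFn_mulId w, coeFn_volterra w h] with t h1 h2 h3 h4 h5 h6
  rw [h1, Pi.add_apply, h2, Pi.add_apply, h3, h4, Pi.smul_apply, Pi.smul_apply, h5, h6,
    smul_eq_mul, smul_eq_mul]
  ring

/-- Existence for the initial value problem. The unknown of the Volterra equation is the second
derivative `h`; with `f = a + b t + primitive₂ h` the fixed point equation reads `h = (v - z) f -
y`. -/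
theorem coeFn_solution₂ (z a b : ℂ) (y : EdgeSpace l) :
    solution₂ v z a b y =ᵐ[edgeMeasure l]
      fun t => (v t - z) * (a + b * t + primitive₂ (solution₂ v z a b y) t) - y t := by
  have h1 := (volterraInv_apply_eq_iff v z (solution₂ v z a b y) _).mp rfl
  set h := solution₂ v z a b y
  have h2 : h = (a • shifted v z + b • mulId (shifted v z) + volterra (shifted v z) h) - y := by
    conv_lhs => rw [h1]
    abel
  filter_upwards [Lp.coeFn_sub (a • shifted v z + b • mulId (shifted v z)
    + volterra (shifted v z) h) y, coeFn_affine a b (shifted v z) h, coeFn_shifted v z]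
    with t e1 e2 e3
  conv_lhs => rw [h2]
  rw [e1, Pi.sub_apply, e2, e3]

theorem eq_affine_of_isH2 {f g h : ℝ → ℂ} (H : IsH2 0 l f g h) :
    (∀ t ∈ Set.Icc 0 l, g t = g 0 + primitive H.memLp.toLp t) ∧
    ∀ t ∈ Set.Icc 0 l, f t = f 0 + g 0 * t + primitive₂ H.memLp.toLp t := by
  have h1 : ∀ t ∈ Set.Icc 0 l, g t = g 0 + primitive H.memLp.toLp t := fun t ht => by
    rw [H.eq_snd t ht, primitive, integral_congr_edge H.memLp.coeFn_toLp ht]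
  refine ⟨h1, fun t ht => ?_⟩
  rw [H.eq_fst t ht, add_assoc]
  congr 1
  have h2 : ∫ s in 0..t, g s = ∫ s in 0..t, (g 0 + primitive H.memLp.toLp s) := by
    refine intervalIntegral.integral_congr fun s hs => h1 s ?_
    rw [Set.uIcc_of_le ht.1] at hs
    exact ⟨hs.1, hs.2.trans ht.2⟩
  rw [h2, intervalIntegral.integral_add (by simp) (intervalIntegrable_primitive _ ht)]
  simp [primitive₂, mul_comm]

/-- Uniqueness for the initial value problem: the second derivative of any solution satisfies the
same fixed point equation, and the operator in it is invertible. -/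
theorem toLp_eq_solution₂ {f g h : ℝ → ℂ} (H : IsH2 0 l f g h) {z : ℂ} {y : EdgeSpace l}
    (e : h =ᵐ[edgeMeasure l] fun t => (v t - z) * f t - y t) :
    H.memLp.toLp = solution₂ v z (f 0) (g 0) y := by
  rw [solution₂, volterraInv_apply_eq_iff]
  have h1 : (f 0 • shifted v z + g 0 • mulId (shifted v z) - y + volterra (shifted v z) H.memLp.toLp)
      = (f 0 • shifted v z + g 0 • mulId (shifted v z) + volterra (shifted v z) H.memLp.toLp) - y := by
    abel
  rw [h1]
  refine Lp.ext ?_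
  filter_upwards [H.memLp.coeFn_toLp, e, Lp.coeFn_sub (f 0 • shifted v z
    + g 0 • mulId (shifted v z) + volterra (shifted v z) H.memLp.toLp) y,
    coeFn_affine (f 0) (g 0) (shifted v z) H.memLp.toLp, coeFn_shifted v z,
    ae_edge (eq_affine_of_isH2 H).2] with t e1 e2 e3 e4 e5 e6
  rw [e1, e2, e3, Pi.sub_apply, e4, e5, ← e6]

/-- `x ∈ H²[0, l]` with `-x'' + v x = y` and boundary values `x(0) = a`, `x'(0) = b`, `x(l) = c`,
`x'(l) = d`. -/
def EdgeRel (x y : EdgeSpace l) (a b c d : ℂ) : Prop :=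
  ∃ f g h : ℝ → ℂ, IsH2 0 l f g h ∧ x =ᵐ[edgeMeasure l] f ∧
    y =ᵐ[edgeMeasure l] (fun t => -h t + v t * f t) ∧ f 0 = a ∧ g 0 = b ∧ f l = c ∧ g l = d

/-- The second derivative of the solution `u₁`. -/
def u₁'' (z : ℂ) : EdgeSpace l := volterraInv v z (mulId (shifted v z))

/-- The second derivative of the solution `u₂`. -/
def u₂'' (z : ℂ) : EdgeSpace l := volterraInv v z (shifted v z)

/-- The solution with `u₁(0) = 0`, `u₁'(0) = 1`, as an element of `L²`. -/
def solOne (z : ℂ) : EdgeSpace l := mulId oneFn + volterra oneFn (u₁'' v z)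

/-- The solution with `u₂(0) = 1`, `u₂'(0) = 0`, as an element of `L²`. -/
def solTwo (z : ℂ) : EdgeSpace l := oneFn + volterra oneFn (u₂'' v z)

/-- The value `u₁(l; z)`. -/
def u₁End (z : ℂ) : ℂ := l + primitiveEnd₂ (u₁'' v z)

/-- The value `u₁'(l; z)`. -/
def u₁End' (z : ℂ) : ℂ := 1 + primitiveEnd (u₁'' v z)

/-- The value `u₂(l; z)`. -/
def u₂End (z : ℂ) : ℂ := 1 + primitiveEnd₂ (u₂'' v z)

/-- The value `u₂'(l; z)`. -/
def u₂End' (z : ℂ) : ℂ := primitiveEnd (u₂'' v z)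

/-- The solution operator of the inhomogeneous equation with zero initial data. -/
def solInhom (z : ℂ) : EdgeSpace l →L[ℂ] EdgeSpace l := -(volterra oneFn ∘L volterraInv v z)

/-- The value at `l` of the solution of the inhomogeneous equation with zero initial data. -/
def inhomEnd (z : ℂ) : EdgeSpace l →L[ℂ] ℂ := -(primitiveEnd₂ ∘L volterraInv v z)

/-- The derivative at `l` of the solution of the inhomogeneous equation with zero initial data. -/
def inhomEnd' (z : ℂ) : EdgeSpace l →L[ℂ] ℂ := -(primitiveEnd ∘L volterraInv v z)

theorem solution₂_eq (z a b : ℂ) (y : EdgeSpace l) :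
    solution₂ v z a b y = a • u₂'' v z + b • u₁'' v z - volterraInv v z y := by
  simp only [solution₂, u₂'', u₁'', map_sub, map_add, map_smul]

/-- The bridge from the differential equation to linear algebra. Relative to `z`, the function `x`
solves the equation with source `y - z • x`, so it is a combination of the two fundamental solutions
plus the response to that source, and the data at `l` come from the transfer matrix. The reference
point `z` is free, which is exploited below with `z = 0` as well as with spectral parameters. -/
theorem edgeRel_iff (z : ℂ) (x y : EdgeSpace l) (a b c d : ℂ) :
    EdgeRel v x y a b c d ↔
      x = a • solTwo v z + b • solOne v z + solInhom v z (y - z • x) ∧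
      c = u₂End v z * a + u₁End v z * b + inhomEnd v z (y - z • x) ∧
      d = u₂End' v z * a + u₁End' v z * b + inhomEnd' v z (y - z • x) := by
  have hll : l ∈ Set.Icc 0 l := ⟨hl.out.le, le_rfl⟩
  obtain ⟨Y, hY⟩ : ∃ Y, Y = y - z • x := ⟨_, rfl⟩
  rw [← hY]
  have ex : a • solTwo v z + b • solOne v z + solInhom v z Y =
      a • oneFn + b • mulId oneFn + volterra oneFn (solution₂ v z a b Y) := by
    rw [solution₂_eq, solTwo, solOne, solInhom, map_sub, map_add, map_smul, map_smul, neg_apply,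
      ContinuousLinearMap.comp_apply, smul_add, smul_add]
    abel
  have ec : u₂End v z * a + u₁End v z * b + inhomEnd v z Y =
      a + b * l + primitive₂ (solution₂ v z a b Y) l := by
    change _ = a + b * l + primitiveEnd₂ (solution₂ v z a b Y)
    rw [solution₂_eq, u₂End, u₁End, inhomEnd, map_sub, map_add, map_smul, map_smul, neg_apply,
      ContinuousLinearMap.comp_apply, smul_eq_mul, smul_eq_mul]
    ring
  have ed : u₂End' v z * a + u₁End' v z * b + inhomEnd' v z Y =
      b + primitive (solution₂ v z a b Y) l := by
    change _ = b + primitiveEnd (solution₂ v z a b Y)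
    rw [solution₂_eq, u₂End', u₁End', inhomEnd', map_sub, map_add, map_smul, map_smul, neg_apply,
      ContinuousLinearMap.comp_apply, smul_eq_mul, smul_eq_mul]
    ring
  rw [ex, ec, ed]
  have eY : Y =ᵐ[edgeMeasure l] fun t => y t - z * x t := by
    filter_upwards [Lp.coeFn_sub y (z • x), Lp.coeFn_smul z x] with t e1 e2
    rw [hY, e1, Pi.sub_apply, e2, Pi.smul_apply, smul_eq_mul]
  constructor
  · rintro ⟨f, g, h, H, hx, hy, rfl, rfl, rfl, rfl⟩
    have e : h =ᵐ[edgeMeasure l] fun t => (v t - z) * f t - Y t := by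
      filter_upwards [hx, hy, eY] with t e1 e2 e3
      rw [e3, e1, e2]; ring
    have hs := toLp_eq_solution₂ v H e
    obtain ⟨hg, hf⟩ := eq_affine_of_isH2 H
    rw [hs] at hg hf
    refine ⟨Lp.ext ?_, hf l hll, hg l hll⟩
    filter_upwards [hx, coeFn_affine (f 0) (g 0) oneFn (solution₂ v z (f 0) (g 0) Y),
      coeFn_oneFn (l := l), ae_edge hf] with t e1 e2 e3 e4
    rw [e1, e2, e3, one_mul, ← e4]
  · rintro ⟨hx, hc, hd⟩
    have hx' : x =ᵐ[edgeMeasure l] fun t => a + b * t + primitive₂ (solution₂ v z a b Y) t := by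
      filter_upwards [coeFn_affine a b oneFn (solution₂ v z a b Y), coeFn_oneFn (l := l)]
        with t e1 e2
      conv_lhs => rw [hx]
      rw [e1, e2, one_mul]
    refine ⟨_, _, _, isH2_affine_add a b (solution₂ v z a b Y), hx', ?_, ?_, ?_, hc.symm, hd.symm⟩
    · filter_upwards [hx', coeFn_solution₂ v z a b Y, eY] with t e1 e2 e3
      rw [e2, e3, ← e1]; ring
    · simp [primitive₂]
    · simp [primitive]

theorem EdgeRel.add {x y x' y' : EdgeSpace l} {a b c d a' b' c' d' : ℂ}
    (h : EdgeRel v x y a b c d) (h' : EdgeRel v x' y' a' b' c' d') :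
    EdgeRel v (x + x') (y + y') (a + a') (b + b') (c + c') (d + d') := by
  obtain ⟨f, g, k, H, hx, hy, rfl, rfl, rfl, rfl⟩ := h
  obtain ⟨f', g', k', H', hx', hy', rfl, rfl, rfl, rfl⟩ := h'
  refine ⟨_, _, _, H.add H', (Lp.coeFn_add x x').trans (hx.add hx'), ?_, rfl, rfl, rfl, rfl⟩
  filter_upwards [Lp.coeFn_add y y', hy, hy'] with t e1 e2 e3
  simp only [e1, Pi.add_apply, e2, e3]; ring

theorem EdgeRel.smul {x y : EdgeSpace l} {a b c d : ℂ} (r : ℂ)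
    (h : EdgeRel v x y a b c d) : EdgeRel v (r • x) (r • y) (r * a) (r * b) (r * c) (r * d) := by
  obtain ⟨f, g, k, H, hx, hy, rfl, rfl, rfl, rfl⟩ := h
  refine ⟨_, _, _, H.smul r, (Lp.coeFn_smul r x).trans (hx.const_smul r), ?_, rfl, rfl, rfl, rfl⟩
  filter_upwards [Lp.coeFn_smul r y, hy] with t e1 e2
  simp only [e1, Pi.smul_apply, e2, smul_eq_mul]; ring

theorem edgeRel_solOne (z : ℂ) :
    EdgeRel v (solOne v z) (z • solOne v z) 0 1 (u₁End v z) (u₁End' v z) :=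
  (edgeRel_iff v z _ _ _ _ _ _).mpr (by simp)

/-- The boundary values are determined by the function. -/
theorem EdgeRel.unique {x y : EdgeSpace l} {a b c d a' b' c' d' : ℂ}
    (h : EdgeRel v x y a b c d) (h' : EdgeRel v x y a' b' c' d') :
    a = a' ∧ b = b' ∧ c = c' ∧ d = d' := by
  obtain ⟨f, g, k, H, hx, hy, rfl, rfl, rfl, rfl⟩ := h
  obtain ⟨f', g', k', H', hx', hy', rfl, rfl, rfl, rfl⟩ := h'
  have ef : Set.EqOn f f' (Set.Icc 0 l) :=
    Measure.eqOn_Icc_of_ae_eq volume hl.out.ne (hx.symm.trans hx') H.continuousOn_fst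
      H'.continuousOn_fst
  have H0 := H.add (H'.smul (-1))
  have eg : Set.EqOn (g + (-1 : ℂ) • g') 0 (Set.Icc 0 l) := by
    refine Measure.eqOn_Icc_of_ae_eq volume hl.out.ne (IsH2.ae_zero_of_primitive
      H0.integrableOn_snd fun t ht => ?_) H0.continuousOn_snd continuousOn_const
    have h1 := H0.eq_fst t ht
    simp only [Pi.add_apply, Pi.smul_apply, ef ht, ef ⟨le_rfl, hl.out.le⟩] at h1
    simpa using h1.symm
  have eg' : ∀ t ∈ Set.Icc 0 l, g t = g' t := fun t ht => by
    have := eg ht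
    simp only [Pi.add_apply, Pi.smul_apply, smul_eq_mul, Pi.zero_apply] at this
    linear_combination this
  have h0 : (0 : ℝ) ∈ Set.Icc 0 l := ⟨le_rfl, hl.out.le⟩
  have hll : l ∈ Set.Icc 0 l := ⟨hl.out.le, le_rfl⟩
  exact ⟨ef h0, eg' 0 h0, ef hll, eg' l hll⟩

/-- Solutions are controlled below by their initial data. -/
theorem exists_norm_initial_le (z : ℂ) :
    ∃ C > 0, ∀ a b : ℂ, ‖a‖ ≤ C * ‖a • solTwo v z + b • solOne v z‖ ∧
      ‖b‖ ≤ C * ‖a • solTwo v z + b • solOne v z‖ := by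
  let T : ℂ × ℂ →ₗ[ℂ] EdgeSpace l :=
    (LinearMap.toSpanSingleton ℂ _ (solTwo v z)).coprod (LinearMap.toSpanSingleton ℂ _ (solOne v z))
  have hT : ∀ a b, T (a, b) = a • solTwo v z + b • solOne v z := fun a b => by simp [T]
  have hker : T.ker = ⊥ := by
    rw [LinearMap.ker_eq_bot']
    rintro ⟨a, b⟩ h
    rw [hT] at h
    have h1 : EdgeRel v (0 : EdgeSpace l) 0 a b (u₂End v z * a + u₁End v z * b)
        (u₂End' v z * a + u₁End' v z * b) :=
      (edgeRel_iff v z _ _ _ _ _ _).mpr (by simp [h])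
    have h2 : EdgeRel v (0 : EdgeSpace l) 0 0 0 0 0 :=
      (edgeRel_iff v z _ _ _ _ _ _).mpr (by simp)
    obtain ⟨rfl, rfl, -⟩ := h1.unique v h2
    rfl
  -- An injective linear map on the finite-dimensional space `ℂ × ℂ` is bounded below.
  obtain ⟨K, hK, hA⟩ := T.exists_antilipschitzWith hker
  refine ⟨K, hK, fun a b => ?_⟩
  have h1 := hA.le_mul_dist (a, b) 0
  rw [map_zero, dist_zero_right, dist_zero_right, hT] at h1
  exact ⟨(norm_fst_le (a, b)).trans h1, (norm_snd_le (a, b)).trans h1⟩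

/-- Differentiating the equation in `z` gives the inhomogeneous equation with zero initial data
whose source is the solution itself. This identifies the derivatives of the end values with
`inhomEnd` and `inhomEnd'` at `solOne`, the form needed for Green's formula. -/
theorem hasDerivAt_u₁'' (z : ℂ) :
    HasDerivAt (u₁'' v) (-(volterraInv v z (solOne v z))) z := by
  have h2 : HasDerivAt (fun z => mulId (shifted v z)) (-(mulId (oneFn : EdgeSpace l))) z := by
    simp only [shifted, map_add, map_smul]
    simpa using ((hasDerivAt_id z).neg.smul_const (mulId (oneFn : EdgeSpace l))).const_add (mulId v)
  refine ((hasDerivAt_volterraInv v z).clm_apply h2).congr_deriv ?_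
  simp only [neg_apply, mul_apply_eq_comp, solOne, u₁'', map_add, map_neg]
  abel

theorem hasDerivAt_u₂'' (z : ℂ) :
    HasDerivAt (u₂'' v) (-(volterraInv v z (solTwo v z))) z := by
  have h2 : HasDerivAt (fun z => shifted v z) (-(oneFn : EdgeSpace l)) z := by
    simp only [shifted]
    simpa using ((hasDerivAt_id z).neg.smul_const (oneFn : EdgeSpace l)).const_add v
  refine ((hasDerivAt_volterraInv v z).clm_apply h2).congr_deriv ?_
  simp only [neg_apply, mul_apply_eq_comp, solTwo, u₂'', map_add, map_neg]
  abel

theorem hasDerivAt_u₁End (z : ℂ) : HasDerivAt (u₁End v) (inhomEnd v z (solOne v z)) z := by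
  have := ((primitiveEnd₂ (l := l)).hasFDerivAt.comp_hasDerivAt z (hasDerivAt_u₁'' v z)).const_add
    (l : ℂ)
  rw [map_neg] at this
  exact this

theorem hasDerivAt_u₁End' (z : ℂ) : HasDerivAt (u₁End' v) (inhomEnd' v z (solOne v z)) z := by
  have := ((primitiveEnd (l := l)).hasFDerivAt.comp_hasDerivAt z (hasDerivAt_u₁'' v z)).const_add
    (1 : ℂ)
  rw [map_neg] at this
  exact this

theorem hasDerivAt_u₂End (z : ℂ) : HasDerivAt (u₂End v) (inhomEnd v z (solTwo v z)) z := by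
  have := ((primitiveEnd₂ (l := l)).hasFDerivAt.comp_hasDerivAt z (hasDerivAt_u₂'' v z)).const_add
    (1 : ℂ)
  rw [map_neg] at this
  exact this

/-- Green's formula for the sesquilinear form. -/
theorem EdgeRel.inner_sub_inner {x y x' y' : EdgeSpace l} {a b c d a' b' c' d' : ℂ}
    (hv : ∀ᵐ t ∂edgeMeasure l, (starRingEnd ℂ) (v t) = v t)
    (h : EdgeRel v x y a b c d) (h' : EdgeRel v x' y' a' b' c' d') :
    inner ℂ y x' - inner ℂ x y' = (starRingEnd ℂ c * d' - starRingEnd ℂ d * c')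
      - (starRingEnd ℂ a * b' - starRingEnd ℂ b * a') := by
  obtain ⟨f, g, k, H, hx, hy, rfl, rfl, rfl, rfl⟩ := h
  obtain ⟨f', g', k', H', hx', hy', rfl, rfl, rfl, rfl⟩ := h'
  have h1 := H.conj.integral_wronskian H' hl.out.le
  rw [← h1, L2.inner_def, L2.inner_def, ← integral_sub (L2.integrable_inner (𝕜 := ℂ) y x')
    (L2.integrable_inner (𝕜 := ℂ) x y'), intervalIntegral.integral_of_le hl.out.le,
    ← integral_Icc_eq_integral_Ioc]
  refine integral_congr_ae ?_
  filter_upwards [hx, hy, hx', hy', hv] with t e1 e2 e3 e4 e5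
  simp only [e1, e2, e3, e4, RCLike.inner_apply, map_add, map_neg, map_mul, e5]
  ring

end Edge

/-! ### Transfer matrix of one edge: determinant, reality, large spectral parameter. -/

section Edge

variable {l : ℝ} [hl : Fact (0 < l)] (v : EdgeSpace l)

theorem edgeRel_of_isH2 {f g h : ℝ → ℂ} (H : IsH2 0 l f g h) {z : ℂ}
    (e : h =ᵐ[edgeMeasure l] fun t => (v t - z) * f t) :
    EdgeRel v (memLp_of_continuousOn H.continuousOn_fst).toLp
      (z • (memLp_of_continuousOn H.continuousOn_fst).toLp) (f 0) (g 0) (f l) (g l) := by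
  refine ⟨f, g, h, H, MemLp.coeFn_toLp _, ?_, rfl, rfl, rfl, rfl⟩
  filter_upwards [e, Lp.coeFn_smul z (memLp_of_continuousOn (p := 2) H.continuousOn_fst).toLp,
    (memLp_of_continuousOn (p := 2) H.continuousOn_fst).coeFn_toLp] with t e1 e2 e3
  rw [e2, Pi.smul_apply, e3, e1, smul_eq_mul]; ring

theorem isH2_end {f g h : ℝ → ℂ} (H : IsH2 0 l f g h) {z : ℂ}
    (e : h =ᵐ[edgeMeasure l] fun t => (v t - z) * f t) :
    f l = u₂End v z * f 0 + u₁End v z * g 0 ∧ g l = u₂End' v z * f 0 + u₁End' v z * g 0 := by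
  have h1 := (edgeRel_iff v z _ _ _ _ _ _).mp (edgeRel_of_isH2 v H e)
  simpa using h1.2

/-- Functions representing the homogeneous solution with given initial data. -/
theorem exists_isH2_solution (z a b : ℂ) : ∃ f g h : ℝ → ℂ, IsH2 0 l f g h ∧
    (h =ᵐ[edgeMeasure l] fun t => (v t - z) * f t) ∧ f 0 = a ∧ g 0 = b := by
  refine ⟨_, _, _, isH2_affine_add a b (solution₂ v z a b 0), ?_, by simp [primitive₂],
    by simp [primitive]⟩
  filter_upwards [coeFn_solution₂ v z a b 0, Lp.coeFn_zero ℂ 2 (edgeMeasure l)] with t e1 e2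
  rw [e1, e2]; simp

/-- For two solutions with the same `z` the integrand in Green's formula vanishes, so their
Wronskian takes the same value at both ends; at `0` the initial data give `1`. -/
theorem wronskian_eq_one (z : ℂ) :
    u₁End' v z * u₂End v z - u₁End v z * u₂End' v z = 1 := by
  obtain ⟨f, g, h, H, e, h1, h2⟩ := exists_isH2_solution v z 1 0
  obtain ⟨f', g', h', H', e', h1', h2'⟩ := exists_isH2_solution v z 0 1
  have h3 := H.integral_wronskian H' hl.out.le
  have h4 : ∫ s in 0..l, (f s * h' s - h s * f' s) = ∫ s in 0..l, (0 : ℂ) := by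
    refine integral_congr_edge (l := l) ?_ ⟨hl.out.le, le_rfl⟩
    filter_upwards [e, e'] with t e1 e2
    rw [e1, e2]; ring
  rw [h4, intervalIntegral.integral_zero] at h3
  obtain ⟨a1, a2⟩ := isH2_end v H e
  obtain ⟨b1, b2⟩ := isH2_end v H' e'
  rw [a1, a2, b1, b2, h1, h2, h1', h2'] at h3
  linear_combination -h3

/-- For a real potential and a real spectral parameter the conjugate of a solution solves the same
equation. With real initial data it has the same data at `0`, hence the same data at `l`. -/
theorem conj_end (hv : ∀ᵐ t ∂edgeMeasure l, (starRingEnd ℂ) (v t) = v t) (x : ℝ) :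
    (starRingEnd ℂ) (u₁End v x) = u₁End v x ∧ (starRingEnd ℂ) (u₁End' v x) = u₁End' v x ∧
    (starRingEnd ℂ) (u₂End v x) = u₂End v x := by
  have key : ∀ a b : ℝ, (starRingEnd ℂ) (u₂End v x * a + u₁End v x * b)
      = u₂End v x * a + u₁End v x * b ∧ (starRingEnd ℂ) (u₂End' v x * a + u₁End' v x * b)
      = u₂End' v x * a + u₁End' v x * b := by
    intro a b
    obtain ⟨f, g, h, H, e, h1, h2⟩ := exists_isH2_solution v x a b
    obtain ⟨a1, a2⟩ := isH2_end v H e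
    have ec : (fun t => (starRingEnd ℂ) (h t)) =ᵐ[edgeMeasure l]
        fun t => (v t - x) * (starRingEnd ℂ) (f t) := by
      filter_upwards [e, hv] with t e1 e2
      rw [e1, map_mul, map_sub, e2, Complex.conj_ofReal]
    obtain ⟨b1, b2⟩ := isH2_end v H.conj ec
    rw [h1, h2] at a1 a2
    simp only [h1, h2, Complex.conj_ofReal] at b1 b2
    rw [← a1, ← a2, b1, b2, a1, a2]
    exact ⟨rfl, rfl⟩
  have k1 := key 0 1
  have k2 := key 1 0
  simp only [Complex.ofReal_zero, Complex.ofReal_one, mul_zero, mul_one, zero_add, add_zero] at k1 k2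
  exact ⟨k1.1, k1.2, k2.1⟩

/-- Since a solution exists, the choice made by `Classical.epsilon` is one; its values at `l` are
then forced, whichever representative was chosen. -/
theorem cauchySolution_spec {V : ℝ → ℝ} (hv : v =ᵐ[edgeMeasure l] fun t => (V t : ℂ))
    (z a b : ℂ) : IsH2 0 l (cauchySolution l V z a b).1 (cauchySolution l V z a b).2
      (fun t => ((V t : ℂ) - z) * (cauchySolution l V z a b).1 t) ∧
      (cauchySolution l V z a b).1 0 = a ∧ (cauchySolution l V z a b).2 0 = b := by
  obtain ⟨f, g, h, H, e, h1, h2⟩ := exists_isH2_solution v z a b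
  refine Classical.epsilon_spec (p := fun p : (ℝ → ℂ) × (ℝ → ℂ) =>
    IsH2 0 l p.1 p.2 (fun t => ((V t : ℂ) - z) * p.1 t) ∧ p.1 0 = a ∧ p.2 0 = b)
    ⟨(f, g), H.congr_third ?_, h1, h2⟩
  filter_upwards [e, hv] with t e1 e2
  rw [e1, e2]

theorem cauchySolution_end {V : ℝ → ℝ} (hv : v =ᵐ[edgeMeasure l] fun t => (V t : ℂ))
    (z a b : ℂ) : (cauchySolution l V z a b).1 l = u₂End v z * a + u₁End v z * b ∧
      (cauchySolution l V z a b).2 l = u₂End' v z * a + u₁End' v z * b := by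
  obtain ⟨H, h1, h2⟩ := cauchySolution_spec v hv z a b
  have := isH2_end v H (z := z) (by
    filter_upwards [hv] with t e1
    rw [e1])
  rwa [h1, h2] at this

theorem eta_eq {V : ℝ → ℝ} (hv : v =ᵐ[edgeMeasure l] fun t => (V t : ℂ)) (α β : ℝ) (z : ℂ) :
    eta l V α β z = (1 + (β : ℂ) ^ 2) * (u₁End' v z + u₂End v z) + α * u₁End v z := by
  simp only [eta, (cauchySolution_end v hv z _ _).1, (cauchySolution_end v hv z _ _).2]
  ring

/-! ### Asymptotics for large spectral parameter -/

theorem norm_sin_le_exp (w : ℂ) : ‖Complex.sin w‖ ≤ Real.exp |w.im| := by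
  rw [Complex.sin, norm_div, norm_mul, Complex.norm_I, mul_one, Complex.norm_ofNat,
    div_le_iff₀ two_pos]
  refine (norm_sub_le _ _).trans ?_
  rw [Complex.norm_exp, Complex.norm_exp]
  have h1 : (-w * Complex.I).re ≤ |w.im| := by simpa using le_abs_self _
  have h2 : (w * Complex.I).re ≤ |w.im| := by simpa using neg_le_abs _
  have := Real.exp_le_exp.mpr h1
  have := Real.exp_le_exp.mpr h2
  linarith

theorem norm_cos_le_exp (w : ℂ) : ‖Complex.cos w‖ ≤ Real.exp |w.im| := by
  rw [Complex.cos, norm_div, Complex.norm_ofNat, div_le_iff₀ two_pos]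
  refine (norm_add_le _ _).trans ?_
  rw [Complex.norm_exp, Complex.norm_exp]
  have h1 : (-w * Complex.I).re ≤ |w.im| := by simpa using le_abs_self _
  have h2 : (w * Complex.I).re ≤ |w.im| := by simpa using neg_le_abs _
  have := Real.exp_le_exp.mpr h1
  have := Real.exp_le_exp.mpr h2
  linarith

theorem eq_add_integral_of_hasDerivAt {F F' : ℝ → ℂ} (hF : ∀ s, HasDerivAt F (F' s) s)
    (hc : Continuous F') (t : ℝ) : F t = F 0 + ∫ s in 0..t, F' s := by
  rw [intervalIntegral.integral_eq_sub_of_hasDerivAt (fun s _ => hF s) (hc.intervalIntegrable _ _)]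
  ring

/-- Variation of constants. -/
theorem variation_of_constants {f g h : ℝ → ℂ} (H : IsH2 0 l f g h) {κ : ℂ} (hκ : κ ≠ 0)
    (e : h =ᵐ[edgeMeasure l] fun t => (v t - κ ^ 2) * f t) {t : ℝ} (ht : t ∈ Set.Icc 0 l) :
    f t = Complex.cos (κ * t) * f 0 + Complex.sin (κ * t) / κ * g 0
        + ∫ s in 0..t, Complex.sin (κ * (t - s)) / κ * (v s * f s) ∧
    g t = Complex.cos (κ * t) * g 0 - κ * Complex.sin (κ * t) * f 0
        + ∫ s in 0..t, Complex.cos (κ * (t - s)) * (v s * f s) := by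
  have dlin : ∀ s : ℝ, HasDerivAt (fun s : ℝ => κ * ((t : ℂ) - s)) (-κ) s := fun s => by
    simpa using (((hasDerivAt_id s).ofReal_comp).const_sub (t : ℂ)).const_mul κ
  have dS : ∀ s : ℝ, HasDerivAt (fun s : ℝ => Complex.sin (κ * (t - s)) / κ)
      (-Complex.cos (κ * (t - s))) s := fun s => by
    refine (((Complex.hasDerivAt_sin _).comp s (dlin s)).div_const κ).congr_deriv ?_
    field_simp
  have dC : ∀ s : ℝ, HasDerivAt (fun s : ℝ => Complex.cos (κ * (t - s)))
      (κ * Complex.sin (κ * (t - s))) s := fun s => by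
    refine ((Complex.hasDerivAt_cos _).comp s (dlin s)).congr_deriv ?_
    ring
  have dS' : ∀ s : ℝ, HasDerivAt (fun s : ℝ => κ * Complex.sin (κ * (t - s)))
      (-κ ^ 2 * Complex.cos (κ * (t - s))) s := fun s => by
    refine (((Complex.hasDerivAt_sin _).comp s (dlin s)).const_mul κ).congr_deriv ?_
    ring
  have ci : ∀ {F : ℝ → ℂ}, Continuous F → IntegrableOn F (Set.Icc 0 l) := fun hF =>
    hF.continuousOn.integrableOn_Icc
  have cC : Continuous fun s : ℝ => Complex.cos (κ * (t - s)) := by fun_prop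
  have cS : Continuous fun s : ℝ => Complex.sin (κ * (t - s)) / κ := by fun_prop
  have cS1 : Continuous fun s : ℝ => κ * Complex.sin (κ * (t - s)) := by fun_prop
  have cnC : Continuous fun s : ℝ => -Complex.cos (κ * (t - s)) := by fun_prop
  have cC2 : Continuous fun s : ℝ => -κ ^ 2 * Complex.cos (κ * (t - s)) := by fun_prop
  -- The four product rules concern sin · g, cos · f, cos · g and sin · f. In the sum of the first
  -- two and in the difference of the last two the terms with `g` cancel, and what remains is the
  -- kernel times `h + κ² f = v f`.
  have e1 := mul_eq_of_primitive (ci cnC) H.integrableOn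
    (fun t _ => eq_add_integral_of_hasDerivAt dS cnC t) H.eq_snd ht
  have e2 := mul_eq_of_primitive (ci cS1) H.integrableOn_snd
    (fun t _ => eq_add_integral_of_hasDerivAt dC cS1 t) H.eq_fst ht
  have e3 := mul_eq_of_primitive (ci cS1) H.integrableOn
    (fun t _ => eq_add_integral_of_hasDerivAt dC cS1 t) H.eq_snd ht
  have e4 := mul_eq_of_primitive (ci cC2) H.integrableOn_snd
    (fun t _ => eq_add_integral_of_hasDerivAt dS' cC2 t) H.eq_fst ht
  have ii : ∀ {φ ψ : ℝ → ℂ}, Continuous φ → IntegrableOn ψ (Set.Icc 0 l) →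
      IntervalIntegrable (fun s => φ s * ψ s) volume 0 t := fun hφ hψ =>
    IsH2.intervalIntegrable_of (hψ.continuousOn_mul hφ.continuousOn isCompact_Icc) ht
  have fi := H.continuousOn_fst.integrableOn_Icc (μ := volume)
  have s1 := intervalIntegral.integral_add ((ii cnC H.integrableOn_snd).add (ii cS H.integrableOn))
    ((ii cS1 fi).add (ii cC H.integrableOn_snd))
  have s2 := intervalIntegral.integral_sub ((ii cS1 H.integrableOn_snd).add (ii cC H.integrableOn))
    ((ii cC2 fi).add (ii cS1 H.integrableOn_snd))
  simp only [sub_self, mul_zero, Complex.sin_zero, zero_div, zero_mul, Complex.cos_zero, one_mul,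
    Complex.ofReal_zero, sub_zero] at e1 e2 e3 e4
  have i1 : ∫ s in 0..t, Complex.sin (κ * (t - s)) / κ * (v s * f s) =
      ∫ s in 0..t, ((-Complex.cos (κ * (t - s)) * g s + Complex.sin (κ * (t - s)) / κ * h s) +
        (κ * Complex.sin (κ * (t - s)) * f s + Complex.cos (κ * (t - s)) * g s)) := by
    refine integral_congr_edge (l := l) ?_ ht
    filter_upwards [e] with s hs
    rw [hs]; field_simp; ring
  have i2 : ∫ s in 0..t, Complex.cos (κ * (t - s)) * (v s * f s) =
      ∫ s in 0..t, ((κ * Complex.sin (κ * (t - s)) * g s + Complex.cos (κ * (t - s)) * h s) -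
        (-κ ^ 2 * Complex.cos (κ * (t - s)) * f s + κ * Complex.sin (κ * (t - s)) * g s)) := by
    refine integral_congr_edge (l := l) ?_ ht
    filter_upwards [e] with s hs
    rw [hs]; ring
  constructor
  · rw [i1, s1]
    linear_combination e1 + e2
  · rw [i2, s2]
    linear_combination e3 - e4

/-- The `L¹` norm of the potential. -/
def potentialNorm : ℝ := ∫ s in 0..l, ‖v s‖

theorem potentialNorm_nonneg : 0 ≤ potentialNorm v :=
  intervalIntegral.integral_nonneg hl.out.le fun _ _ => norm_nonneg _

/-- The exponentials `exp (σ (t - s))` of the kernel and `exp (σ s)` of the function multiply to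
`exp (σ t)`, so only the `L¹` norm of the potential is left under the integral. -/
theorem norm_integral_kernel_le {f : ℝ → ℂ} (hf : ContinuousOn f (Set.Icc 0 l)) {σ M B : ℝ}
    (hM : ∀ s ∈ Set.Icc 0 l, ‖f s‖ ≤ M * Real.exp (σ * s)) (hM0 : 0 ≤ M) (hB : 0 ≤ B) {t : ℝ}
    (ht : t ∈ Set.Icc 0 l) {K : ℝ → ℂ} (hKc : Continuous K)
    (hK : ∀ s ∈ Set.Icc 0 t, ‖K s‖ ≤ B * Real.exp (σ * (t - s))) :
    ‖∫ s in 0..t, K s * (v s * f s)‖ ≤ B * potentialNorm v * M * Real.exp (σ * t) := by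
  have i0 : IntervalIntegrable (fun s => ‖v s‖) volume 0 t := (v.intervalIntegrable ht).norm
  have h1 : ‖∫ s in 0..t, K s * (v s * f s)‖ ≤ ∫ s in 0..t, B * M * Real.exp (σ * t) * ‖v s‖ := by
    refine (intervalIntegral.norm_integral_le_integral_norm ht.1).trans ?_
    refine intervalIntegral.integral_mono_on ht.1 ?_ (i0.const_mul _) fun s hs => ?_
    · refine IntervalIntegrable.norm (IsH2.intervalIntegrable_of ?_ ht)
      exact (v.integrableOn.mul_continuousOn hf isCompact_Icc).continuousOn_mul hKc.continuousOn
        isCompact_Icc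
    · have h2 := hK s hs
      have h3 := hM s ⟨hs.1, hs.2.trans ht.2⟩
      rw [norm_mul, norm_mul]
      calc ‖K s‖ * (‖v s‖ * ‖f s‖) ≤
          (B * Real.exp (σ * (t - s))) * (‖v s‖ * (M * Real.exp (σ * s))) := by gcongr
        _ = B * M * (Real.exp (σ * (t - s)) * Real.exp (σ * s)) * ‖v s‖ := by ring
        _ = _ := by rw [← Real.exp_add]; ring_nf
  refine h1.trans ?_
  rw [intervalIntegral.integral_const_mul]
  have h4 : ∫ s in 0..t, ‖v s‖ ≤ potentialNorm v :=
    intervalIntegral.integral_mono_interval le_rfl ht.1 ht.2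
      (Filter.Eventually.of_forall fun _ => norm_nonneg _)
      (v.intervalIntegrable ⟨hl.out.le, le_rfl⟩).norm
  calc B * M * Real.exp (σ * t) * ∫ s in 0..t, ‖v s‖
      ≤ B * M * Real.exp (σ * t) * potentialNorm v := by gcongr
    _ = _ := by ring

theorem norm_kernel_le (κ : ℂ) {t s : ℝ} (hs : s ≤ t) :
    ‖Complex.sin (κ * (t - s))‖ ≤ Real.exp (|κ.im| * (t - s)) ∧
    ‖Complex.cos (κ * (t - s))‖ ≤ Real.exp (|κ.im| * (t - s)) := by
  have h : |(κ * ((t : ℂ) - s)).im| = |κ.im| * (t - s) := by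
    rw [← Complex.ofReal_sub, Complex.im_mul_ofReal, abs_mul, abs_of_nonneg (sub_nonneg.mpr hs)]
  rw [← h]
  exact ⟨norm_sin_le_exp _, norm_cos_le_exp _⟩

/-- Absorption instead of Gronwall: let `M` be the maximum of `‖f t‖ exp (-σ t)`. Variation of
constants at the maximizing point bounds `M` by the free part plus `‖κ‖⁻¹ * potentialNorm v * M`,
and `hN` makes the last term at most `M / 2`. -/
theorem norm_solution_le {f g h : ℝ → ℂ} (H : IsH2 0 l f g h) {κ : ℂ} (hκ : κ ≠ 0)
    (hN : 2 * potentialNorm v ≤ ‖κ‖)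
    (e : h =ᵐ[edgeMeasure l] fun t => (v t - κ ^ 2) * f t) :
    ∀ t ∈ Set.Icc 0 l, ‖f t‖ ≤ 2 * (‖f 0‖ + ‖g 0‖ / ‖κ‖) * Real.exp (|κ.im| * t) := by
  set σ := |κ.im| with hσ
  have hκ0 : 0 < ‖κ‖ := norm_pos_iff.mpr hκ
  have cf := H.continuousOn_fst
  obtain ⟨t₀, ht₀, hmax⟩ := isCompact_Icc.exists_isMaxOn (s := Set.Icc 0 l)
    ⟨0, le_rfl, hl.out.le⟩ (f := fun t => ‖f t‖ * Real.exp (-(σ * t)))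
    (cf.norm.mul (by fun_prop))
  set M := ‖f t₀‖ * Real.exp (-(σ * t₀)) with hM
  have hM0 : 0 ≤ M := by positivity
  have hbound : ∀ s ∈ Set.Icc 0 l, ‖f s‖ ≤ M * Real.exp (σ * s) := fun s hs => by
    have h1 : ‖f s‖ * Real.exp (-(σ * s)) ≤ M := hmax hs
    calc ‖f s‖ = ‖f s‖ * Real.exp (-(σ * s)) * Real.exp (σ * s) := by
          rw [mul_assoc, ← Real.exp_add]; simp
      _ ≤ _ := by gcongr
  have h1 := (variation_of_constants v H hκ e ht₀).1
  have h2 := norm_integral_kernel_le v cf hbound hM0 (B := ‖κ‖⁻¹) (by positivity) ht₀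
    (K := fun s : ℝ => Complex.sin (κ * (t₀ - s)) / κ) (by fun_prop) (fun s hs => by
      rw [norm_div, div_eq_inv_mul]
      exact mul_le_mul_of_nonneg_left (norm_kernel_le κ hs.2).1 (by positivity))
  have h3 := norm_kernel_le κ (t := t₀) (s := 0) ht₀.1
  simp only [Complex.ofReal_zero, sub_zero] at h3
  rw [← hσ] at h3
  have h4 : ‖f t₀‖ ≤ (‖f 0‖ + ‖g 0‖ / ‖κ‖ + ‖κ‖⁻¹ * potentialNorm v * M) *
      Real.exp (σ * t₀) := by
    rw [h1]
    refine (norm_add_le _ _).trans ?_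
    rw [add_mul]
    refine add_le_add ?_ h2
    refine (norm_add_le _ _).trans ?_
    rw [norm_mul, norm_mul, norm_div, add_mul]
    refine add_le_add ?_ ?_
    · rw [mul_comm]; exact mul_le_mul_of_nonneg_left h3.2 (norm_nonneg _)
    · rw [div_mul_eq_mul_div, div_mul_eq_mul_div, mul_comm ‖g 0‖]
      gcongr
      exact h3.1
  have h5 : M ≤ ‖f 0‖ + ‖g 0‖ / ‖κ‖ + ‖κ‖⁻¹ * potentialNorm v * M := by
    rw [hM]
    calc ‖f t₀‖ * Real.exp (-(σ * t₀)) ≤ (‖f 0‖ + ‖g 0‖ / ‖κ‖ + ‖κ‖⁻¹ * potentialNorm v * M) *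
      Real.exp (σ * t₀) * Real.exp (-(σ * t₀)) := by gcongr
      _ = _ := by rw [mul_assoc, ← Real.exp_add]; simp [hM]
  have h6 : ‖κ‖⁻¹ * potentialNorm v ≤ 1 / 2 := by
    rw [inv_mul_le_iff₀ hκ0]; linarith
  have h7 : ‖κ‖⁻¹ * potentialNorm v * M ≤ 1 / 2 * M := by gcongr
  have h8 : M ≤ 2 * (‖f 0‖ + ‖g 0‖ / ‖κ‖) := by linarith
  intro t ht
  refine (hbound t ht).trans ?_
  gcongr

theorem norm_solution_sub_le {f g h : ℝ → ℂ} (H : IsH2 0 l f g h) {κ : ℂ} (hκ : κ ≠ 0)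
    (hN : 2 * potentialNorm v ≤ ‖κ‖)
    (e : h =ᵐ[edgeMeasure l] fun t => (v t - κ ^ 2) * f t) :
    ‖f l - (Complex.cos (κ * l) * f 0 + Complex.sin (κ * l) / κ * g 0)‖ ≤
      ‖κ‖⁻¹ * potentialNorm v * (2 * (‖f 0‖ + ‖g 0‖ / ‖κ‖)) * Real.exp (|κ.im| * l) ∧
    ‖g l - (Complex.cos (κ * l) * g 0 - κ * Complex.sin (κ * l) * f 0)‖ ≤
      potentialNorm v * (2 * (‖f 0‖ + ‖g 0‖ / ‖κ‖)) * Real.exp (|κ.im| * l) := by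
  have hll : l ∈ Set.Icc 0 l := ⟨hl.out.le, le_rfl⟩
  have hb := norm_solution_le v H hκ hN e
  obtain ⟨h1, h2⟩ := variation_of_constants v H hκ e hll
  constructor
  · rw [h1, add_sub_cancel_left]
    refine norm_integral_kernel_le v H.continuousOn_fst hb (by positivity) (B := ‖κ‖⁻¹)
      (by positivity) hll (K := fun s : ℝ => Complex.sin (κ * (l - s)) / κ) (by fun_prop)
      fun s hs => ?_
    rw [norm_div, div_eq_inv_mul]
    exact mul_le_mul_of_nonneg_left (norm_kernel_le κ hs.2).1 (by positivity)
  · rw [h2, add_sub_cancel_left]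
    have := norm_integral_kernel_le v H.continuousOn_fst hb (by positivity) (B := 1)
      (by positivity) hll (K := fun s : ℝ => Complex.cos (κ * (l - s))) (by fun_prop)
      fun s hs => by rw [one_mul]; exact (norm_kernel_le κ hs.2).2
    rwa [one_mul] at this

theorem norm_end_sub_le {κ : ℂ} (hκ : κ ≠ 0) (hN : 2 * potentialNorm v ≤ ‖κ‖) :
    ‖u₁End v (κ ^ 2) - Complex.sin (κ * l) / κ‖ ≤
      2 * potentialNorm v / ‖κ‖ ^ 2 * Real.exp (|κ.im| * l) ∧
    ‖u₁End' v (κ ^ 2) - Complex.cos (κ * l)‖ ≤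
      2 * potentialNorm v / ‖κ‖ * Real.exp (|κ.im| * l) ∧
    ‖u₂End v (κ ^ 2) - Complex.cos (κ * l)‖ ≤
      2 * potentialNorm v / ‖κ‖ * Real.exp (|κ.im| * l) := by
  have hκ0 : ‖κ‖ ≠ 0 := norm_ne_zero_iff.mpr hκ
  obtain ⟨f, g, h, H, e, h1, h2⟩ := exists_isH2_solution v (κ ^ 2) 0 1
  obtain ⟨f', g', h', H', e', h1', h2'⟩ := exists_isH2_solution v (κ ^ 2) 1 0
  have a := norm_solution_sub_le v H hκ hN e
  have b := (norm_solution_sub_le v H' hκ hN e').1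
  rw [(isH2_end v H e).1, (isH2_end v H e).2, h1, h2] at a
  rw [(isH2_end v H' e').1, h1', h2'] at b
  simp only [mul_zero, mul_one, zero_add, sub_zero, add_zero, norm_zero, norm_one, zero_div] at a b
  refine ⟨a.1.trans_eq ?_, a.2.trans_eq ?_, b.trans_eq ?_⟩ <;> field_simp

end Edge

/-! ### Facts from real analysis -/

theorem eventually_lt_of_hasDerivAt_pos {f : ℝ → ℝ} {f' x : ℝ} (h : HasDerivAt f f' x)
    (hf' : 0 < f') : ∀ᶠ y in nhds x, (x < y → f x < f y) ∧ (y < x → f y < f x) := by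
  have h1 := (hasDerivAt_iff_tendsto_slope.mp h).eventually (lt_mem_nhds hf')
  rw [eventually_nhdsWithin_iff] at h1
  filter_upwards [h1] with y hy
  constructor
  · intro hxy
    have h2 := hy hxy.ne'
    rw [slope_def_field] at h2
    have := (div_pos_iff_of_pos_right (sub_pos.mpr hxy)).mp h2
    linarith
  · intro hxy
    have h2 := hy hxy.ne
    rw [slope_def_field, ← neg_div_neg_eq] at h2
    have := (div_pos_iff_of_pos_right (by linarith : 0 < -(y - x))).mp h2
    linarith

theorem eventually_gt_of_hasDerivAt_neg {f : ℝ → ℝ} {f' x : ℝ} (h : HasDerivAt f f' x)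
    (hf' : f' < 0) : ∀ᶠ y in nhds x, (x < y → f y < f x) ∧ (y < x → f x < f y) := by
  filter_upwards [eventually_lt_of_hasDerivAt_pos h.neg (by linarith : 0 < -f')] with y hy
  simpa using hy

theorem exists_left_of_eventually {p : ℝ → Prop} {a x : ℝ} (h : ∀ᶠ y in nhds x, p y)
    (hax : a < x) : ∃ y, a < y ∧ y < x ∧ p y := by
  have h1 : ∀ᶠ y in nhdsWithin x (Set.Iio x), p y ∧ a < y ∧ y < x := by
    filter_upwards [h.filter_mono nhdsWithin_le_nhds, Ioo_mem_nhdsLT hax] with y h1 h2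
    exact ⟨h1, h2⟩
  obtain ⟨y, h1, h2, h3⟩ := h1.exists
  exact ⟨y, h2, h3, h1⟩

theorem exists_right_of_eventually {p : ℝ → Prop} {b x : ℝ} (h : ∀ᶠ y in nhds x, p y)
    (hxb : x < b) : ∃ y, x < y ∧ y < b ∧ p y := by
  have h1 : ∀ᶠ y in nhdsWithin x (Set.Ioi x), p y ∧ x < y ∧ y < b := by
    filter_upwards [h.filter_mono nhdsWithin_le_nhds, Ioo_mem_nhdsGT hxb] with y h1 h2
    exact ⟨h1, h2⟩
  obtain ⟨y, h1, h2, h3⟩ := h1.exists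
  exact ⟨y, h2, h3, h1⟩

theorem pos_of_ne_zero_of_pos {f : ℝ → ℝ} (hf : Continuous f) {a b : ℝ}
    (h : ∀ x ∈ Set.uIcc a b, f x ≠ 0) (ha : 0 < f a) : 0 < f b := by
  by_contra hb
  have h1 : (0 : ℝ) ∈ Set.uIcc (f a) (f b) := by
    rw [Set.mem_uIcc]; right; exact ⟨not_lt.mp hb, ha.le⟩
  obtain ⟨x, hx, h0⟩ := intermediate_value_uIcc (hf.continuousOn (s := Set.uIcc a b)) h1
  exact h x hx h0

/-- Consecutive simple zeros have derivatives of opposite signs. -/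
theorem deriv_mul_neg_of_consecutive {f : ℝ → ℝ} (hf : Continuous f) {a b a' b' : ℝ} (hab : a < b)
    (ha : f a = 0) (hb : f b = 0) (hne : ∀ x, a < x → x < b → f x ≠ 0) (da : HasDerivAt f a' a)
    (db : HasDerivAt f b' b) (ha' : a' ≠ 0) (hb' : b' ≠ 0) : a' * b' < 0 := by
  have key : ∀ {f : ℝ → ℝ} {a' b' : ℝ}, Continuous f → f a = 0 → f b = 0 →
      (∀ x, a < x → x < b → f x ≠ 0) → HasDerivAt f a' a → HasDerivAt f b' b → 0 < a' → b' ≤ 0 := by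
    intro f a' b' hf ha hb hne da db ha'
    by_contra hb'
    obtain ⟨x, hx1, hx2, hx⟩ := exists_right_of_eventually
      (eventually_lt_of_hasDerivAt_pos da ha') hab
    obtain ⟨y, hy1, hy2, hy⟩ := exists_left_of_eventually
      (eventually_lt_of_hasDerivAt_pos db (not_le.mp hb')) hab
    have e1 := hx.1 hx1
    have e2 := hy.2 hy2
    rw [ha] at e1
    rw [hb] at e2
    refine absurd (pos_of_ne_zero_of_pos hf (a := x) (b := y) (fun t ht => ?_) e1) (by linarith)
    rcases Set.mem_uIcc.mp ht with h | h
    · exact hne t (hx1.trans_le h.1) (h.2.trans_lt hy2)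
    · exact hne t (hy1.trans_le h.1) (h.2.trans_lt hx2)
  rcases lt_or_gt_of_ne ha' with h | h
  · have h1 := key hf.neg (by simp [ha]) (by simp [hb]) (fun x h1 h2 => by simpa using hne x h1 h2)
      da.neg db.neg (by linarith)
    have h2 : 0 < b' := lt_of_le_of_ne (by linarith) hb'.symm
    nlinarith
  · have h1 := key hf ha hb hne da db h
    have h2 : b' < 0 := lt_of_le_of_ne h1 hb'
    nlinarith

/-- Enumeration of a locally finite set by successive infima. -/
theorem enumerate_locally_finite {Z : Set ℝ} (hfin : ∀ b, (Z ∩ Set.Iic b).Finite)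
    (hunb : ∀ b, ∃ x ∈ Z, b < x) {e : ℕ → ℝ} (h0 : e 0 = sInf Z)
    (hs : ∀ k, e (k + 1) = sInf {x | x ∈ Z ∧ e k < x}) :
    StrictMono e ∧ Set.range e = Z ∧ (∀ x ∈ Z, e 0 ≤ x) ∧
      ∀ k, ∀ x ∈ Z, e k < x → e (k + 1) ≤ x := by
  have key : ∀ S : Set ℝ, S ⊆ Z → S.Nonempty → sInf S ∈ S ∧ ∀ x ∈ S, sInf S ≤ x := by
    intro S hS ⟨b, hb⟩
    obtain ⟨m, ⟨hm, hmb⟩, hmin⟩ := Set.exists_min_image (S ∩ Set.Iic b) id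
      ((hfin b).subset (Set.inter_subset_inter_left _ hS)) ⟨b, hb, Set.mem_Iic.mpr le_rfl⟩
    have hlow : ∀ x ∈ S, m ≤ x := fun x hx => by
      rcases le_total x b with h | h
      · exact hmin x ⟨hx, h⟩
      · exact le_trans hmb h
    have : sInf S = m := le_antisymm (csInf_le ⟨m, hlow⟩ hm) (le_csInf ⟨b, hb⟩ hlow)
    rw [this]
    exact ⟨hm, hlow⟩
  obtain ⟨x₀, hx₀, -⟩ := hunb 0
  have k0 := key Z subset_rfl ⟨x₀, hx₀⟩
  rw [← h0] at k0
  have ks : ∀ k, (e (k + 1) ∈ Z ∧ e k < e (k + 1)) ∧ ∀ x ∈ Z, e k < x → e (k + 1) ≤ x := by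
    intro k
    have := key {x | x ∈ Z ∧ e k < x} (fun x hx => hx.1)
      (by obtain ⟨x, hx, hlt⟩ := hunb (e k); exact ⟨x, hx, hlt⟩)
    rw [← hs k] at this
    exact ⟨this.1, fun x hx hlt => this.2 x ⟨hx, hlt⟩⟩
  have hmono : StrictMono e := strictMono_nat_of_lt_succ fun k => (ks k).1.2
  have hmem : ∀ k, e k ∈ Z := fun k => by
    cases k with
    | zero => exact k0.1
    | succ k => exact (ks k).1.1
  refine ⟨hmono, Set.Subset.antisymm ?_ ?_, k0.2, fun k => (ks k).2⟩
  · rintro _ ⟨k, rfl⟩; exact hmem k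
  · intro x hx
    -- A point of `Z` missed by `e` would lie above every `e k`, so that infinitely many points of
    -- `Z` would lie below it.
    by_contra hnot
    have hlt : ∀ k, e k < x := by
      intro k
      induction k with
      | zero => exact lt_of_le_of_ne (k0.2 x hx) fun h => hnot ⟨0, h⟩
      | succ k ih => exact lt_of_le_of_ne ((ks k).2 x hx ih) fun h => hnot ⟨k + 1, h⟩
    refine (Set.infinite_range_of_injective hmono.injective) ((hfin x).subset ?_)
    rintro _ ⟨k, rfl⟩
    exact ⟨hmem k, (hlt k).le⟩

/-! ### The zeros of `u₁(l; ·)` and the discriminant -/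

section Edge

variable {l : ℝ} [hl : Fact (0 < l)] (v : EdgeSpace l)

/-- The potential is real. -/
abbrev IsRealPotential : Prop := ∀ᵐ t ∂edgeMeasure l, (starRingEnd ℂ) (v t) = v t

/-- The complex discriminant `u₁'(l; z) + u₂(l; z) + a u₁(l; z)`. -/
def discC (a : ℝ) (z : ℂ) : ℂ := u₁End' v z + u₂End v z + a * u₁End v z

/-- The discriminant on the real axis. -/
def disc (a x : ℝ) : ℝ := (discC v a x).re

/-- The value `u₁(l; x)` for real `x`. -/
def dirichletFn (x : ℝ) : ℝ := (u₁End v x).re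

/-- The derivative of `dirichletFn`. -/
def dirichletFn' (x : ℝ) : ℝ := (inhomEnd v x (solOne v x)).re

theorem hasDerivAt_dirichletFn (x : ℝ) : HasDerivAt (dirichletFn v) (dirichletFn' v x) x :=
  (hasDerivAt_u₁End v x).real_of_complex

theorem continuous_dirichletFn : Continuous (dirichletFn v) :=
  continuous_iff_continuousAt.mpr fun x => (hasDerivAt_dirichletFn v x).continuousAt

theorem hasDerivAt_discC (a : ℝ) (z : ℂ) : HasDerivAt (discC v a)
    (inhomEnd' v z (solOne v z) + inhomEnd v z (solTwo v z) + a * inhomEnd v z (solOne v z)) z :=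
  ((hasDerivAt_u₁End' v z).add (hasDerivAt_u₂End v z)).add ((hasDerivAt_u₁End v z).const_mul _)

theorem continuous_discC (a : ℝ) : Continuous (discC v a) :=
  continuous_iff_continuousAt.mpr fun x => (hasDerivAt_discC v a x).continuousAt

theorem differentiable_disc (a : ℝ) : Differentiable ℝ (disc v a) := fun x =>
  ((hasDerivAt_discC v a x).real_of_complex).differentiableAt

theorem continuous_disc (a : ℝ) : Continuous (disc v a) := (differentiable_disc v a).continuous

variable {v}

theorem ofReal_dirichletFn (hv : IsRealPotential v) (x : ℝ) : (dirichletFn v x : ℂ) = u₁End v x :=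
  Complex.conj_eq_iff_re.mp (conj_end v hv x).1

theorem ofReal_u₁End'_re (hv : IsRealPotential v) (x : ℝ) : ((u₁End' v x).re : ℂ) = u₁End' v x :=
  Complex.conj_eq_iff_re.mp (conj_end v hv x).2.1

theorem ofReal_disc (hv : IsRealPotential v) (a x : ℝ) : (disc v a x : ℂ) = discC v a x := by
  obtain ⟨h1, h2, h3⟩ := conj_end v hv x
  refine Complex.conj_eq_iff_re.mp ?_
  rw [discC, map_add, map_add, map_mul, h1, h2, h3, Complex.conj_ofReal]

/-- The coupling constant enters only through a multiple of `u₁(l; ·)`. It therefore moves the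
discriminant everywhere except at the Dirichlet eigenvalues. -/
theorem disc_eq_add (a x : ℝ) : disc v a x = disc v 0 x + a * dirichletFn v x := by
  simp [disc, discC, dirichletFn]

theorem solOne_ne_zero (z : ℂ) : solOne v z ≠ 0 := by
  obtain ⟨C, hC, h⟩ := exists_norm_initial_le v z
  intro h0
  have := (h 0 1).2
  rw [h0] at this
  simp at this
  linarith

/-- The zeros of `u₁(l; ·)` are real. -/
theorem conj_eq_of_u₁End_eq_zero (hv : IsRealPotential v)
    {z : ℂ} (hz : u₁End v z = 0) : (starRingEnd ℂ) z = z := by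
  have h1 := (edgeRel_solOne v z).inner_sub_inner v hv (edgeRel_solOne v z)
  rw [inner_smul_left, inner_smul_right, hz, ← sub_mul] at h1
  simp only [map_zero, mul_zero, zero_mul, sub_zero] at h1
  rcases mul_eq_zero.mp h1 with h | h
  · exact sub_eq_zero.mp h
  · exact absurd (inner_self_eq_zero.mp h) (solOne_ne_zero z)

/-- Green's formula for `u₁` and its derivative in the spectral parameter: when `u₁(l) = 0`, the
boundary terms reduce to `u₁'(l)` times the derivative of `u₁(l; ·)`, and this product equals
`‖u₁‖²`. So the zeros are simple, and the sign of the derivative there is that of `u₁'(l)`. -/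
theorem deriv_mul_pos (hv : IsRealPotential v) {x : ℝ} (hx : dirichletFn v x = 0) :
    0 < (u₁End' v x).re * dirichletFn' v x := by
  have hu : u₁End v x = 0 := by rw [← ofReal_dirichletFn hv, hx, Complex.ofReal_zero]
  set w := solInhom v x (solOne v x)
  have hw : EdgeRel v w ((x : ℂ) • w + solOne v x) 0 0 (inhomEnd v x (solOne v x))
      (inhomEnd' v x (solOne v x)) := (edgeRel_iff v x _ _ _ _ _ _).mpr (by simp [w])
  have h1 := (edgeRel_solOne v x).inner_sub_inner v hv hw
  rw [inner_add_right, inner_smul_left, inner_smul_right, hu, Complex.conj_ofReal,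
    (conj_end v hv x).2.1] at h1
  simp only [map_zero, mul_zero, zero_mul, zero_sub, sub_zero] at h1
  have h2 : u₁End' v x * inhomEnd v x (solOne v x) = inner ℂ (solOne v x) (solOne v x) := by
    linear_combination h1
  rw [← ofReal_u₁End'_re hv x, inner_self_eq_norm_sq_to_K] at h2
  have h3 := congrArg Complex.re h2
  rw [Complex.re_ofReal_mul] at h3
  rw [dirichletFn', h3]
  have : 0 < ‖solOne v x‖ := norm_pos_iff.mpr (solOne_ne_zero x)
  rw [← RCLike.ofReal_pow]
  change 0 < ((‖solOne v x‖ ^ 2 : ℝ) : ℂ).re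
  rw [Complex.ofReal_re]
  positivity

theorem dirichletFn'_ne_zero (hv : IsRealPotential v)
    {x : ℝ} (hx : dirichletFn v x = 0) : dirichletFn' v x ≠ 0 := fun h => by
  have := deriv_mul_pos hv hx
  rw [h, mul_zero] at this
  exact lt_irrefl _ this

/-- At a Dirichlet eigenvalue the discriminant is `s + s⁻¹` with `s = u₁'(l)`. -/
theorem disc_eq_of_zero (hv : IsRealPotential v) {x : ℝ} (a : ℝ) (hx : dirichletFn v x = 0) :
    (u₁End' v x).re ≠ 0 ∧ disc v a x = (u₁End' v x).re + ((u₁End' v x).re)⁻¹ := by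
  have hu : u₁End v x = 0 := by rw [← ofReal_dirichletFn hv, hx, Complex.ofReal_zero]
  have hW := wronskian_eq_one v x
  rw [hu, zero_mul, sub_zero] at hW
  have h0 : u₁End' v x ≠ 0 := left_ne_zero_of_mul_eq_one hW
  have h1 : u₂End v x = (u₁End' v x)⁻¹ := eq_inv_of_mul_eq_one_right hW
  have hr := ofReal_u₁End'_re hv x
  refine ⟨fun h => h0 (by rw [← hr, h, Complex.ofReal_zero]), ?_⟩
  apply Complex.ofReal_injective
  rw [ofReal_disc hv, discC, hu, h1, mul_zero, add_zero, Complex.ofReal_add, Complex.ofReal_inv, hr]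

/-- With `s = u₁'(l)` the value `s + s⁻¹` has modulus at least `2` and the sign of `s`, which by
`deriv_mul_pos` is the sign of the derivative of `u₁(l; ·)`. Consecutive zeros therefore carry
discriminants of opposite signs. -/
theorem disc_zero_cases (hv : IsRealPotential v) {x : ℝ} (a : ℝ) (hx : dirichletFn v x = 0) :
    (0 < dirichletFn' v x ∧ 2 ≤ disc v a x) ∨ (dirichletFn' v x < 0 ∧ disc v a x ≤ -2) := by
  obtain ⟨h0, h1⟩ := disc_eq_of_zero hv a hx
  have h2 := deriv_mul_pos hv hx
  set s := (u₁End' v x).re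
  rcases lt_or_gt_of_ne h0 with hs | hs
  · right
    refine ⟨by nlinarith, ?_⟩
    rw [h1]
    have : s * s⁻¹ = 1 := mul_inv_cancel₀ h0
    have h3 : s⁻¹ < 0 := inv_lt_zero.mpr hs
    nlinarith [sq_nonneg (s - s⁻¹)]
  · left
    refine ⟨by nlinarith, ?_⟩
    rw [h1]
    have : s * s⁻¹ = 1 := mul_inv_cancel₀ h0
    have h3 : 0 < s⁻¹ := inv_pos.mpr hs
    nlinarith [sq_nonneg (s - s⁻¹)]

/-- For `κ = i k` the free values are `sinh (k l) / k` and `cosh (k l)`; the potential changes them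
by errors that are smaller by a factor of order `1 / k`. -/
theorem exists_forall_left (a : ℝ) :
    ∃ X : ℝ, ∀ x ≤ X, 0 < dirichletFn v x ∧ 2 < disc v a x := by
  set N := potentialNorm v with hN
  have hN0 : 0 ≤ N := potentialNorm_nonneg v
  have hl0 := hl.out
  -- The part `8 * N + 4 * |a|` keeps the errors of the potential and the term with `a` below half
  -- of `exp (k l)`, which `2 cosh (k l)` exceeds; `4 / l` makes `exp (k l)` at least `5`, so that
  -- the remaining half is more than `2`.
  set k₀ := 8 * N + 4 * |a| + 1 + 4 / l with hk₀
  have hk₀0 : 0 < k₀ := by positivity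
  refine ⟨-(k₀ ^ 2), fun x hx => ?_⟩
  obtain ⟨k, hk, hkx⟩ : ∃ k, k₀ ≤ k ∧ x = -k ^ 2 := by
    refine ⟨√(-x), Real.le_sqrt_of_sq_le (by linarith), ?_⟩
    rw [Real.sq_sqrt (by nlinarith)]; ring
  have hk0 : 0 < k := hk₀0.trans_le hk
  have hkN : 8 * N + 4 * |a| < k := by
    have : 0 < 4 / l := by positivity
    linarith
  have ha0 := abs_nonneg a
  have hkl : 4 ≤ k * l := by
    have h1 : 4 / l ≤ k := by linarith [abs_nonneg a]
    rwa [div_le_iff₀ hl0] at h1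
  set κ : ℂ := k * Complex.I with hκ
  have hκn : ‖κ‖ = k := by simp [hκ, abs_of_pos hk0]
  have hκ0 : κ ≠ 0 := norm_ne_zero_iff.mp (by rw [hκn]; exact hk0.ne')
  have hκ2 : κ ^ 2 = (x : ℂ) := by
    rw [hκ, mul_pow, Complex.I_sq, hkx]; push_cast; ring
  have him : |κ.im| = k := by simp [hκ, abs_of_pos hk0]
  have hκl : κ * l = ((k * l : ℝ) : ℂ) * Complex.I := by rw [hκ]; push_cast; ring
  obtain ⟨b1, b2, b3⟩ := norm_end_sub_le v hκ0 (by rw [hκn]; linarith)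
  rw [hκ2, hκn, him, hκl] at b1 b2 b3
  rw [Complex.sin_mul_I, hκ, mul_div_mul_right _ _ Complex.I_ne_zero, ← Complex.ofReal_sinh,
    ← Complex.ofReal_div] at b1
  rw [Complex.cos_mul_I, ← Complex.ofReal_cosh] at b2 b3
  have c1 := (Complex.abs_re_le_norm _).trans b1
  have c2 := (Complex.abs_re_le_norm _).trans b2
  have c3 := (Complex.abs_re_le_norm _).trans b3
  rw [Complex.sub_re, Complex.ofReal_re] at c1 c2 c3
  set q := Real.exp (k * l) with hq
  have hq5 : 5 ≤ q := by linarith [Real.add_one_le_exp (k * l)]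
  have hqi : Real.exp (-(k * l)) ≤ 1 := Real.exp_le_one_iff.mpr (by linarith)
  have hqi0 := Real.exp_pos (-(k * l))
  have hsh : Real.sinh (k * l) = (q - Real.exp (-(k * l))) / 2 := Real.sinh_eq _
  have hch : Real.cosh (k * l) = (q + Real.exp (-(k * l))) / 2 := Real.cosh_eq _
  have hq0 : 0 < q := by linarith
  have hNk : N / k < 1 / 8 := by rw [div_lt_iff₀ hk0]; linarith
  have e1 : 2 * N / k ^ 2 * q = q / k * (2 * (N / k)) := by field_simp
  have hqk : 0 < q / k := by positivity
  have e2 : 2 * N / k ^ 2 * q < q / k * (1 / 4) := by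
    rw [e1]; exact mul_lt_mul_of_pos_left (by linarith) hqk
  have hs1 : q / k * (1 / 4) ≤ Real.sinh (k * l) / k := by
    rw [hsh, div_mul_eq_mul_div]; gcongr; linarith
  have hs2 : Real.sinh (k * l) / k ≤ q / k * 1 := by
    rw [hsh, mul_one]; gcongr; linarith
  rw [abs_le] at c1 c2 c3
  change -(2 * N / k ^ 2 * q) ≤ dirichletFn v x - _ ∧ dirichletFn v x - _ ≤ _ at c1
  have hD0 : 0 < dirichletFn v x := by linarith [c1.1]
  refine ⟨hD0, ?_⟩
  have hD1 : dirichletFn v x ≤ q / k * 2 := by linarith [c1.2]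
  have hdisc : disc v a x = (u₁End' v x).re + (u₂End v x).re + a * dirichletFn v x := by
    simp [disc, discC, dirichletFn]
  have e3 : a * dirichletFn v x ≥ -(|a| * (q / k * 2)) := by
    have : |a| * dirichletFn v x ≤ |a| * (q / k * 2) := by gcongr
    have h3 : -(|a|) * dirichletFn v x ≤ a * dirichletFn v x :=
      mul_le_mul_of_nonneg_right (neg_abs_le a) hD0.le
    linarith
  have e4 : 2 * (2 * N / k * q) + |a| * (q / k * 2) = q * ((8 * N + 4 * |a|) / k) / 2 := by
    field_simp; ring
  have e5 : (8 * N + 4 * |a|) / k < 1 := by rw [div_lt_one hk0]; exact hkN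
  have e6 : q * ((8 * N + 4 * |a|) / k) ≤ q * 1 := by gcongr
  rw [hdisc]
  linarith [c2.1, c3.1]

/-- At `k = (n + 1/2) π / l` the free value is `(-1) ^ n / k`, and for `k > 2 N` the error is too
small to change its sign. Consecutive points of this kind enclose a zero. -/
theorem exists_zero_gt (X : ℝ) : ∃ x, dirichletFn v x = 0 ∧ X < x := by
  set N := potentialNorm v with hN
  have hN0 : 0 ≤ N := potentialNorm_nonneg v
  have hl0 := hl.out
  have hpi := Real.pi_pos
  set k : ℕ → ℝ := fun n => (n * Real.pi + Real.pi / 2) / l with hk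
  have hk0 : ∀ n, 0 < k n := fun n => by simp only [hk]; positivity
  have sign : ∀ n, 2 * N < k n → 0 < (-1) ^ n * dirichletFn v (k n ^ 2) := by
    intro n hn
    have hkl : k n * l = n * Real.pi + Real.pi / 2 := by simp only [hk]; field_simp
    have hsin : Real.sin (k n * l) = (-1) ^ n := by
      rw [hkl, Real.sin_add_pi_div_two, Real.cos_nat_mul_pi]
    have hκ0 : ((k n : ℝ) : ℂ) ≠ 0 := Complex.ofReal_ne_zero.mpr (hk0 n).ne'
    have hκn : ‖((k n : ℝ) : ℂ)‖ = k n := by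
      rw [Complex.norm_real, Real.norm_eq_abs, abs_of_pos (hk0 n)]
    have b1 := (norm_end_sub_le v hκ0 (by rw [hκn]; linarith)).1
    rw [hκn, Complex.ofReal_im, abs_zero, zero_mul, Real.exp_zero, mul_one, ← Complex.ofReal_mul,
      ← Complex.ofReal_sin, ← Complex.ofReal_div, hsin, ← Complex.ofReal_pow] at b1
    have c1 := (Complex.abs_re_le_norm _).trans b1
    rw [Complex.sub_re, Complex.ofReal_re] at c1
    change |dirichletFn v (k n ^ 2) - _| ≤ _ at c1
    have h1 : 2 * N / k n ^ 2 < 1 / k n := by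
      have := hk0 n
      rw [div_lt_div_iff₀ (by positivity) this]
      nlinarith
    have h2 : |(-1) ^ n * dirichletFn v (k n ^ 2) - 1 / k n| < 1 / k n := by
      have h3 : (-1) ^ n * dirichletFn v (k n ^ 2) - 1 / k n
          = (-1) ^ n * (dirichletFn v (k n ^ 2) - (-1) ^ n / k n) := by
        have : ((-1 : ℝ) ^ n) * (-1) ^ n = 1 := by rw [← mul_pow]; simp
        rw [mul_sub, mul_div_assoc', this]
      rw [h3, abs_mul, abs_pow, abs_neg, abs_one, one_pow, one_mul]
      exact c1.trans_lt h1
    linarith [(abs_lt.mp h2).1]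
  have hkt : Filter.Tendsto k Filter.atTop Filter.atTop := by
    simp only [hk]
    refine Filter.Tendsto.atTop_div_const hl0 (Filter.tendsto_atTop_add_const_right _ _ ?_)
    exact tendsto_natCast_atTop_atTop.atTop_mul_const hpi
  obtain ⟨n, hn⟩ := (hkt.eventually_gt_atTop (2 * N + |X| + 1)).exists
  have hX := le_abs_self X
  have hX0 := abs_nonneg X
  have hlt : k n < k (n + 1) := by
    simp only [hk]
    push_cast
    gcongr
    linarith
  have s1 := sign n (by linarith)
  have s2 := sign (n + 1) (by linarith)
  rw [pow_succ] at s2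
  have hle : k n ^ 2 ≤ k (n + 1) ^ 2 := by have := hk0 n; gcongr
  have h0 : (0 : ℝ) ∈ Set.uIcc (dirichletFn v (k n ^ 2)) (dirichletFn v (k (n + 1) ^ 2)) := by
    rw [Set.mem_uIcc]
    rcases neg_one_pow_eq_or ℝ n with h | h <;> rw [h] at s1 s2
    · right; constructor <;> linarith
    · left; constructor <;> linarith
  obtain ⟨x, hx, hx0⟩ := intermediate_value_uIcc
    ((continuous_dirichletFn v).continuousOn (s := Set.uIcc (k n ^ 2) (k (n + 1) ^ 2))) h0
  rw [Set.uIcc_of_le hle] at hx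
  refine ⟨x, hx0, lt_of_lt_of_le ?_ hx.1⟩
  nlinarith

/-- There are no zeros far to the left, and an accumulation point would be a zero that is not
simple. -/
theorem finite_zeros (hv : IsRealPotential v)
    (b : ℝ) : ({x | dirichletFn v x = 0} ∩ Set.Iic b).Finite := by
  by_contra hinf
  obtain ⟨X, hX⟩ := exists_forall_left (v := v) 0
  have hsub : {x | dirichletFn v x = 0} ∩ Set.Iic b ⊆ Set.Icc X b := fun x hx => by
    refine ⟨?_, hx.2⟩
    by_contra h
    exact (hX x (not_le.mp h).le).1.ne' hx.1
  obtain ⟨x, -, hacc⟩ := Set.Infinite.exists_accPt_of_subset_isCompact hinf isCompact_Icc hsub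
  have hcl : IsClosed {x | dirichletFn v x = 0} :=
    isClosed_singleton.preimage (continuous_dirichletFn v)
  have hfreq := accPt_iff_frequently_nhdsNE.mp hacc
  have hx0 : dirichletFn v x = 0 := by
    have : x ∈ closure {x | dirichletFn v x = 0} :=
      mem_closure_iff_frequently.mpr ((hfreq.filter_mono nhdsWithin_le_nhds).mono fun y hy => hy.1)
    rwa [hcl.closure_eq] at this
  refine hfreq (((hasDerivAt_dirichletFn v x).eventually_ne (c := 0)
    (dirichletFn'_ne_zero hv hx0)).mono fun y hy h => hy h.1)

theorem mem_dirichletGraph_iff {V : ℝ → ℝ} (hvV : v =ᵐ[edgeMeasure l] fun t => (V t : ℂ))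
    (p : EdgeSpace l × EdgeSpace l) :
    p ∈ dirichletGraph l V ↔ ∃ b d, EdgeRel v p.1 p.2 0 b 0 d := by
  have e : ∀ f h : ℝ → ℂ, (fun t => -h t + v t * f t) =ᵐ[edgeMeasure l]
      fun t => -h t + (V t : ℂ) * f t := fun f h => by
    filter_upwards [hvV] with t ht
    rw [ht]
  constructor
  · rintro ⟨f, g, h, H, h1, h2, h3, h4⟩
    exact ⟨g 0, g l, f, g, h, H, h1, h2.trans (e f h).symm, h3, rfl, h4, rfl⟩
  · rintro ⟨b, d, f, g, h, H, h1, h2, h3, -, h4, -⟩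
    exact ⟨f, g, h, H, h1, h2.trans (e f h), h3, h4⟩

theorem isEigenvalue_iff_graph {E : Type*} [NormedAddCommGroup E] [InnerProductSpace ℂ E]
    (T : E →ₗ.[ℂ] E) (z : ℂ) : IsEigenvalue T z ↔ ∃ x, x ≠ 0 ∧ (x, z • x) ∈ T.graph := by
  constructor
  · rintro ⟨x, hx, h⟩
    refine ⟨x, hx, ?_⟩
    rw [← h]
    exact T.mem_graph x
  · rintro ⟨x, hx, h⟩
    obtain ⟨y, hy1, hy2⟩ := (T.mem_graph_iff).mp h
    refine ⟨y, ?_, ?_⟩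
    · rwa [hy1]
    · rw [hy2, hy1]

theorem isEigenvalue_dirichletOp_iff {V : ℝ → ℝ} (hvV : v =ᵐ[edgeMeasure l] fun t => (V t : ℂ))
    (z : ℂ) : IsEigenvalue (dirichletOp l V) z ↔ u₁End v z = 0 := by
  rw [isEigenvalue_iff_graph, dirichletOp_graph hl.out]
  constructor
  · rintro ⟨x, hx, h⟩
    obtain ⟨b, d, h⟩ := (mem_dirichletGraph_iff hvV _).mp h
    obtain ⟨h1, h2, -⟩ := (edgeRel_iff v z _ _ _ _ _ _).mp h
    simp only [zero_smul, zero_add, sub_self, map_zero, add_zero, mul_zero] at h1 h2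
    rcases mul_eq_zero.mp h2.symm with h | h
    · exact h
    · rw [h, zero_smul] at h1
      exact absurd h1 hx
  · intro h
    refine ⟨solOne v z, solOne_ne_zero z, (mem_dirichletGraph_iff hvV _).mpr ⟨1, u₁End' v z, ?_⟩⟩
    have := edgeRel_solOne v z
    rwa [h] at this

theorem isEigenvalue_dirichletOp_ofReal_iff (hv : IsRealPotential v) {V : ℝ → ℝ}
    (hvV : v =ᵐ[edgeMeasure l] fun t => (V t : ℂ)) (x : ℝ) :
    IsEigenvalue (dirichletOp l V) x ↔ dirichletFn v x = 0 := by
  rw [isEigenvalue_dirichletOp_iff hvV, ← ofReal_dirichletFn hv, Complex.ofReal_eq_zero]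

theorem dirichletEigenvalue_enumerates (hv : IsRealPotential v) {V : ℝ → ℝ}
    (hvV : v =ᵐ[edgeMeasure l] fun t => (V t : ℂ)) :
    StrictMono (dirichletEigenvalue l V) ∧
      Set.range (dirichletEigenvalue l V) = {x | dirichletFn v x = 0} ∧
      (∀ x, dirichletFn v x = 0 → dirichletEigenvalue l V 0 ≤ x) ∧
      ∀ k x, dirichletFn v x = 0 → dirichletEigenvalue l V k < x →
        dirichletEigenvalue l V (k + 1) ≤ x := by
  refine enumerate_locally_finite (finite_zeros hv) (fun b => ?_) ?_ fun k => ?_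
  · exact exists_zero_gt (v := v) b
  · simp only [dirichletEigenvalue, isEigenvalue_dirichletOp_ofReal_iff hv hvV]
  · simp only [dirichletEigenvalue, isEigenvalue_dirichletOp_ofReal_iff hv hvV, Set.mem_ofPred_eq]

theorem dirichletFn_eigenvalue (hv : IsRealPotential v)
    {V : ℝ → ℝ} (hvV : v =ᵐ[edgeMeasure l] fun t => (V t : ℂ)) (k : ℕ) :
    dirichletFn v (dirichletEigenvalue l V k) = 0 := by
  have := (dirichletEigenvalue_enumerates hv hvV).2.1
  exact this.subset ⟨k, rfl⟩

/-- The eigenvalue condition for a complex number. -/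
theorem u₁End_eq_zero_iff (hv : IsRealPotential v)
    {V : ℝ → ℝ} (hvV : v =ᵐ[edgeMeasure l] fun t => (V t : ℂ)) (z : ℂ) :
    u₁End v z = 0 ↔ ∃ k, z = dirichletEigenvalue l V k := by
  constructor
  · intro h
    have h1 := Complex.conj_eq_iff_re.mp (conj_eq_of_u₁End_eq_zero hv h)
    rw [← h1, ← ofReal_dirichletFn hv, Complex.ofReal_eq_zero] at h
    obtain ⟨k, hk⟩ := (dirichletEigenvalue_enumerates hv hvV).2.1.superset h
    exact ⟨k, by rw [← h1, ← hk]⟩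
  · rintro ⟨k, rfl⟩
    rw [← ofReal_dirichletFn hv, dirichletFn_eigenvalue hv hvV, Complex.ofReal_zero]

/-- The discriminant has a zero in each interval between consecutive Dirichlet eigenvalues, and
one below all of them. -/
theorem exists_interlacing (hv : IsRealPotential v)
    {V : ℝ → ℝ} (hvV : v =ᵐ[edgeMeasure l] fun t => (V t : ℂ)) (a : ℝ) :
    ∃ p : ℕ → ℝ, ∀ k, p k < dirichletEigenvalue l V k ∧ dirichletEigenvalue l V k < p (k + 1) ∧
      disc v a (p k) = 0 := by
  set e := dirichletEigenvalue l V
  obtain ⟨hmono, hrange, hmin, hnext⟩ := dirichletEigenvalue_enumerates hv hvV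
  have hz := dirichletFn_eigenvalue hv hvV
  have ivt : ∀ {x y : ℝ}, x < y → disc v a x ≠ 0 → disc v a y ≠ 0 →
      disc v a x * disc v a y < 0 → ∃ p, x < p ∧ p < y ∧ disc v a p = 0 := by
    intro x y hxy hx hy hneg
    have h0 : (0 : ℝ) ∈ Set.uIcc (disc v a x) (disc v a y) := by
      rw [Set.mem_uIcc]
      rcases mul_neg_iff.mp hneg with h | h
      · right; exact ⟨h.2.le, h.1.le⟩
      · left; exact ⟨h.1.le, h.2.le⟩
    obtain ⟨p, hp, hp0⟩ := intermediate_value_uIcc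
      ((continuous_disc v a).continuousOn (s := Set.uIcc x y)) h0
    rw [Set.uIcc_of_le hxy.le] at hp
    refine ⟨p, lt_of_le_of_ne hp.1 ?_, lt_of_le_of_ne hp.2 ?_, hp0⟩
    · rintro rfl; exact hx hp0
    · rintro rfl; exact hy hp0
  have hne : ∀ k, disc v a (e k) ≠ 0 := fun k => by
    rcases disc_zero_cases hv a (hz k) with h | h
    · linarith [h.2]
    · linarith [h.2]
  -- Far to the left both `dirichletFn` and the discriminant are positive. As `dirichletFn` has no
  -- zero below `e 0`, it decreases through `e 0`, so the discriminant is at most `-2` there and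
  -- vanishes in between.
  have hp0 : ∃ p, p < e 0 ∧ disc v a p = 0 := by
    obtain ⟨X, hX⟩ := exists_forall_left (v := v) a
    set x := min X (e 0 - 1)
    have hx := hX x (min_le_left _ _)
    have hx1 : x < e 0 := by linarith [min_le_right X (e 0 - 1)]
    have hneg : dirichletFn' v (e 0) < 0 := by
      by_contra hpos
      have hpos' : 0 < dirichletFn' v (e 0) :=
        lt_of_le_of_ne (not_lt.mp hpos) (dirichletFn'_ne_zero hv (hz 0)).symm
      obtain ⟨y, hy1, hy2, hy⟩ := exists_left_of_eventually
        (eventually_lt_of_hasDerivAt_pos (hasDerivAt_dirichletFn v (e 0)) hpos') hx1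
      have h1 := hy.2 hy2
      rw [hz 0] at h1
      refine absurd (pos_of_ne_zero_of_pos (continuous_dirichletFn v) (a := x) (b := y)
        (fun t ht h0 => ?_) hx.1) (by linarith)
      rw [Set.uIcc_of_le hy1.le] at ht
      exact absurd (hmin t h0) (by linarith [ht.2])
    have h2 : disc v a (e 0) ≤ -2 := by
      rcases disc_zero_cases hv a (hz 0) with h | h
      · linarith [h.1]
      · exact h.2
    obtain ⟨p, -, h1, h3⟩ := ivt hx1 (by linarith [hx.2]) (hne 0) (by nlinarith [hx.2])
    exact ⟨p, h1, h3⟩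
  have hps : ∀ k, ∃ p, e k < p ∧ p < e (k + 1) ∧ disc v a p = 0 := by
    intro k
    have hlt : e k < e (k + 1) := hmono (Nat.lt_succ_self k)
    have h1 := deriv_mul_neg_of_consecutive (continuous_dirichletFn v) hlt (hz k) (hz (k + 1))
      (fun x h1 h2 h0 => absurd (hnext k x h0 h1) (not_le.mpr h2)) (hasDerivAt_dirichletFn v _)
      (hasDerivAt_dirichletFn v _) (dirichletFn'_ne_zero hv (hz k))
      (dirichletFn'_ne_zero hv (hz (k + 1)))
    refine ivt hlt (hne k) (hne (k + 1)) ?_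
    rcases disc_zero_cases hv a (hz k) with h | h <;>
      rcases disc_zero_cases hv a (hz (k + 1)) with h' | h' <;> nlinarith
  choose q hq1 hq2 hq3 using hps
  obtain ⟨p, hp1, hp2⟩ := hp0
  refine ⟨fun k => Nat.casesOn k p q, fun k => ?_⟩
  cases k with
  | zero => exact ⟨hp1, hq1 0, hp2⟩
  | succ k => exact ⟨hq2 k, hq1 (k + 1), hq3 k⟩

end Edge

/-! ### Operators between `ℓ²` spaces -/

section Lp2

/-- Square summable families in a fixed normed space. -/
abbrev L2Sum (ι F : Type*) [NormedAddCommGroup F] : Type _ := lp (fun _ : ι => F) 2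

variable {ι κ F G : Type*} [NormedAddCommGroup F] [NormedSpace ℂ F] [NormedAddCommGroup G]
  [NormedSpace ℂ G]

theorem memℓp_two_iff {f : ι → F} : Memℓp f 2 ↔ Summable fun i => ‖f i‖ ^ 2 := by
  rw [memℓp_gen_iff (by norm_num)]
  simp

theorem hasSum_norm_sq (f : L2Sum ι F) : HasSum (fun i => ‖f i‖ ^ 2) (‖f‖ ^ 2) := by
  simpa using lp.hasSum_norm (p := 2) (by norm_num) f

theorem memℓp_of_le {f : ι → F} (g : L2Sum ι G) {C : ℝ} (h : ∀ i, ‖f i‖ ≤ C * ‖g i‖) :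
    Memℓp f 2 := by
  refine memℓp_two_iff.mpr (Summable.of_nonneg_of_le (fun _ => sq_nonneg _) (fun i => ?_)
    ((hasSum_norm_sq g).summable.mul_left (C ^ 2)))
  rw [← mul_pow]
  exact pow_le_pow_left₀ (norm_nonneg _) (h i) 2

theorem norm_le_of_forall_le (f : L2Sum ι F) (g : L2Sum ι G) {C : ℝ} (hC : 0 ≤ C)
    (h : ∀ i, ‖f i‖ ≤ C * ‖g i‖) : ‖f‖ ≤ C * ‖g‖ := by
  refine le_of_sq_le_sq ?_ (by positivity)
  rw [mul_pow]
  refine hasSum_le (fun i => ?_) (hasSum_norm_sq f) ((hasSum_norm_sq g).mul_left (C ^ 2))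
  rw [← mul_pow]
  exact pow_le_pow_left₀ (norm_nonneg _) (h i) 2

theorem norm_eq_of_forall_eq (f : L2Sum ι F) (g : L2Sum ι G) {C : ℝ} (hC : 0 ≤ C)
    (h : ∀ i, ‖f i‖ = C * ‖g i‖) : ‖f‖ = C * ‖g‖ := by
  refine (sq_eq_sq₀ (norm_nonneg _) (by positivity)).mp ?_
  rw [mul_pow]
  refine (hasSum_norm_sq f).unique (((hasSum_norm_sq g).mul_left (C ^ 2)).congr_fun ?_)
  intro i
  rw [h i, mul_pow]

/-- A bounded operator applied to each component. -/
def lpMap (T : F →L[ℂ] G) : L2Sum ι F →L[ℂ] L2Sum ι G :=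
  LinearMap.mkContinuous
    { toFun := fun f => ⟨fun i => T (f i), memℓp_of_le f fun i => T.le_opNorm (f i)⟩
      map_add' := fun _ _ => lp.ext (funext fun _ => T.map_add _ _)
      map_smul' := fun _ _ => lp.ext (funext fun _ => T.map_smul _ _) } ‖T‖
    fun f => norm_le_of_forall_le _ f (norm_nonneg T) fun i => T.le_opNorm (f i)

theorem lpMap_apply (T : F →L[ℂ] G) (f : L2Sum ι F) (i : ι) : lpMap T f i = T (f i) := rfl

/-- The family `i ↦ w i • x`. -/
def lpTensor (x : F) : L2Sum ι ℂ →L[ℂ] L2Sum ι F :=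
  lpMap (ContinuousLinearMap.toSpanSingleton ℂ x)

theorem lpTensor_apply (x : F) (w : L2Sum ι ℂ) (i : ι) : lpTensor x w i = w i • x := by
  simp [lpTensor, lpMap_apply]

theorem norm_lpTensor (x : F) (w : L2Sum ι ℂ) : ‖lpTensor x w‖ = ‖x‖ * ‖w‖ :=
  norm_eq_of_forall_eq _ _ (norm_nonneg _) fun i => by rw [lpTensor_apply, norm_smul, mul_comm]

variable {D : Type*} [Fintype D]

/-- The tag `t` embeds `ι` into `κ × D`, so every value of `s` is taken at most `Fintype.card D`
times. For the lattice the tag is the direction of an edge: each node is the initial point of two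
edges. -/
theorem summable_comp_of_injective {φ : κ → ℝ} (hφ : Summable φ) (h0 : ∀ k, 0 ≤ φ k)
    (s : ι → κ) (t : ι → D) (hst : Function.Injective fun i => (s i, t i)) :
    Summable (fun i => φ (s i)) ∧ ∑' i, φ (s i) ≤ Fintype.card D * ∑' k, φ k := by
  have h1 : HasSum (fun p : κ × D => φ p.1) (∑' k, (Fintype.card D : ℝ) * φ k) := by
    have hs : Summable fun p : κ × D => φ p.1 := by
      have := hφ.mul_of_nonneg (hasSum_fintype fun _ : D => (1 : ℝ)).summable h0
        fun _ => zero_le_one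
      simpa using this
    convert hs.hasSum using 1
    rw [hs.tsum_prod]
    refine tsum_congr fun k => ?_
    simp [tsum_fintype]
  have h2 := h1.summable.comp_injective hst
  refine ⟨h2, ?_⟩
  have h3 := tsum_comp_le_tsum_of_inj h1.summable (fun p => h0 p.1) hst
  rw [h1.tsum_eq, tsum_mul_left] at h3
  exact h3

theorem pull_bound (s : ι → κ) (t : ι → D) (hst : Function.Injective fun i => (s i, t i))
    {c : ι → ℂ} {C : ℝ} (hc : ∀ i, ‖c i‖ ≤ C) (g : L2Sum κ F) :
    Summable (fun i => ‖c i • g (s i)‖ ^ 2) ∧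
      ∑' i, ‖c i • g (s i)‖ ^ 2 ≤ C ^ 2 * (Fintype.card D * ‖g‖ ^ 2) := by
  obtain ⟨h1, h2⟩ := summable_comp_of_injective (φ := fun k => ‖g k‖ ^ 2)
    (hasSum_norm_sq g).summable (fun _ => sq_nonneg _) s t hst
  rw [(hasSum_norm_sq g).tsum_eq] at h2
  have bd : ∀ i, ‖c i • g (s i)‖ ^ 2 ≤ C ^ 2 * ‖g (s i)‖ ^ 2 := fun i => by
    rw [norm_smul, mul_pow]
    have := hc i
    gcongr
  have hs := Summable.of_nonneg_of_le (fun _ => sq_nonneg _) bd (h1.mul_left _)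
  refine ⟨hs, (hs.tsum_le_tsum bd (h1.mul_left _)).trans ?_⟩
  rw [tsum_mul_left]
  gcongr

/-- Weighted pullback `g ↦ (i ↦ c i • g (s i))` along a map `s` with fibres of bounded size. -/
def lpPull (s : ι → κ) (t : ι → D) (hst : Function.Injective fun i => (s i, t i)) (c : ι → ℂ)
    (C : ℝ) (hc : ∀ i, ‖c i‖ ≤ C) : L2Sum κ F →L[ℂ] L2Sum ι F :=
  LinearMap.mkContinuous
    { toFun := fun g => ⟨fun i => c i • g (s i), memℓp_two_iff.mpr (pull_bound s t hst hc g).1⟩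
      map_add' := fun _ _ => lp.ext (funext fun _ => smul_add _ _ _)
      map_smul' := fun _ _ => lp.ext (funext fun _ => smul_comm _ _ _) }
    (|C| * √(Fintype.card D)) <| by
      intro g
      obtain ⟨h1, h2⟩ := pull_bound s t hst hc g
      refine le_of_sq_le_sq ?_ (by positivity)
      rw [mul_pow, mul_pow, sq_abs, Real.sq_sqrt (Nat.cast_nonneg _), mul_assoc]
      have h3 := hasSum_norm_sq (ι := ι) (F := F)
        ⟨fun i => c i • g (s i), memℓp_two_iff.mpr h1⟩
      exact h3.tsum_eq.symm.trans_le h2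

theorem lpPull_apply (s : ι → κ) (t : ι → D) (hst : Function.Injective fun i => (s i, t i))
    (c : ι → ℂ) (C : ℝ) (hc : ∀ i, ‖c i‖ ≤ C) (g : L2Sum κ F) (i : ι) :
    lpPull s t hst c C hc g i = c i • g (s i) := rfl

end Lp2

/-! ### Weighted shifts: isometry and adjoint. -/

section Shift

variable {ι : Type*} {A B : L2Sum ι ℂ →L[ℂ] L2Sum ι ℂ} {c : ι → ℂ} {e : ι ≃ ι}

theorem norm_shift (hc : ∀ x, ‖c x‖ = 1) (hA : ∀ g x, A g x = c x * g (e x)) (g : L2Sum ι ℂ) :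
    ‖A g‖ = ‖g‖ := by
  refine (sq_eq_sq₀ (norm_nonneg _) (norm_nonneg _)).mp ?_
  refine (hasSum_norm_sq (A g)).unique ?_
  have := (e.hasSum_iff).mpr (hasSum_norm_sq g)
  refine this.congr_fun fun x => ?_
  rw [hA, norm_mul, hc, one_mul, Function.comp_apply]

theorem inner_shift (hA : ∀ g x, A g x = c x * g (e x))
    (hB : ∀ g x, B g x = (starRingEnd ℂ) (c (e.symm x)) * g (e.symm x)) (g h : L2Sum ι ℂ) :
    inner ℂ (A g) h = inner ℂ g (B h) := by
  rw [lp.inner_eq_tsum, lp.inner_eq_tsum, ← e.tsum_eq fun x => inner ℂ (g x) (B h x)]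
  refine tsum_congr fun x => ?_
  rw [hA, hB, e.symm_apply_apply]
  simp only [RCLike.inner_apply, map_mul]
  ring

end Shift

theorem mem_spectrum_of_selfAdjoint {H : Type*} [NormedAddCommGroup H] [InnerProductSpace ℂ H]
    [CompleteSpace H] {A : H →L[ℂ] H} (hA : ∀ x y, inner ℂ (A x) y = inner ℂ x (A y)) {C : ℝ}
    (hC : ∀ x, ‖A x‖ ≤ C * ‖x‖) (hC0 : 0 ≤ C) {z : ℂ} (hz : z ∈ spectrum ℂ A) :
    ∃ r : ℝ, |r| ≤ C ∧ z = r := by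
  have hs : IsSelfAdjoint A := ContinuousLinearMap.isSelfAdjoint_iff_isSymmetric.mpr hA
  have h1 := hs.mem_spectrum_eq_re hz
  refine ⟨z.re, ?_, h1⟩
  have h2 := spectrum.norm_le_norm_mul_of_mem hz
  have h3 : ‖A‖ ≤ C := A.opNorm_le_bound hC0 hC
  have h4 : ‖(1 : H →L[ℂ] H)‖ ≤ 1 := ContinuousLinearMap.norm_id_le
  rw [h1, Complex.norm_real, Real.norm_eq_abs] at h2
  calc |z.re| ≤ ‖A‖ * ‖(1 : H →L[ℂ] H)‖ := h2
    _ ≤ C * 1 := by gcongr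
    _ = C := mul_one C

/-! ### Slowly decaying weights -/

/-- The relative change of the weight between neighbours is at most `ρ⁻¹ - 1`, which tends to `0` as
`ρ → 1`. Exponential weights thus act as cutoffs whose error is controlled pointwise by the weight
itself, without boundary terms. -/
theorem abs_pow_sub_pow_le {ρ : ℝ} (h0 : 0 < ρ) (h1 : ρ ≤ 1) {a b : ℕ} (hab : a ≤ b + 1)
    (hba : b ≤ a + 1) : |ρ ^ a - ρ ^ b| ≤ (ρ⁻¹ - 1) * ρ ^ b := by
  have hi : 1 ≤ ρ⁻¹ := (one_le_inv₀ h0).mpr h1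
  have hm : ρ * ρ⁻¹ = 1 := mul_inv_cancel₀ h0.ne'
  obtain rfl | rfl | rfl : a = b + 1 ∨ a = b ∨ b = a + 1 := by omega
  · have hp : 0 < ρ ^ b := by positivity
    rw [pow_succ, abs_sub_comm, abs_of_nonneg (by nlinarith)]
    have : 1 - ρ ≤ ρ⁻¹ - 1 := by nlinarith [sq_nonneg (ρ - 1), sq_nonneg (ρ⁻¹ - 1)]
    nlinarith
  · simp only [sub_self, abs_zero]
    have : 0 ≤ ρ⁻¹ - 1 := by linarith
    positivity
  · have hp : 0 < ρ ^ a := by positivity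
    rw [pow_succ, abs_of_nonneg (by nlinarith)]
    apply le_of_eq
    linear_combination -(ρ ^ a) * hm

/-- The weight `ρ ^ |k|` on `ℤ`. -/
def decay (ρ : ℝ) (k : ℤ) : ℝ := ρ ^ k.natAbs

theorem decay_pos {ρ : ℝ} (h0 : 0 < ρ) (k : ℤ) : 0 < decay ρ k := pow_pos h0 _

theorem abs_decay_sub_le {ρ : ℝ} (h0 : 0 < ρ) (h1 : ρ ≤ 1) {j k : ℤ} (h : |j - k| ≤ 1) :
    |decay ρ j - decay ρ k| ≤ (ρ⁻¹ - 1) * decay ρ k := by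
  rw [abs_le] at h
  exact abs_pow_sub_pow_le h0 h1 (by omega) (by omega)

theorem summable_decay_sq {ρ : ℝ} (h0 : 0 < ρ) (h1 : ρ < 1) : Summable fun k => decay ρ k ^ 2 := by
  have h2 : Summable fun n : ℕ => (ρ ^ 2) ^ n := summable_geometric_of_lt_one (sq_nonneg _)
    (by nlinarith)
  refine summable_int_iff_summable_nat_and_neg.mpr ⟨h2.congr fun n => ?_, h2.congr fun n => ?_⟩
  · simp [decay, ← pow_mul, mul_comm]
  · simp [decay, ← pow_mul, mul_comm]

/-! ### The discrete Laplacian on `ℤ` -/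

/-- The shift `(S g)ₖ = g (k + j)` on `ℓ²(ℤ)`. -/
def chainShift (j : ℤ) : L2Sum ℤ ℂ →L[ℂ] L2Sum ℤ ℂ :=
  lpPull (fun k => k + j) (fun _ => ()) (fun a b h => by simpa using h) (fun _ => 1) 1 (by simp)

theorem chainShift_apply (j : ℤ) (g : L2Sum ℤ ℂ) (k : ℤ) : chainShift j g k = g (k + j) :=
  (lpPull_apply _ _ _ _ _ _ g k).trans (one_smul ℂ _)

/-- The operator `(J g)ₖ = g (k + 1) + g (k - 1)` on `ℓ²(ℤ)`. -/
def chainLaplacian : L2Sum ℤ ℂ →L[ℂ] L2Sum ℤ ℂ := chainShift 1 + chainShift (-1)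

theorem chainLaplacian_apply (g : L2Sum ℤ ℂ) (k : ℤ) :
    chainLaplacian g k = g (k + 1) + g (k - 1) := by
  change chainShift 1 g k + chainShift (-1) g k = _
  rw [chainShift_apply, chainShift_apply, ← sub_eq_add_neg]

/-- The operator is the sum of a unitary shift and its adjoint. One inclusion suffices: it provides
the inverse used for the resolvent of the Kronig–Penney operator, while spectrum is produced by
explicit approximate eigenvectors. -/
theorem mem_spectrum_chainLaplacian {z : ℂ} (hz : z ∈ spectrum ℂ chainLaplacian) :
    ∃ r : ℝ, |r| ≤ 2 ∧ z = r := by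
  have hA : ∀ (j : ℤ) g x, chainShift j g x = (fun _ => (1 : ℂ)) x * g (Equiv.addRight j x) :=
    fun j g x => by simp [chainShift_apply]
  have hn : ∀ j g, ‖chainShift j g‖ = ‖g‖ := fun j => norm_shift (by simp) (hA j)
  have hi : ∀ j g h, inner ℂ (chainShift j g) h = inner ℂ g (chainShift (-j) h) := fun j =>
    inner_shift (hA j) fun g x => by
      rw [chainShift_apply]
      simp [← sub_eq_add_neg]
  refine mem_spectrum_of_selfAdjoint (A := chainLaplacian) (fun g h => ?_) (fun g => ?_)
    zero_le_two hz
  · change inner ℂ (chainShift 1 g + chainShift (-1) g) h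
      = inner ℂ g (chainShift 1 h + chainShift (-1) h)
    rw [inner_add_left, inner_add_right, hi, hi, neg_neg, add_comm]
  · change ‖chainShift 1 g + chainShift (-1) g‖ ≤ _
    refine (norm_add_le _ _).trans_eq ?_
    rw [hn, hn]; ring

/-! ### The spectrum of the discrete magnetic Laplacian -/

theorem phase_add (θ : ℝ) (j k : ℤ) : phase θ (j + k) = phase θ j * phase θ k := by
  rw [phase, phase, phase, ← Complex.exp_add]
  congr 1
  push_cast
  ring

theorem phase_zero (θ : ℝ) : phase θ 0 = 1 := by simp [phase]

theorem phase_mul_neg (θ : ℝ) (k : ℤ) : phase θ k * phase θ (-k) = 1 := by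
  rw [← phase_add, add_neg_cancel, phase_zero]

theorem phase_ne_zero (θ : ℝ) (k : ℤ) : phase θ k ≠ 0 := left_ne_zero_of_mul_eq_one (phase_mul_neg θ k)

theorem conj_phase (θ : ℝ) (k : ℤ) : (starRingEnd ℂ) (phase θ k) = phase θ (-k) := by
  rw [phase, phase, ← Complex.exp_conj, map_mul, Complex.conj_ofReal, Complex.conj_I]
  congr 1
  push_cast
  ring

theorem phase_two_mul {θ : ℝ} (hθ : ∃ N : ℤ, θ = N) (k : ℤ) : phase θ (2 * k) = 1 := by
  obtain ⟨N, rfl⟩ := hθ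
  rw [phase, Complex.exp_eq_one_iff]
  refine ⟨k * N, ?_⟩
  push_cast
  ring

theorem weightedShift_apply (c : ℤ × ℤ → ℂ) (hc : ∀ x, ‖c x‖ = 1) (e : ℤ × ℤ ≃ ℤ × ℤ)
    (g : NodeSpace) (x : ℤ × ℤ) : weightedShift c hc e g x = c x * g (e x) := rfl

/-- The four hopping terms are unitary and form two adjoint pairs with real weights `1` and `β²`, so
the sum is self-adjoint with norm at most `2 (1 + β²)`. -/
theorem mem_spectrum_magneticLaplacian {θ β : ℝ} {z : ℂ}
    (hz : z ∈ spectrum ℂ (magneticLaplacian θ β)) : ∃ r : ℝ, |r| ≤ 2 * (1 + β ^ 2) ∧ z = r := by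
  set A := weightedShift (fun x => phase θ x.2) (fun _ => norm_phase _ _) (translate 1 0)
  set A' := weightedShift (fun x => phase θ (-x.2)) (fun _ => norm_phase _ _) (translate (-1) 0)
  set B := weightedShift (fun x => phase θ (-x.1)) (fun _ => norm_phase _ _) (translate 0 1)
  set B' := weightedShift (fun x => phase θ x.1) (fun _ => norm_phase _ _) (translate 0 (-1))
  have nA : ∀ g, ‖A g‖ = ‖g‖ := norm_shift (fun _ => norm_phase _ _) (weightedShift_apply _ _ _)
  have nA' : ∀ g, ‖A' g‖ = ‖g‖ := norm_shift (fun _ => norm_phase _ _) (weightedShift_apply _ _ _)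
  have nB : ∀ g, ‖B g‖ = ‖g‖ := norm_shift (fun _ => norm_phase _ _) (weightedShift_apply _ _ _)
  have nB' : ∀ g, ‖B' g‖ = ‖g‖ := norm_shift (fun _ => norm_phase _ _) (weightedShift_apply _ _ _)
  have iA : ∀ g h, inner ℂ (A g) h = inner ℂ g (A' h) :=
    inner_shift (weightedShift_apply _ _ _) fun g x => by
      rw [weightedShift_apply, conj_phase]
      simp [translate]
  have iA' : ∀ g h, inner ℂ (A' g) h = inner ℂ g (A h) :=
    inner_shift (weightedShift_apply _ _ _) fun g x => by
      rw [weightedShift_apply, conj_phase]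
      simp [translate]
  have iB : ∀ g h, inner ℂ (B g) h = inner ℂ g (B' h) :=
    inner_shift (weightedShift_apply _ _ _) fun g x => by
      rw [weightedShift_apply, conj_phase]
      simp [translate]
  have iB' : ∀ g h, inner ℂ (B' g) h = inner ℂ g (B h) :=
    inner_shift (weightedShift_apply _ _ _) fun g x => by
      rw [weightedShift_apply, conj_phase]
      simp [translate]
  have hM : ∀ g, magneticLaplacian θ β g = A g + A' g + ((β ^ 2 : ℝ) : ℂ) • (B g + B' g) :=
    fun g => rfl
  refine mem_spectrum_of_selfAdjoint (A := magneticLaplacian θ β) (fun g h => ?_) (fun g => ?_)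
    (by positivity) hz
  · rw [hM, hM, inner_add_left, inner_add_left, inner_add_right, inner_add_right, inner_smul_left,
      inner_smul_right, inner_add_left, inner_add_right, iA, iA', iB, iB', Complex.conj_ofReal]
    ring
  · rw [hM]
    calc _ ≤ ‖A g‖ + ‖A' g‖ + ‖((β ^ 2 : ℝ) : ℂ) • (B g + B' g)‖ := norm_add₃_le
      _ ≤ ‖g‖ + ‖g‖ + β ^ 2 * (‖g‖ + ‖g‖) := by
        rw [norm_smul, nA, nA', Complex.norm_real, Real.norm_eq_abs, abs_of_nonneg (sq_nonneg β)]
        gcongr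
        exact (norm_add_le _ _).trans_eq (by rw [nB, nB'])
      _ = _ := by ring

/-- Approximate eigenvectors of the magnetic Laplacian with integer flux. -/
theorem exists_approx_eigenvector {θ β : ℝ} (hθ : ∃ N : ℤ, θ = N) {r : ℝ}
    (hr : |r| ≤ 2 * (1 + β ^ 2)) {ε : ℝ} (hε : 0 < ε) :
    ∃ g : NodeSpace, g ≠ 0 ∧ ‖magneticLaplacian θ β g - (r : ℂ) • g‖ ≤ ε * ‖g‖ := by
  have hβ : 0 < 1 + β ^ 2 := by positivity
  set K := 2 * (1 + β ^ 2) with hK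
  have hK0 : 0 < K := by positivity
  -- The four hops have total weight `K = 2 (1 + β²)`, and each contributes a relative error of at
  -- most `ρ⁻¹ - 1`.
  obtain ⟨ρ, hρ0, hρ1, hρ⟩ : ∃ ρ : ℝ, 0 < ρ ∧ ρ < 1 ∧ K * (ρ⁻¹ - 1) = ε := by
    refine ⟨(1 + ε / K)⁻¹, by positivity, inv_lt_one_of_one_lt₀ (by
      have : 0 < ε / K := by positivity
      linarith), ?_⟩
    rw [inv_inv]; field_simp; ring
  set δ := ρ⁻¹ - 1 with hδ
  set φ := Real.arccos (r / K) with hφ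
  have hcos : K * Real.cos φ = r := by
    rw [abs_le] at hr
    rw [hφ, Real.cos_arccos (by rw [le_div_iff₀ hK0]; linarith) (by rw [div_le_iff₀ hK0]; linarith)]
    field_simp
  set E : ℤ → ℂ := fun k => Complex.exp (((φ * k : ℝ) : ℂ) * Complex.I) with hE
  have hEadd : ∀ j k, E (j + k) = E j * E k := fun j k => by
    simp only [hE]
    rw [← Complex.exp_add]
    congr 1
    push_cast
    ring
  have hEn : ∀ k, ‖E k‖ = 1 := fun k => Complex.norm_exp_ofReal_mul_I _
  have hE2 : (1 + (β : ℂ) ^ 2) * (E 1 + E (-1)) = r := by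
    rw [← hcos, hK]
    push_cast
    rw [Complex.cos]
    simp only [hE]
    push_cast
    ring_nf
  set w : ℤ × ℤ → ℝ := fun x => decay ρ x.1 * decay ρ x.2 with hw
  have hw0 : ∀ x, 0 < w x := fun x => mul_pos (decay_pos hρ0 _) (decay_pos hρ0 _)
  -- The gauge factor cancels the phases of the horizontal hops and leaves `phase θ (∓2 m)` in the
  -- vertical ones, which is `1` for integer `θ`. A plane wave with the same quasimomentum `φ` in
  -- both directions is enough, because `2 (1 + β²) cos φ` already takes every admissible value `r`.
  set χ : ℤ × ℤ → ℂ := fun x => E (x.1 + x.2) * phase θ (-(x.1 * x.2)) with hχ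
  have hχn : ∀ x, ‖χ x‖ = 1 := fun x => by simp only [hχ]; rw [norm_mul, hEn, norm_phase, mul_one]
  have hgn : ∀ x, ‖(w x : ℂ) * χ x‖ = w x := fun x => by
    rw [norm_mul, hχn, mul_one, Complex.norm_real, Real.norm_eq_abs, abs_of_pos (hw0 x)]
  have hmem : Memℓp (fun x => (w x : ℂ) * χ x) 2 := by
    refine memℓp_two_iff.mpr ?_
    have := (summable_decay_sq hρ0 hρ1).mul_of_nonneg (summable_decay_sq hρ0 hρ1)
      (fun _ => sq_nonneg _) fun _ => sq_nonneg _
    refine this.congr fun x => ?_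
    rw [hgn, hw, mul_pow]
  let g : NodeSpace := ⟨fun x => (w x : ℂ) * χ x, hmem⟩
  have hg : ∀ x, g x = (w x : ℂ) * χ x := fun x => rfl
  refine ⟨g, fun h => ?_, ?_⟩
  · have h1 : g (0, 0) = 0 := by rw [h]; rfl
    have h2 := hgn (0, 0)
    rw [← hg, h1, norm_zero] at h2
    exact (hw0 (0, 0)).ne h2
  refine norm_le_of_forall_le _ g hε.le ?_
  rintro ⟨m, n⟩
  have c1 : phase θ n * χ (m + 1, n) = E 1 * χ (m, n) := by
    simp only [hχ]
    rw [show m + 1 + n = 1 + (m + n) by ring, hEadd, show -((m + 1) * n) = -(m * n) + -n by ring,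
      phase_add]
    linear_combination (E 1 * E (m + n) * phase θ (-(m * n))) * phase_mul_neg θ n
  have c2 : phase θ (-n) * χ (m - 1, n) = E (-1) * χ (m, n) := by
    simp only [hχ]
    rw [show m - 1 + n = -1 + (m + n) by ring, hEadd, show -((m - 1) * n) = -(m * n) + n by ring,
      phase_add]
    linear_combination (E (-1) * E (m + n) * phase θ (-(m * n))) * phase_mul_neg θ n
  have c3 : phase θ (-m) * χ (m, n + 1) = E 1 * χ (m, n) := by
    simp only [hχ]
    rw [show m + (n + 1) = 1 + (m + n) by ring, hEadd, show -(m * (n + 1)) = -(m * n) + -m by ring,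
      phase_add]
    have := phase_two_mul hθ (-m)
    rw [two_mul, phase_add] at this
    linear_combination (E 1 * E (m + n) * phase θ (-(m * n))) * this
  have c4 : phase θ m * χ (m, n - 1) = E (-1) * χ (m, n) := by
    simp only [hχ]
    rw [show m + (n - 1) = -1 + (m + n) by ring, hEadd, show -(m * (n - 1)) = -(m * n) + m by ring,
      phase_add]
    have := phase_two_mul hθ m
    rw [two_mul, phase_add] at this
    linear_combination (E (-1) * E (m + n) * phase θ (-(m * n))) * this
  have key : (magneticLaplacian θ β g - (r : ℂ) • g) (m, n) =
      E 1 * χ (m, n) * ((w (m + 1, n) - w (m, n) : ℝ) : ℂ)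
      + E (-1) * χ (m, n) * ((w (m - 1, n) - w (m, n) : ℝ) : ℂ)
      + ((β ^ 2 : ℝ) : ℂ) * (E 1 * χ (m, n) * ((w (m, n + 1) - w (m, n) : ℝ) : ℂ)
        + E (-1) * χ (m, n) * ((w (m, n - 1) - w (m, n) : ℝ) : ℂ)) := by
    change magneticLaplacian θ β g (m, n) - (r : ℂ) * g (m, n) = _
    rw [magneticLaplacian_apply, ← hE2]
    simp only [hg]
    push_cast
    linear_combination (w (m + 1, n) : ℂ) * c1 + (w (m - 1, n) : ℂ) * c2
      + (β : ℂ) ^ 2 * ((w (m, n + 1) : ℂ) * c3 + (w (m, n - 1) : ℂ) * c4)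
  have d1 : ∀ j, |j - m| ≤ 1 → |w (j, n) - w (m, n)| ≤ δ * w (m, n) := fun j hj => by
    simp only [hw]
    rw [← sub_mul, abs_mul, abs_of_pos (decay_pos hρ0 n), ← mul_assoc]
    have := abs_decay_sub_le hρ0 hρ1.le hj
    have := decay_pos hρ0 n
    gcongr
  have d2 : ∀ j, |j - n| ≤ 1 → |w (m, j) - w (m, n)| ≤ δ * w (m, n) := fun j hj => by
    simp only [hw]
    rw [← mul_sub, abs_mul, abs_of_pos (decay_pos hρ0 m), mul_left_comm]
    have := abs_decay_sub_le hρ0 hρ1.le hj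
    have := decay_pos hρ0 m
    gcongr
  have nn : ∀ (j : ℤ) (x : ℝ), ‖E j * χ (m, n) * (x : ℂ)‖ = |x| := fun j x => by
    rw [norm_mul, norm_mul, hEn, hχn, one_mul, one_mul, Complex.norm_real, Real.norm_eq_abs]
  rw [key, hg, hgn]
  calc _ ≤ |w (m + 1, n) - w (m, n)| + |w (m - 1, n) - w (m, n)|
        + β ^ 2 * (|w (m, n + 1) - w (m, n)| + |w (m, n - 1) - w (m, n)|) := by
        refine norm_add₃_le.trans ?_
        rw [nn, nn, norm_mul, Complex.norm_real, Real.norm_eq_abs, abs_of_nonneg (sq_nonneg β)]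
        gcongr
        exact (norm_add_le _ _).trans_eq (by rw [nn, nn])
    _ ≤ δ * w (m, n) + δ * w (m, n) + β ^ 2 * (δ * w (m, n) + δ * w (m, n)) := by
        gcongr
        · exact d1 _ (by simp)
        · exact d1 _ (by simp)
        · exact d2 _ (by simp)
        · exact d2 _ (by simp)
    _ = _ := by rw [← hρ, hK]; ring

theorem mem_spectrum_magneticLaplacian_iff {θ β : ℝ} (hθ : ∃ N : ℤ, θ = N) {z : ℂ} :
    z ∈ spectrum ℂ (magneticLaplacian θ β) ↔ ∃ r : ℝ, |r| ≤ 2 * (1 + β ^ 2) ∧ z = r := by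
  refine ⟨mem_spectrum_magneticLaplacian, ?_⟩
  rintro ⟨r, hr, rfl⟩ hz
  obtain ⟨u, hu⟩ := hz
  have hinv : ∀ g : NodeSpace, g = (↑u⁻¹ : NodeSpace →L[ℂ] NodeSpace)
      ((r : ℂ) • g - magneticLaplacian θ β g) := fun g => by
    have h1 : (↑u⁻¹ : NodeSpace →L[ℂ] NodeSpace) ((u : NodeSpace →L[ℂ] NodeSpace) g) = g := by
      rw [← mul_apply_eq_comp, Units.inv_mul, one_apply_eq_self]
    rw [hu] at h1
    conv_lhs => rw [← h1]
    rfl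
  set C := ‖(↑u⁻¹ : NodeSpace →L[ℂ] NodeSpace)‖
  obtain ⟨g, hg0, hg⟩ := exists_approx_eigenvector (θ := θ) hθ hr
    (ε := 1 / (2 * (C + 1))) (by positivity)
  have h1 : ‖g‖ ≤ C * ‖(r : ℂ) • g - magneticLaplacian θ β g‖ := by
    conv_lhs => rw [hinv g]
    exact ContinuousLinearMap.le_opNorm _ _
  rw [norm_sub_rev] at h1
  have hgp : 0 < ‖g‖ := norm_pos_iff.mpr hg0
  have h2 : ‖g‖ ≤ C * (1 / (2 * (C + 1)) * ‖g‖) := h1.trans (by gcongr)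
  have h3 : C * (1 / (2 * (C + 1)) * ‖g‖) = C / (C + 1) * ‖g‖ / 2 := by field_simp
  have h4 : C / (C + 1) ≤ 1 := by
    rw [div_le_one (by positivity)]; linarith
  have h5 : C / (C + 1) * ‖g‖ ≤ 1 * ‖g‖ := by gcongr
  linarith

/-! ### The magnetic Laplacian with integer flux has no eigenvectors -/

section Torus

/-- The two-dimensional torus. -/
abbrev Torus : Type := UnitAddCircle × UnitAddCircle

/-- Normalized Haar measure on the torus. -/
abbrev torusMeasure : Measure Torus :=
  (AddCircle.haarAddCircle (T := 1)).prod (AddCircle.haarAddCircle (T := 1))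

theorem memLp_continuousMap_mul (s : C(Torus, ℂ)) (f : Lp ℂ 2 torusMeasure) :
    MemLp (fun x => s x * f x) 2 torusMeasure :=
  (Lp.memLp f).of_le_mul (c := ‖s‖) (s.continuous.aestronglyMeasurable.mul (Lp.aestronglyMeasurable f))
    (Filter.Eventually.of_forall fun x => by
      rw [norm_mul]
      exact mul_le_mul_of_nonneg_right (s.norm_coe_le_norm x) (norm_nonneg _))

/-- Multiplication by a continuous function on the torus. -/
def torusMul (s : C(Torus, ℂ)) : Lp ℂ 2 torusMeasure →L[ℂ] Lp ℂ 2 torusMeasure :=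
  LinearMap.mkContinuous
    { toFun := fun f => (memLp_continuousMap_mul s f).toLp
      map_add' := fun f g => by
        refine Lp.ext ?_
        filter_upwards [(memLp_continuousMap_mul s (f + g)).coeFn_toLp,
          (memLp_continuousMap_mul s f).coeFn_toLp, (memLp_continuousMap_mul s g).coeFn_toLp,
          Lp.coeFn_add f g, Lp.coeFn_add (memLp_continuousMap_mul s f).toLp
          (memLp_continuousMap_mul s g).toLp] with x h1 h2 h3 h4 h5
        rw [h1, h5, Pi.add_apply, h2, h3, h4, Pi.add_apply, mul_add]
      map_smul' := fun c f => by
        refine Lp.ext ?_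
        filter_upwards [(memLp_continuousMap_mul s (c • f)).coeFn_toLp,
          (memLp_continuousMap_mul s f).coeFn_toLp, Lp.coeFn_smul c f,
          Lp.coeFn_smul c (memLp_continuousMap_mul s f).toLp] with x h1 h2 h3 h4
        rw [h1, RingHom.id_apply, h4, Pi.smul_apply, h2, h3, Pi.smul_apply, smul_eq_mul,
          smul_eq_mul, mul_left_comm] } ‖s‖
    fun f => by
      refine Lp.norm_le_mul_norm_of_ae_le_mul ?_
      filter_upwards [(memLp_continuousMap_mul s f).coeFn_toLp] with x h1
      change ‖(memLp_continuousMap_mul s f).toLp _ x‖ ≤ _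
      rw [h1, norm_mul]
      exact mul_le_mul_of_nonneg_right (s.norm_coe_le_norm x) (norm_nonneg _)

theorem coeFn_torusMul (s : C(Torus, ℂ)) (f : Lp ℂ 2 torusMeasure) :
    torusMul s f =ᵐ[torusMeasure] fun x => s x * f x :=
  (memLp_continuousMap_mul s f).coeFn_toLp

/-- The monomial `exp (2 π i (m x + n y))`. -/
def monomial (p : ℤ × ℤ) : C(Torus, ℂ) :=
  ⟨fun x => fourier p.1 x.1 * fourier p.2 x.2, by fun_prop⟩

theorem monomial_apply (p : ℤ × ℤ) (x : Torus) :
    monomial p x = fourier p.1 x.1 * fourier p.2 x.2 := rfl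

/-- The gauge transformed monomials. -/
def gaugeMonomial (θ : ℝ) (p : ℤ × ℤ) : Lp ℂ 2 torusMeasure :=
  ContinuousMap.toLp 2 torusMeasure ℂ (phase θ (p.1 * p.2) • monomial p)

theorem integral_fourier_mul_conj (m n : ℤ) :
    ∫ x : UnitAddCircle, fourier n x * (starRingEnd ℂ) (fourier m x) ∂AddCircle.haarAddCircle
      = if m = n then 1 else 0 := by
  have := (orthonormal_iff_ite.mp (orthonormal_fourier (T := 1))) m n
  rwa [fourierLp, fourierLp, ContinuousMap.inner_toLp] at this

theorem orthonormal_gaugeMonomial (θ : ℝ) : Orthonormal ℂ (gaugeMonomial θ) := by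
  rw [orthonormal_iff_ite]
  intro p q
  rw [gaugeMonomial, gaugeMonomial, map_smul, map_smul, inner_smul_left, inner_smul_right,
    ContinuousMap.inner_toLp]
  have h1 : ∫ x, monomial q x * (starRingEnd ℂ) (monomial p x) ∂torusMeasure =
      (∫ x : UnitAddCircle, fourier q.1 x * (starRingEnd ℂ) (fourier p.1 x)
        ∂AddCircle.haarAddCircle) *
      ∫ x : UnitAddCircle, fourier q.2 x * (starRingEnd ℂ) (fourier p.2 x)
        ∂AddCircle.haarAddCircle := by
    rw [← integral_prod_mul]
    refine integral_congr_ae (Filter.Eventually.of_forall fun x => ?_)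
    simp only [monomial_apply, map_mul]
    ring
  rw [h1, integral_fourier_mul_conj, integral_fourier_mul_conj]
  by_cases h : p = q
  · subst h
    have := phase_mul_neg θ (p.1 * p.2)
    simp only [if_true, mul_one, conj_phase]
    linear_combination this
  · rw [if_neg h]
    by_cases h1 : p.1 = q.1
    · rw [if_neg (fun h2 => h (Prod.ext h1 h2))]; simp
    · rw [if_neg h1]; simp

/-- The symbol of the magnetic Laplacian. -/
def symbol (β : ℝ) : C(Torus, ℂ) :=
  monomial (-1, 0) + monomial (1, 0) + ((β ^ 2 : ℝ) : ℂ) • (monomial (0, -1) + monomial (0, 1))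

theorem torusMul_toLp (s f : C(Torus, ℂ)) :
    torusMul s (ContinuousMap.toLp 2 torusMeasure ℂ f) =
      ContinuousMap.toLp 2 torusMeasure ℂ (s * f) := by
  refine Lp.ext ?_
  filter_upwards [coeFn_torusMul s (ContinuousMap.toLp 2 torusMeasure ℂ f),
    ContinuousMap.coeFn_toLp (𝕜 := ℂ) (p := 2) torusMeasure f,
    ContinuousMap.coeFn_toLp (𝕜 := ℂ) (p := 2) torusMeasure (s * f)] with x h1 h2 h3
  rw [h1, h2, h3, ContinuousMap.mul_apply]

theorem monomial_mul (p q : ℤ × ℤ) : monomial p * monomial q = monomial (p + q) := by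
  ext x
  simp only [ContinuousMap.mul_apply, monomial_apply, Prod.fst_add, Prod.snd_add, fourier_add]
  ring

/-- The Fourier transform from `ℓ²(ℤ²)` to the torus. -/
def torusTransform (θ : ℝ) : NodeSpace →ₗᵢ[ℂ] Lp ℂ 2 torusMeasure :=
  (orthonormal_gaugeMonomial θ).orthogonalFamily.linearIsometry

theorem torusTransform_single (θ : ℝ) (p : ℤ × ℤ) (c : ℂ) :
    torusTransform θ (lp.single 2 p c) = c • gaugeMonomial θ p := by
  rw [torusTransform, OrthogonalFamily.linearIsometry_apply_single]
  rfl

theorem magneticLaplacian_single (θ β : ℝ) (a b : ℤ) :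
    magneticLaplacian θ β (lp.single 2 (a, b) 1) =
      lp.single 2 (a - 1, b) (phase θ b) + lp.single 2 (a + 1, b) (phase θ (-b))
      + ((β ^ 2 : ℝ) : ℂ) • (lp.single 2 (a, b - 1) (phase θ (-a))
        + lp.single 2 (a, b + 1) (phase θ a)) := by
  refine lp.ext (funext fun x => ?_)
  obtain ⟨m, n⟩ := x
  rw [magneticLaplacian_apply]
  change _ = (lp.single 2 (a - 1, b) (phase θ b) : NodeSpace) (m, n)
    + (lp.single 2 (a + 1, b) (phase θ (-b)) : NodeSpace) (m, n)
    + ((β ^ 2 : ℝ) : ℂ) * ((lp.single 2 (a, b - 1) (phase θ (-a)) : NodeSpace) (m, n)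
      + (lp.single 2 (a, b + 1) (phase θ a) : NodeSpace) (m, n))
  have key : ∀ (p q : ℤ × ℤ) (c : ℂ), (lp.single 2 p c : NodeSpace) q = if q = p then c else 0 :=
    fun p q c => by
      rw [lp.single_apply]
      by_cases h : q = p
      · subst h; simp
      · rw [if_neg h, Pi.single_eq_of_ne h]
  simp only [key, Prod.mk.injEq]
  congr 1
  · congr 1
    · by_cases h : m + 1 = a ∧ n = b
      · rw [if_pos h, if_pos ⟨by omega, h.2⟩, mul_one, h.2]
      · rw [if_neg h, if_neg (fun h' => h ⟨by omega, h'.2⟩), mul_zero]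
    · by_cases h : m - 1 = a ∧ n = b
      · rw [if_pos h, if_pos ⟨by omega, h.2⟩, mul_one, h.2]
      · rw [if_neg h, if_neg (fun h' => h ⟨by omega, h'.2⟩), mul_zero]
  · congr 2
    · by_cases h : m = a ∧ n + 1 = b
      · rw [if_pos h, if_pos ⟨h.1, by omega⟩, mul_one, h.1]
      · rw [if_neg h, if_neg (fun h' => h ⟨h'.1, by omega⟩), mul_zero]
    · by_cases h : m = a ∧ n - 1 = b
      · rw [if_pos h, if_pos ⟨h.1, by omega⟩, mul_one, h.1]
      · rw [if_neg h, if_neg (fun h' => h ⟨h'.1, by omega⟩), mul_zero]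

/-- It suffices to compare the two sides on the standard basis. The factor `phase θ (a * b)` in the
gauge transformed monomials absorbs the phases of the horizontal hops; the vertical hops leave
`phase θ (±2 a)`, which is trivial because `θ` is an integer. -/
theorem torusTransform_magneticLaplacian {θ : ℝ} (hθ : ∃ N : ℤ, θ = N) (β : ℝ) (g : NodeSpace) :
    torusTransform θ (magneticLaplacian θ β g) = torusMul (symbol β) (torusTransform θ g) := by
  have h : (torusTransform θ).toContinuousLinearMap ∘L magneticLaplacian θ β =
      torusMul (symbol β) ∘L (torusTransform θ).toContinuousLinearMap := by
    refine lp.ext_continuousLinearMap (by norm_num) fun p => ?_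
    obtain ⟨a, b⟩ := p
    refine ContinuousLinearMap.ext_ring ?_
    change torusTransform θ (magneticLaplacian θ β (lp.single 2 (a, b) 1)) =
      torusMul (symbol β) (torusTransform θ (lp.single 2 (a, b) 1))
    rw [magneticLaplacian_single, map_add, map_add, map_smul, map_add]
    simp only [torusTransform_single, gaugeMonomial, one_smul, torusMul_toLp]
    simp only [← map_smul, ← map_add]
    congr 1
    have e1 : phase θ b * phase θ ((a - 1) * b) = phase θ (a * b) := by
      rw [← phase_add]; ring_nf
    have e2 : phase θ (-b) * phase θ ((a + 1) * b) = phase θ (a * b) := by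
      rw [← phase_add]; ring_nf
    have e3 : phase θ (-a) * phase θ (a * (b - 1)) = phase θ (a * b) := by
      rw [← phase_add, show -a + a * (b - 1) = a * b + 2 * (-a) by ring, phase_add,
        phase_two_mul hθ, mul_one]
    have e4 : phase θ a * phase θ (a * (b + 1)) = phase θ (a * b) := by
      rw [← phase_add, show a + a * (b + 1) = a * b + 2 * a by ring, phase_add,
        phase_two_mul hθ, mul_one]
    simp only [smul_smul, e1, e2, e3, e4]
    simp only [symbol, mul_smul_comm, add_mul, smul_mul_assoc, monomial_mul, Prod.mk_add_mk,
      zero_add]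
    rw [show -1 + a = a - 1 by ring, show 1 + a = a + 1 by ring, show -1 + b = b - 1 by ring,
      show 1 + b = b + 1 by ring]
    ext x
    simp only [ContinuousMap.add_apply, ContinuousMap.smul_apply, smul_eq_mul]
    ring
  exact congrArg (· g) h

instance nullSingletonClass_haar : NullSingletonClass (AddCircle.haarAddCircle (T := 1)) := by
  refine ⟨fun x => ?_⟩
  have h := AddCircle.volume_eq_smul_haarAddCircle (T := 1)
  rw [ENNReal.ofReal_one, one_smul] at h
  rw [← h, ← (AddCircle.measurePreserving_mk 1 0).measure_preimage
    (measurableSet_singleton x).nullMeasurableSet]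
  obtain ⟨t, rfl⟩ := QuotientAddGroup.mk_surjective x
  refine Set.Countable.measure_zero ?_ _
  refine (Set.countable_range fun n : ℤ => t + n).mono fun s hs => ?_
  have hs' : ((s - t : ℝ) : UnitAddCircle) = 0 := by
    rw [AddCircle.coe_sub]
    exact sub_eq_zero.mpr hs
  obtain ⟨n, hn⟩ := (AddCircle.coe_eq_zero_iff 1).mp hs'
  refine ⟨n, ?_⟩
  rw [zsmul_eq_mul, mul_one] at hn
  change t + n = s
  linarith

/-- For fixed `x`, the number `w = exp (2 π i y)` satisfies `w² - c w + 1 = 0` with `c` determined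
by `x` and `r`; solving for `c` requires `β ≠ 0`. The polynomial is nonzero since its constant term
is `1`. -/
theorem symbol_fibre_finite (β : ℝ) (hβ : β ≠ 0) (r : ℂ) (x : UnitAddCircle) :
    {y | symbol β (x, y) = r}.Finite := by
  have hβ' : ((β ^ 2 : ℝ) : ℂ) ≠ 0 := Complex.ofReal_ne_zero.mpr (pow_ne_zero 2 hβ)
  set c : ℂ := (r - (fourier (-1) x + fourier 1 x)) / ((β ^ 2 : ℝ) : ℂ) with hc
  have hinj : Function.Injective fun y : UnitAddCircle => (fourier 1 y : ℂ) := fun y y' h => by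
    simp only [fourier_one] at h
    exact AddCircle.injective_toCircle one_ne_zero (Subtype.ext h)
  have hpoly : (Polynomial.X ^ 2 - Polynomial.C c * Polynomial.X + 1 : Polynomial ℂ) ≠ 0 := by
    intro h
    have := congrArg (Polynomial.eval 0) h
    simp at this
  refine ((Polynomial.finite_setOfPred_isRoot hpoly).preimage hinj.injOn).subset fun y hy => ?_
  have h1 : symbol β (x, y) = fourier (-1) x + fourier 1 x
      + ((β ^ 2 : ℝ) : ℂ) * (fourier (-1) y + fourier 1 y) := by
    simp [symbol, monomial_apply]
  have hy' : symbol β (x, y) = r := hy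
  have h2 : (fourier (-1) y : ℂ) + fourier 1 y = c := by
    rw [hc, ← hy', h1]
    field_simp
    ring
  have h3 : (fourier (-1) y : ℂ) * fourier 1 y = 1 := by
    rw [← fourier_add]; simp
  simp only [Set.mem_preimage, Set.mem_ofPred_eq, Polynomial.IsRoot, Polynomial.eval_add,
    Polynomial.eval_sub, Polynomial.eval_pow, Polynomial.eval_X, Polynomial.eval_mul,
    Polynomial.eval_C, Polynomial.eval_one]
  rw [← h2]
  linear_combination -h3

/-- On the torus the eigenvalue equation says that the transform of `g` is supported where the
symbol equals `r`. The fibres of this set are finite, so it is null by Fubini. -/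
theorem eq_zero_of_magneticLaplacian_eq {θ : ℝ} (hθ : ∃ N : ℤ, θ = N) {β : ℝ} (hβ : β ≠ 0)
    {g : NodeSpace} {r : ℂ} (h : magneticLaplacian θ β g = r • g) : g = 0 := by
  have h1 := torusTransform_magneticLaplacian hθ β g
  rw [h, map_smul] at h1
  set f := torusTransform θ g with hf
  have hnull : torusMeasure {x | symbol β x = r} = 0 := by
    change torusMeasure (symbol β ⁻¹' {r}) = 0
    rw [Measure.measure_prod_null ((symbol β).continuous.measurable (measurableSet_singleton r))]
    refine Filter.Eventually.of_forall fun x => ?_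
    have hfin : (Prod.mk x ⁻¹' {x | symbol β x = r}).Finite := symbol_fibre_finite β hβ r x
    exact hfin.measure_zero _
  have hae : f =ᵐ[torusMeasure] 0 := by
    have h3 : ∀ᵐ x ∂torusMeasure, symbol β x ≠ r := measure_eq_zero_iff_ae_notMem.mp hnull
    filter_upwards [coeFn_torusMul (symbol β) f, Lp.coeFn_smul r f, h3] with x e1 e2 e3
    rw [← h1, e2, Pi.smul_apply, smul_eq_mul] at e1
    have : (symbol β x - r) * f x = 0 := by rw [sub_mul, ← e1, sub_self]
    exact (mul_eq_zero.mp this).resolve_left (sub_ne_zero.mpr e3)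
  have h4 : f = 0 := Lp.ext (hae.trans (Lp.coeFn_zero _ _ _).symm)
  rw [hf] at h4
  exact (torusTransform θ).injective (h4.trans (map_zero _).symm)

end Torus

/-! ### Resolvent set and spectrum in terms of the graph -/

section Graph

variable {E : Type*} [NormedAddCommGroup E] [InnerProductSpace ℂ E]

/-- The hypothesis `h1` gives a right inverse of `T - z`; it is also a left inverse because `R (T x
- z x) - x` lies in the kernel of `T - z`, which `h2` excludes. -/
theorem mem_resolventSet_of_graph {T : E →ₗ.[ℂ] E} {z : ℂ} (R : E →L[ℂ] E)
    (h1 : ∀ y, (R y, y + z • R y) ∈ T.graph) (h2 : ∀ x, (x, z • x) ∈ T.graph → x = 0) :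
    z ∈ resolventSet T := by
  refine ⟨R, fun y => ?_, fun x => ?_⟩
  · obtain ⟨x, hx1, hx2⟩ := (T.mem_graph_iff).mp (h1 y)
    simp only at hx1 hx2
    have hd : R y ∈ T.domain := hx1 ▸ x.2
    refine ⟨hd, ?_⟩
    have : (⟨R y, hd⟩ : T.domain) = x := Subtype.ext hx1.symm
    rw [this, hx2, add_sub_cancel_right]
  · set w := T x - z • (x : E) with hw
    have h3 := T.graph.sub_mem (h1 w) (T.mem_graph x)
    have h4 := h2 (R w - x) (by
      convert h3 using 1
      refine Prod.ext rfl ?_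
      change z • (R w - (x : E)) = w + z • R w - T x
      rw [smul_sub, hw]
      abel)
    exact sub_eq_zero.mp h4

theorem norm_le_of_mem_resolventSet {T : E →ₗ.[ℂ] E} {z : ℂ} (hz : z ∈ resolventSet T) :
    ∃ C : ℝ, 0 ≤ C ∧ ∀ x y, (x, y) ∈ T.graph → ‖x‖ ≤ C * ‖y - z • x‖ := by
  obtain ⟨R, -, h⟩ := hz
  refine ⟨‖R‖, norm_nonneg R, fun x y hxy => ?_⟩
  obtain ⟨w, hw1, hw2⟩ := (T.mem_graph_iff).mp hxy
  simp only at hw1 hw2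
  have h3 := h w
  rw [hw2, hw1] at h3
  conv_lhs => rw [← h3]
  exact R.le_opNorm _

/-- Weyl's criterion. -/
theorem mem_spec_of_approx {T : E →ₗ.[ℂ] E} {z : ℂ}
    (h : ∀ ε > 0, ∃ x y, (x, y) ∈ T.graph ∧ x ≠ 0 ∧ ‖y - z • x‖ ≤ ε * ‖x‖) : z ∈ spec T := by
  intro hz
  obtain ⟨C, hC, h1⟩ := norm_le_of_mem_resolventSet hz
  obtain ⟨x, y, hxy, hx, hle⟩ := h (1 / (C + 1)) (by positivity)
  have hx' : 0 < ‖x‖ := norm_pos_iff.mpr hx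
  have h2 : ‖x‖ ≤ C * (1 / (C + 1) * ‖x‖) := (h1 x y hxy).trans (by gcongr)
  rw [← mul_assoc, mul_one_div] at h2
  have h3 : C / (C + 1) < 1 := by rw [div_lt_one (by positivity)]; linarith
  nlinarith

end Graph

/-! ### Decomposition of `L²(ℝ)` into period cells -/

theorem IsH2.translate {a b : ℝ} {f g h : ℝ → ℂ} (H : IsH2 a b f g h) (s : ℝ) :
    IsH2 (a - s) (b - s) (fun t => f (t + s)) (fun t => g (t + s)) (fun t => h (t + s)) := by
  have hm : MeasurePreserving (fun t => t + s) (volume.restrict (Set.Icc (a - s) (b - s)))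
      (volume.restrict (Set.Icc a b)) := by
    have := (measurePreserving_add_right volume s).restrict_preimage (s := Set.Icc a b)
      measurableSet_Icc
    rwa [Set.preimage_add_const_Icc] at this
  have ht : ∀ t ∈ Set.Icc (a - s) (b - s), t + s ∈ Set.Icc a b := fun t ht =>
    ⟨by linarith [ht.1], by linarith [ht.2]⟩
  refine ⟨H.memLp.comp_measurePreserving hm, fun t h => ?_, fun t h => ?_⟩
  · rw [intervalIntegral.integral_comp_add_right g s, sub_add_cancel]
    exact H.eq_fst _ (ht t h)
  · rw [intervalIntegral.integral_comp_add_right _ s, sub_add_cancel]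
    exact H.eq_snd _ (ht t h)

section Line

variable {l : ℝ} [hl : Fact (0 < l)]

theorem measurePreserving_toCell (l : ℝ) (k : ℤ) :
    MeasurePreserving (fun t => t + k * l) (edgeMeasure l) (volume.restrict (cell l k)) := by
  have := (measurePreserving_add_right volume (k * l)).restrict_preimage (s := cell l k)
    measurableSet_Icc
  rwa [Set.preimage_add_const_Icc, sub_self, show (k + 1) * l - k * l = l by ring] at this

theorem measurePreserving_fromCell (l : ℝ) (k : ℤ) :
    MeasurePreserving (fun t => t + -(k * l)) (volume.restrict (cell l k)) (edgeMeasure l) := by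
  have := (measurePreserving_add_right volume (-(k * l))).restrict_preimage (s := Set.Icc 0 l)
    measurableSet_Icc
  rwa [Set.preimage_add_const_Icc, sub_neg_eq_add, sub_neg_eq_add, zero_add,
    show l + k * l = (k + 1) * l by ring] at this

theorem memLp_cellPart (f : LineSpace) (k : ℤ) :
    MemLp (fun t => f (t + k * l)) 2 (edgeMeasure l) :=
  ((Lp.memLp f).restrict _).comp_measurePreserving (measurePreserving_toCell l k)

/-- The restriction of a function to the cell number `k`, moved to `[0, l]`. -/
def cellPart (l : ℝ) [Fact (0 < l)] (k : ℤ) (f : LineSpace) : EdgeSpace l := (memLp_cellPart f k).toLp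

theorem coeFn_cellPart (k : ℤ) (f : LineSpace) :
    cellPart l k f =ᵐ[edgeMeasure l] fun t => f (t + k * l) := MemLp.coeFn_toLp _

theorem cellPart_ae_iff (k : ℤ) (f : LineSpace) (φ : ℝ → ℂ) :
    f =ᵐ[volume.restrict (cell l k)] φ ↔ cellPart l k f =ᵐ[edgeMeasure l] fun t => φ (t + k * l) := by
  constructor
  · intro h
    exact (coeFn_cellPart k f).trans
      ((measurePreserving_toCell l k).quasiMeasurePreserving.ae_eq_comp h)
  · intro h
    have h1 := (measurePreserving_fromCell l k).quasiMeasurePreserving.ae_eq_comp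
      ((coeFn_cellPart k f).symm.trans h)
    simpa [Function.comp_def] using h1

theorem cellPart_add (k : ℤ) (f g : LineSpace) :
    cellPart l k (f + g) = cellPart l k f + cellPart l k g := by
  refine Lp.ext (((cellPart_ae_iff k (f + g) _).mp (ae_restrict_of_ae (Lp.coeFn_add f g))).trans ?_)
  filter_upwards [Lp.coeFn_add (cellPart l k f) (cellPart l k g), coeFn_cellPart k f,
    coeFn_cellPart k g] with t h1 h2 h3
  rw [h1, Pi.add_apply, Pi.add_apply, h2, h3]

theorem cellPart_smul (k : ℤ) (c : ℂ) (f : LineSpace) :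
    cellPart l k (c • f) = c • cellPart l k f := by
  refine Lp.ext (((cellPart_ae_iff k (c • f) _).mp (ae_restrict_of_ae (Lp.coeFn_smul c f))).trans ?_)
  filter_upwards [Lp.coeFn_smul c (cellPart l k f), coeFn_cellPart k f] with t h1 h2
  rw [h1, Pi.smul_apply, Pi.smul_apply, h2]

theorem norm_sq_cellPart (k : ℤ) (f : LineSpace) :
    ‖cellPart l k f‖ ^ 2 = ∫ s in Set.Ioc (k • l) ((k + 1) • l), ‖f s‖ ^ 2 := by
  rw [EdgeSpace.norm_sq_eq, ← integral_Icc_eq_integral_Ioc]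
  have h1 : ∫ s in Set.Icc 0 l, ‖cellPart l k f s‖ ^ 2 = ∫ s in Set.Icc 0 l, ‖f (s + k * l)‖ ^ 2 :=
    integral_congr_ae ((coeFn_cellPart k f).fun_comp fun x => ‖x‖ ^ 2)
  rw [h1, zsmul_eq_mul, zsmul_eq_mul, Int.cast_add, Int.cast_one]
  exact (measurePreserving_toCell l k).integral_comp (measurableEmbedding_addRight _)
    fun s => ‖f s‖ ^ 2

theorem hasSum_norm_sq_cellPart (f : LineSpace) :
    HasSum (fun k => ‖cellPart l k f‖ ^ 2) (‖f‖ ^ 2) := by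
  have hi : Integrable (fun s => ‖f s‖ ^ 2) :=
    (Lp.memLp f).integrable_norm_pow (by norm_num)
  have h1 : ‖f‖ ^ 2 = ∫ s, ‖f s‖ ^ 2 := by
    have h1 : ‖f‖ ^ 2 = RCLike.re (inner ℂ f f) := norm_sq_eq_re_inner f
    rw [h1, L2.inner_def, ← integral_re (L2.integrable_inner (𝕜 := ℂ) f f)]
    refine integral_congr_ae (Filter.Eventually.of_forall fun s => ?_)
    exact (norm_sq_eq_re_inner (𝕜 := ℂ) (f s)).symm
  have h2 := hasSum_integral_iUnion (μ := volume) (f := fun s => ‖f s‖ ^ 2)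
    (s := fun k : ℤ => Set.Ioc (k • l) ((k + 1) • l)) (fun _ => measurableSet_Ioc)
    (Set.pairwise_disjoint_Ioc_zsmul l) hi.integrableOn
  rw [iUnion_Ioc_zsmul hl.out, setIntegral_univ, ← h1] at h2
  exact h2.congr_fun fun k => norm_sq_cellPart k f

theorem exists_cellPart_eq_single (k : ℤ) (x : EdgeSpace l) :
    ∃ f : LineSpace, ∀ j, cellPart l j f = if j = k then x else 0 := by
  -- The open cell is used so that the extension by zero vanishes on the neighbouring closed cells,
  -- shared end points included.
  have hm : MemLp (fun t => x (t + -(k * l))) 2 (volume.restrict (Set.Ioo (k * l) ((k + 1) * l))) := by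
    rw [restrict_Ioo_eq_restrict_Icc]
    exact (Lp.memLp x).comp_measurePreserving (measurePreserving_fromCell l k)
  have hm' := (memLp_indicator_iff_restrict measurableSet_Ioo).mpr hm
  refine ⟨hm'.toLp, fun j => ?_⟩
  split_ifs with hj
  · subst hj
    refine Lp.ext (((cellPart_ae_iff j _ _).mp (ae_restrict_of_ae hm'.coeFn_toLp)).trans ?_)
    have h1 : ∀ᵐ t ∂edgeMeasure l, t ∈ Set.Ioo 0 l := by
      rw [edgeMeasure, ← restrict_Ioo_eq_restrict_Icc]
      exact ae_restrict_mem measurableSet_Ioo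
    filter_upwards [h1] with t ht
    have ht' : t + j * l ∈ Set.Ioo (j * l) ((j + 1) * l) :=
      ⟨by linarith [ht.1], by linarith [ht.2]⟩
    rw [Set.indicator_of_mem ht', add_neg_cancel_right]
  · refine Lp.ext (((cellPart_ae_iff j _ _).mp (ae_restrict_of_ae hm'.coeFn_toLp)).trans
      (Filter.EventuallyEq.trans ?_ (Lp.coeFn_zero _ _ _).symm))
    refine ae_edge fun t ht => ?_
    change Set.indicator _ _ _ = _
    refine Set.indicator_of_notMem (fun h => hj ?_) _
    have hl0 := hl.out
    have h1 : (k : ℝ) < j + 1 := by nlinarith [h.1, ht.2]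
    have h2 : (j : ℝ) < k + 1 := by nlinarith [h.2, ht.1]
    have h3 : k < j + 1 := by exact_mod_cast h1
    have h4 : j < k + 1 := by exact_mod_cast h2
    omega

/-- The decomposition of `L²(ℝ)` into period cells, as an isometry. -/
def cellIsometry (l : ℝ) [Fact (0 < l)] : LineSpace →ₗᵢ[ℂ] L2Sum ℤ (EdgeSpace l) where
  toFun f := ⟨fun k => cellPart l k f, memℓp_two_iff.mpr (hasSum_norm_sq_cellPart f).summable⟩
  map_add' f g := lp.ext (funext fun k => cellPart_add k f g)
  map_smul' c f := lp.ext (funext fun k => cellPart_smul k c f)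
  norm_map' f := (sq_eq_sq₀ (norm_nonneg _) (norm_nonneg _)).mp
    ((hasSum_norm_sq _).unique (hasSum_norm_sq_cellPart f))

/-- The range of an isometry on a complete space is closed, and it contains all families supported
on one cell, whose finite sums are dense. -/
theorem cellIsometry_surjective : Function.Surjective (cellIsometry l) := by
  intro x
  have hcl : IsClosed (Set.range (cellIsometry l)) := (cellIsometry l).isometry.isClosedEmbedding.isClosed_range
  have hs := lp.hasSum_single (p := 2) (by norm_num) x
  refine hcl.mem_of_tendsto hs (Filter.Eventually.of_forall fun s => ?_)
  refine (LinearMap.range (cellIsometry l).toLinearMap).sum_mem fun k _ => ?_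
  obtain ⟨f, hf⟩ := exists_cellPart_eq_single k (x k)
  refine ⟨f, lp.ext (funext fun j => (hf j).trans ?_)⟩
  rw [lp.single_apply]
  split_ifs with h
  · subst h; simp
  · rw [Pi.single_eq_of_ne h]

/-- The decomposition of `L²(ℝ)` into period cells. -/
def cellEquiv (l : ℝ) [Fact (0 < l)] : LineSpace ≃ₗᵢ[ℂ] L2Sum ℤ (EdgeSpace l) :=
  LinearIsometryEquiv.ofSurjective (cellIsometry l) cellIsometry_surjective

/-- The relation between `x` and `y = P x`, cell by cell, for jumps of the derivative by `s` times
the value. -/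
def ChainRel (v : EdgeSpace l) (s : ℝ) (x y : L2Sum ℤ (EdgeSpace l)) : Prop :=
  ∃ a b c d : ℤ → ℂ, (∀ k, EdgeRel v (x k) (y k) (a k) (b k) (c k) (d k)) ∧
    (∀ k, a (k + 1) = c k) ∧ ∀ k, b (k + 1) = d k + s * c k

theorem periodicExtension_add (V : ℝ → ℝ) (k : ℤ) {t : ℝ} (ht : t ∈ Set.Ico 0 l) :
    periodicExtension l V (t + k * l) = V t := by
  have hl0 := hl.out
  rw [periodicExtension]
  congr 1
  rw [add_div, mul_div_cancel_right₀ _ hl0.ne', Int.fract_add_intCast,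
    Int.fract_eq_self.mpr ⟨div_nonneg ht.1 hl0.le, (div_lt_one hl0).mpr ht.2⟩]
  field_simp

theorem mem_kronigPenneyGraph_iff {v : EdgeSpace l} {V : ℝ → ℝ}
    (hvV : v =ᵐ[edgeMeasure l] fun t => (V t : ℂ)) (α β : ℝ) (x y : LineSpace) :
    (x, y) ∈ kronigPenneyGraph l V α β ↔
      ChainRel v (α / (1 + β ^ 2)) (cellEquiv l x) (cellEquiv l y) := by
  have hper : ∀ k : ℤ, ∀ᵐ t ∂edgeMeasure l, (periodicExtension l V (t + k * l) : ℂ) = v t := fun k => by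
    -- The right end point must be excluded: there the fractional part has already returned to `0`.
    have h1 : ∀ᵐ t ∂edgeMeasure l, t ∈ Set.Ico 0 l := by
      rw [edgeMeasure, ← restrict_Ico_eq_restrict_Icc]
      exact ae_restrict_mem measurableSet_Ico
    filter_upwards [h1, hvV] with t h1 h2
    rw [h2, periodicExtension_add V k h1]
  have hk : ∀ k : ℤ, l + k * l = (k + 1) * l := fun k => by ring
  constructor
  · rintro ⟨f, g, h, H, h1, h2, h3, h4⟩
    refine ⟨fun k => f k (k * l), fun k => g k (k * l), fun k => f k ((k + 1) * l),
      fun k => g k ((k + 1) * l), fun k => ?_, fun k => ?_, fun k => ?_⟩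
    · have H' := (H k).translate (k * l)
      rw [sub_self, show (k + 1) * l - k * l = l by ring] at H'
      refine ⟨_, _, _, H', (cellPart_ae_iff k x _).mp (h1 k), ?_, by simp, by simp, by simp [hk],
        by simp [hk]⟩
      refine ((cellPart_ae_iff k y _).mp (h2 k)).trans ?_
      filter_upwards [hper k] with t ht
      rw [ht]
    · simpa using h3 (k + 1)
    · simpa using h4 (k + 1)
  · rintro ⟨a, b, c, d, h, h3, h4⟩
    choose f g h H h1 h2 ha hb hc hd using h
    refine ⟨fun k t => f k (t + -(k * l)), fun k t => g k (t + -(k * l)),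
      fun k t => h k (t + -(k * l)), fun k => ?_, fun k => ?_, fun k => ?_, fun k => ?_, fun k => ?_⟩
    · have H' := (H k).translate (-(k * l))
      rwa [sub_neg_eq_add, sub_neg_eq_add, zero_add, hk] at H'
    · refine (cellPart_ae_iff k x _).mpr ?_
      simp only [add_neg_cancel_right]
      exact h1 k
    · refine (cellPart_ae_iff k y _).mpr ((h2 k).trans ?_)
      filter_upwards [hper k] with t ht
      simp [ht]
    · have e1 : k * l + -(((k - 1 : ℤ) : ℝ) * l) = l := by push_cast; ring
      have := h3 (k - 1)
      rw [sub_add_cancel] at this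
      simp only [add_neg_cancel, e1, ha, hc, this]
    · have e1 : k * l + -(((k - 1 : ℤ) : ℝ) * l) = l := by push_cast; ring
      have := h4 (k - 1)
      rw [sub_add_cancel] at this
      simp only [add_neg_cancel, e1, hb, hd, hc, this]

end Line

/-! ### The spectrum of the Kronig–Penney Hamiltonian -/

section Chain

variable {l : ℝ} [hl : Fact (0 < l)] (v : EdgeSpace l)

/-- A cubic with zero data at `0` and Hermite data at `l`. It repairs the mismatch at the nodes that
a cellwise constant cutoff creates in `exists_chain_approx`. -/
theorem exists_edgeRel_of_end (c d : ℂ) : ∃ x y, EdgeRel v x y 0 0 c d := by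
  have hl0 : (l : ℂ) ≠ 0 := Complex.ofReal_ne_zero.mpr hl.out.ne'
  set A : ℂ := (3 * c - l * d) / l ^ 2 with hA
  set B : ℂ := (l * d - 2 * c) / l ^ 3 with hB
  set f : ℝ → ℂ := fun t => A * (t : ℂ) ^ 2 + B * (t : ℂ) ^ 3 with hf
  set g : ℝ → ℂ := fun t => A * (2 * (t : ℂ)) + B * (3 * (t : ℂ) ^ 2) with hg
  set h : ℝ → ℂ := fun t => A * 2 + B * (6 * (t : ℂ)) with hh
  have hid : ∀ s : ℝ, HasDerivAt (fun t : ℝ => (t : ℂ)) 1 s := fun s => Complex.ofRealCLM.hasDerivAt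
  have d1 : ∀ s, HasDerivAt f (g s) s := fun s => by
    refine ((((hid s).pow 2).const_mul A).add (((hid s).pow 3).const_mul B)).congr_deriv ?_
    simp [hg]
  have d2 : ∀ s, HasDerivAt g (h s) s := fun s => by
    refine ((((hid s).const_mul 2).const_mul A).add
      ((((hid s).pow 2).const_mul 3).const_mul B)).congr_deriv ?_
    simp only [hh, Nat.cast_ofNat, mul_one]
    ring
  have cf : Continuous f := by fun_prop
  have cg : Continuous g := by fun_prop
  have ch : Continuous h := by fun_prop
  have H : IsH2 0 l f g h := ⟨memLp_of_continuousOn ch.continuousOn,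
    fun t _ => eq_add_integral_of_hasDerivAt d1 cg t,
    fun t _ => eq_add_integral_of_hasDerivAt d2 ch t⟩
  have my : MemLp (fun t => -h t + v t * f t) 2 (edgeMeasure l) :=
    (memLp_of_continuousOn ch.continuousOn).neg.add
      (memLp_mul_continuousOn (Lp.memLp v) cf.continuousOn)
  refine ⟨(memLp_of_continuousOn cf.continuousOn).toLp, my.toLp, f, g, h, H, MemLp.coeFn_toLp _,
    MemLp.coeFn_toLp _, by simp [hf], by simp [hg], ?_, ?_⟩
  · simp only [hf, hA, hB]; field_simp; ring
  · simp only [hg, hA, hB]; field_simp; ring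

variable {v}

/-- The initial data of consecutive cells are related by a matrix `T` of determinant one whose trace
is the discriminant, and `T + T⁻¹` is the trace times the identity. So both components are square
summable solutions of `w (k + 1) + w (k - 1) = discC v s z * w k`, which must vanish when the
discriminant is outside the spectrum of `chainLaplacian`. -/
theorem chainRel_eigen_eq_zero {s : ℝ} {z : ℂ} (hz : discC v s z ∉ spectrum ℂ chainLaplacian)
    {x : L2Sum ℤ (EdgeSpace l)} (h : ChainRel v s x (z • x)) : x = 0 := by
  obtain ⟨a, b, c, d, h1, h2, h3⟩ := h
  have h4 : ∀ k, x k = a k • solTwo v z + b k • solOne v z ∧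
      c k = u₂End v z * a k + u₁End v z * b k ∧ d k = u₂End' v z * a k + u₁End' v z * b k := fun k => by
    have h5 := (edgeRel_iff v z _ _ _ _ _ _).mp (h1 k)
    have h6 : (z • x) k - z • x k = 0 := sub_self _
    rwa [h6, map_zero, map_zero, map_zero, add_zero, add_zero, add_zero] at h5
  obtain ⟨C, hC0, hC⟩ := exists_norm_initial_le v z
  have W := wronskian_eq_one v z
  obtain ⟨u, hu⟩ : IsUnit (algebraMap ℂ _ (discC v s z) - chainLaplacian) := not_not.mp hz
  have ker : ∀ w : L2Sum ℤ ℂ, (∀ k, w (k + 1) + w (k - 1) = discC v s z * w k) → w = 0 := fun w hw => by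
    have e1 : (u : L2Sum ℤ ℂ →L[ℂ] L2Sum ℤ ℂ) w = 0 := by
      rw [hu]
      refine lp.ext (funext fun k => ?_)
      change discC v s z * w k - chainLaplacian w k = 0
      rw [chainLaplacian_apply, hw, sub_self]
    have e2 : (↑u⁻¹ : L2Sum ℤ ℂ →L[ℂ] L2Sum ℤ ℂ) ((u : L2Sum ℤ ℂ →L[ℂ] L2Sum ℤ ℂ) w) = w := by
      rw [← mul_apply_eq_comp, Units.inv_mul, one_apply_eq_self]
    rw [← e2, e1, map_zero]
  have ra : ∀ k, a (k + 1) = u₂End v z * a k + u₁End v z * b k := fun k => by rw [h2, (h4 k).2.1]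
  have rb : ∀ k, b (k + 1) = (u₂End' v z + s * u₂End v z) * a k
      + (u₁End' v z + s * u₁End v z) * b k := fun k => by rw [h3, (h4 k).2.1, (h4 k).2.2]; ring
  have ma : Memℓp a 2 := memℓp_of_le x fun k => by
    have := (hC (a k) (b k)).1
    rwa [← (h4 k).1] at this
  have mb : Memℓp b 2 := memℓp_of_le x fun k => by
    have := (hC (a k) (b k)).2
    rwa [← (h4 k).1] at this
  have ka : (⟨a, ma⟩ : L2Sum ℤ ℂ) = 0 := ker _ fun k => by
    change a (k + 1) + a (k - 1) = discC v s z * a k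
    have e1 := ra (k - 1)
    have e2 := rb (k - 1)
    rw [sub_add_cancel] at e1 e2
    rw [ra k, discC, e1, e2]
    linear_combination -(a (k - 1)) * W
  have kb : (⟨b, mb⟩ : L2Sum ℤ ℂ) = 0 := ker _ fun k => by
    change b (k + 1) + b (k - 1) = discC v s z * b k
    have e1 := ra (k - 1)
    have e2 := rb (k - 1)
    rw [sub_add_cancel] at e1 e2
    rw [rb k, discC, e1, e2]
    linear_combination -(b (k - 1)) * W
  refine lp.ext (funext fun k => ?_)
  have e1 : a k = 0 := congrArg (fun w : L2Sum ℤ ℂ => w k) ka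
  have e2 : b k = 0 := congrArg (fun w : L2Sum ℤ ℂ => w k) kb
  rw [(h4 k).1, e1, e2, zero_smul, zero_smul, add_zero]
  rfl

/-- The initial data must solve `X (k + 1) = T X k + F k` with the monodromy matrix `T`. If `J`
inverts `chainLaplacian` minus the discriminant, then `X k = (J F) k - T⁻¹ (J F) (k - 1)` does so,
by `T + T⁻¹ = trace`; `A` and `B` are its two components. -/
theorem exists_chain_resolvent {s : ℝ} {z : ℂ} (hz : discC v s z ∉ spectrum ℂ chainLaplacian) :
    ∃ R : L2Sum ℤ (EdgeSpace l) →L[ℂ] L2Sum ℤ (EdgeSpace l),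
      ∀ y, ChainRel v s (R y) (y + z • R y) := by
  obtain ⟨u, hu⟩ : IsUnit (algebraMap ℂ _ (discC v s z) - chainLaplacian) := not_not.mp hz
  have W := wronskian_eq_one v z
  set J : L2Sum ℤ ℂ →L[ℂ] L2Sum ℤ ℂ := -(↑u⁻¹ : L2Sum ℤ ℂ →L[ℂ] L2Sum ℤ ℂ) with hJ
  have hJ' : ∀ (w : L2Sum ℤ ℂ) k, J w (k + 1) + J w (k - 1) - discC v s z * J w k = w k := fun w k => by
    have e2 : (u : L2Sum ℤ ℂ →L[ℂ] L2Sum ℤ ℂ) ((↑u⁻¹ : L2Sum ℤ ℂ →L[ℂ] L2Sum ℤ ℂ) w) = w := by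
      rw [← mul_apply_eq_comp, Units.mul_inv, one_apply_eq_self]
    have e3 : (↑u⁻¹ : L2Sum ℤ ℂ →L[ℂ] L2Sum ℤ ℂ) w = -(J w) := by rw [hJ, neg_apply, neg_neg]
    rw [e3, map_neg, hu] at e2
    have e4 := congrArg (fun w : L2Sum ℤ ℂ => w k) e2
    change -(discC v s z * J w k - chainLaplacian (J w) k) = w k at e4
    rw [chainLaplacian_apply] at e4
    linear_combination e4
  set F₀ : L2Sum ℤ (EdgeSpace l) →L[ℂ] L2Sum ℤ ℂ := lpMap (inhomEnd v z) with hF₀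
  set F₁ : L2Sum ℤ (EdgeSpace l) →L[ℂ] L2Sum ℤ ℂ := lpMap (inhomEnd' v z + (s : ℂ) • inhomEnd v z)
  set S := chainShift (-1)
  have hS : ∀ w k, S w k = w (k - 1) := fun w k => by rw [chainShift_apply, ← sub_eq_add_neg]
  set A : L2Sum ℤ (EdgeSpace l) →L[ℂ] L2Sum ℤ ℂ :=
    (1 - (u₁End' v z + s * u₁End v z) • S) ∘L J ∘L F₀ + (u₁End v z • S) ∘L J ∘L F₁ with hA
  set B : L2Sum ℤ (EdgeSpace l) →L[ℂ] L2Sum ℤ ℂ :=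
    ((u₂End' v z + s * u₂End v z) • S) ∘L J ∘L F₀ + (1 - u₂End v z • S) ∘L J ∘L F₁ with hB
  have eA : ∀ y k, A y k = J (F₀ y) k - (u₁End' v z + s * u₁End v z) * J (F₀ y) (k - 1)
      + u₁End v z * J (F₁ y) (k - 1) := fun y k => by
    rw [← hS, ← hS]; rfl
  have eB : ∀ y k, B y k = (u₂End' v z + s * u₂End v z) * J (F₀ y) (k - 1)
      + (J (F₁ y) k - u₂End v z * J (F₁ y) (k - 1)) := fun y k => by
    rw [← hS, ← hS]; rfl
  have eF₀ : ∀ y k, F₀ y k = inhomEnd v z (y k) := fun y k => rfl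
  have eF₁ : ∀ y k, F₁ y k = inhomEnd' v z (y k) + s * inhomEnd v z (y k) := fun y k => rfl
  set R : L2Sum ℤ (EdgeSpace l) →L[ℂ] L2Sum ℤ (EdgeSpace l) :=
    lpTensor (solTwo v z) ∘L A + lpTensor (solOne v z) ∘L B + lpMap (solInhom v z) with hR
  refine ⟨R, fun y => ?_⟩
  set x := R y with hx
  have ex : ∀ k, x k = A y k • solTwo v z + B y k • solOne v z + solInhom v z (y k) := fun k => by
    rw [← lpTensor_apply, ← lpTensor_apply]; rfl
  refine ⟨A y, B y, fun k => u₂End v z * A y k + u₁End v z * B y k + inhomEnd v z (y k),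
    fun k => u₂End' v z * A y k + u₁End' v z * B y k + inhomEnd' v z (y k), fun k => ?_,
    fun k => ?_, fun k => ?_⟩
  · refine (edgeRel_iff v z _ _ _ _ _ _).mpr ?_
    have : (y + z • x) k - z • x k = y k := add_sub_cancel_right _ _
    rw [this]
    exact ⟨ex k, rfl, rfl⟩
  · have j0 := hJ' (F₀ y) k
    rw [eF₀] at j0
    rw [discC] at j0
    simp only [eA, eB, add_sub_cancel_right]
    linear_combination j0 + J (F₀ y) (k - 1) * W
  · have j1 := hJ' (F₁ y) k
    rw [eF₁] at j1
    rw [discC] at j1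
    simp only [eA, eB, add_sub_cancel_right]
    linear_combination j1 + J (F₁ y) (k - 1) * W

/-- The characteristic polynomial of the monodromy matrix is `ζ² - r ζ + 1`, and for `|r| ≤ 2` its
roots `exp (±i φ)` with `2 cos φ = r` are on the unit circle. -/
theorem exists_eigenvector_of_disc {s : ℝ} {z : ℂ} {r : ℝ} (hr : |r| ≤ 2) (hz : discC v s z = r) :
    ∃ ζ p q : ℂ, ‖ζ‖ = 1 ∧ (p ≠ 0 ∨ q ≠ 0) ∧ u₂End v z * p + u₁End v z * q = ζ * p ∧
      (u₂End' v z * p + u₁End' v z * q) + s * (u₂End v z * p + u₁End v z * q) = ζ * q := by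
  have W := wronskian_eq_one v z
  set φ := Real.arccos (r / 2)
  have hcos : 2 * Real.cos φ = r := by
    rw [abs_le] at hr
    rw [Real.cos_arccos (by linarith) (by linarith)]; ring
  set ζ : ℂ := Complex.exp ((φ : ℂ) * Complex.I) with hζ
  have hζ1 : ‖ζ‖ = 1 := Complex.norm_exp_ofReal_mul_I φ
  have hζ0 : ζ ^ 2 - r * ζ + 1 = 0 := by
    have e1 : (r : ℂ) = ζ + Complex.exp (-(φ : ℂ) * Complex.I) := by
      rw [← hcos]; push_cast; rw [Complex.cos]; ring
    have e2 : ζ * Complex.exp (-(φ : ℂ) * Complex.I) = 1 := by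
      rw [hζ, ← Complex.exp_add]; simp
    rw [e1]; linear_combination -e2
  rw [← hz, discC] at hζ0
  -- If `u₁(l) ≠ 0`, the first row alone dictates the eigenvector `(u₁, ζ - u₂)`. Otherwise the
  -- matrix is lower triangular and the cases, down to a scalar matrix, are treated separately.
  by_cases h1 : u₁End v z = 0
  · by_cases h2 : u₂End v z - ζ = 0
    · by_cases h3 : u₁End' v z - ζ = 0 ∧ u₂End' v z + s * u₂End v z = 0
      · refine ⟨ζ, 1, 0, hζ1, Or.inl one_ne_zero, ?_, ?_⟩
        · linear_combination h2
        · linear_combination h3.2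
      · refine ⟨ζ, u₁End' v z - ζ, -(u₂End' v z + s * u₂End v z), hζ1, ?_, ?_, ?_⟩
        · by_contra hcon
          push Not at hcon
          exact h3 ⟨hcon.1, by linear_combination -hcon.2⟩
        · rw [h1]; linear_combination (u₁End' v z - ζ) * h2
        · rw [h1]; ring
    · refine ⟨ζ, 0, 1, hζ1, Or.inr one_ne_zero, by rw [h1]; ring, ?_⟩
      have : (u₂End v z - ζ) * (u₁End' v z - ζ) = 0 := by
        rw [h1] at hζ0 W
        linear_combination hζ0 + W
      have := (mul_eq_zero.mp this).resolve_left h2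
      rw [h1]
      linear_combination this
  · refine ⟨ζ, u₁End v z, ζ - u₂End v z, hζ1, Or.inl h1, by ring, ?_⟩
    linear_combination -hζ0 - W

/-- A Bloch wave is multiplied by a slowly decaying weight that is constant on each cell. Adding `w
(k + 1) - w k` times a function `χ` with the end data of the wave and zero data at `0` changes the
end data from weight `w k` to `w (k + 1)`, so the node conditions hold exactly and only the small
multiples of `χ` contribute to the error. -/
theorem exists_chain_approx {s : ℝ} {z : ℂ} {r : ℝ} (hr : |r| ≤ 2) (hz : discC v s z = r) {ε : ℝ}
    (hε : 0 < ε) : ∃ x y, ChainRel v s x y ∧ x ≠ 0 ∧ ‖y - z • x‖ ≤ ε * ‖x‖ := by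
  obtain ⟨ζ, p, q, hζ, hpq, hp, hq⟩ := exists_eigenvector_of_disc hr hz
  have hζ0 : ζ ≠ 0 := fun h => by simp [h] at hζ
  set c := u₂End v z * p + u₁End v z * q with hc
  set d := u₂End' v z * p + u₁End' v z * q with hd
  set ψ := p • solTwo v z + q • solOne v z with hψ
  have rψ : EdgeRel v ψ (z • ψ) p q c d := (edgeRel_iff v z _ _ _ _ _ _).mpr (by simp [hψ, hc, hd])
  have hψ0 : 0 < ‖ψ‖ := by
    obtain ⟨C, hC0, hC⟩ := exists_norm_initial_le v z
    refine norm_pos_iff.mpr fun h => ?_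
    obtain ⟨h1, h2⟩ := hC p q
    rw [← hψ, h, norm_zero, mul_zero] at h1 h2
    exact hpq.elim (fun h => h (norm_le_zero_iff.mp h1)) fun h => h (norm_le_zero_iff.mp h2)
  obtain ⟨χ, χ', rχ⟩ := exists_edgeRel_of_end v c d
  -- `δ` will bound the relative change of the weight: the repair term may take away at most half of
  -- `‖ψ‖`, and its residual may be at most `ε` times the other half.
  obtain ⟨δ, hδ0, hδ1, hδ2⟩ : ∃ δ : ℝ, 0 < δ ∧ δ * ‖χ‖ ≤ ‖ψ‖ / 2 ∧ δ * ‖χ' - z • χ‖ ≤ ε * (‖ψ‖ / 2) := by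
    refine ⟨min (‖ψ‖ / 2 / (‖χ‖ + 1)) (ε * (‖ψ‖ / 2) / (‖χ' - z • χ‖ + 1)), by positivity, ?_, ?_⟩
    · calc _ ≤ ‖ψ‖ / 2 / (‖χ‖ + 1) * (‖χ‖ + 1) := by
            gcongr
            · exact min_le_left _ _
            · linarith
        _ = _ := by field_simp
    · calc _ ≤ ε * (‖ψ‖ / 2) / (‖χ' - z • χ‖ + 1) * (‖χ' - z • χ‖ + 1) := by
            gcongr
            · exact min_le_right _ _
            · linarith
        _ = _ := by field_simp
  obtain ⟨ρ, hρ0, hρ1, hρ⟩ : ∃ ρ : ℝ, 0 < ρ ∧ ρ < 1 ∧ ρ⁻¹ - 1 = δ :=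
    ⟨(1 + δ)⁻¹, by positivity, inv_lt_one_of_one_lt₀ (by linarith), by rw [inv_inv]; ring⟩
  set w := decay ρ
  have hw0 : ∀ k, 0 < w k := decay_pos hρ0
  have hw1 : ∀ k, |w (k + 1) - w k| ≤ δ * w k := fun k => by
    rw [← hρ]; exact abs_decay_sub_le hρ0 hρ1.le (by simp)
  have nc : ∀ (k : ℤ) (r : ℝ) (x : EdgeSpace l), ‖(ζ ^ k * (r : ℂ)) • x‖ = |r| * ‖x‖ := fun k r x => by
    rw [norm_smul, norm_mul, norm_zpow, hζ, one_zpow, one_mul, Complex.norm_real, Real.norm_eq_abs]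
  set f : ℤ → EdgeSpace l := fun k => (ζ ^ k * ((w k : ℝ) : ℂ)) • ψ
    + (ζ ^ k * ((w (k + 1) - w k : ℝ) : ℂ)) • χ with hf
  set g : ℤ → EdgeSpace l := fun k => (ζ ^ k * ((w k : ℝ) : ℂ)) • (z • ψ)
    + (ζ ^ k * ((w (k + 1) - w k : ℝ) : ℂ)) • χ' with hg
  have hle : ∀ k, ‖g k - z • f k‖ ≤ (δ * ‖χ' - z • χ‖) * w k := fun k => by
    have : g k - z • f k = (ζ ^ k * ((w (k + 1) - w k : ℝ) : ℂ)) • (χ' - z • χ) := by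
      simp only [hf, hg]; module
    rw [this, nc, mul_right_comm]
    exact mul_le_mul_of_nonneg_right (hw1 k) (norm_nonneg _)
  have hge : ∀ k, ‖ψ‖ / 2 * w k ≤ ‖f k‖ := fun k => by
    have h1 : ‖(ζ ^ k * ((w k : ℝ) : ℂ)) • ψ‖ - ‖(ζ ^ k * ((w (k + 1) - w k : ℝ) : ℂ)) • χ‖ ≤ ‖f k‖ := by
      have := norm_sub_norm_le ((ζ ^ k * ((w k : ℝ) : ℂ)) • ψ)
        (-((ζ ^ k * ((w (k + 1) - w k : ℝ) : ℂ)) • χ))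
      rwa [norm_neg, sub_neg_eq_add] at this
    rw [nc, nc, abs_of_pos (hw0 k)] at h1
    have h2 := mul_le_mul_of_nonneg_right (hw1 k) (norm_nonneg χ)
    have h3 := mul_le_mul_of_nonneg_right hδ1 (hw0 k).le
    nlinarith
  let W : L2Sum ℤ ℂ := ⟨fun k => (w k : ℂ), memℓp_two_iff.mpr (by
    simpa using summable_decay_sq hρ0 hρ1)⟩
  have hW : ∀ k, ‖W k‖ = w k := fun k => by
    change ‖((w k : ℝ) : ℂ)‖ = _
    rw [Complex.norm_real, Real.norm_eq_abs, abs_of_pos (hw0 k)]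
  have mf : Memℓp f 2 := memℓp_of_le W (C := ‖ψ‖ + δ * ‖χ‖) fun k => by
    rw [hW]
    refine (norm_add_le _ _).trans ?_
    rw [nc, nc, abs_of_pos (hw0 k)]
    have := mul_le_mul_of_nonneg_right (hw1 k) (norm_nonneg χ)
    linarith
  have md : Memℓp (fun k => g k - z • f k) 2 := memℓp_of_le W fun k => by
    rw [hW]; exact hle k
  let x : L2Sum ℤ (EdgeSpace l) := ⟨f, mf⟩
  let D : L2Sum ℤ (EdgeSpace l) := ⟨fun k => g k - z • f k, md⟩
  refine ⟨x, D + z • x, ?_, fun h => ?_, ?_⟩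
  · have ey : ∀ k, (D + z • x) k = g k := fun k => sub_add_cancel (g k) (z • f k)
    refine ⟨fun k => ζ ^ k * ((w k : ℝ) : ℂ) * p, fun k => ζ ^ k * ((w k : ℝ) : ℂ) * q,
      fun k => ζ ^ k * ((w (k + 1) : ℝ) : ℂ) * c, fun k => ζ ^ k * ((w (k + 1) : ℝ) : ℂ) * d,
      fun k => ?_, fun k => ?_, fun k => ?_⟩
    · rw [ey]
      have h := (rψ.smul v (ζ ^ k * ((w k : ℝ) : ℂ))).add v
        (rχ.smul v (ζ ^ k * ((w (k + 1) - w k : ℝ) : ℂ)))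
      convert h using 1 <;> push_cast <;> ring
    · simp only [zpow_add_one₀ hζ0]
      linear_combination -(ζ ^ k * ((w (k + 1) : ℝ) : ℂ)) * hp
    · simp only [zpow_add_one₀ hζ0]
      linear_combination -(ζ ^ k * ((w (k + 1) : ℝ) : ℂ)) * hq
  · have h1 : f 0 = 0 := congrArg (fun x : L2Sum ℤ (EdgeSpace l) => x 0) h
    have h2 := hge 0
    rw [h1, norm_zero] at h2
    have := hw0 0
    nlinarith [mul_pos hψ0 this]
  · rw [add_sub_cancel_right]
    refine norm_le_of_forall_le _ _ hε.le fun k => (hle k).trans ?_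
    calc _ ≤ ε * (‖ψ‖ / 2) * w k := mul_le_mul_of_nonneg_right hδ2 (hw0 k).le
      _ = ε * (‖ψ‖ / 2 * w k) := by ring
      _ ≤ ε * ‖f k‖ := by gcongr; exact hge k

/-- The spectrum of the Kronig–Penney Hamiltonian. -/
theorem mem_spec_kronigPenneyOp_iff {V : ℝ → ℝ} (hvV : v =ᵐ[edgeMeasure l] fun t => (V t : ℂ))
    (α β : ℝ) (z : ℂ) : z ∈ spec (kronigPenneyOp l V α β) ↔
      ∃ r : ℝ, |r| ≤ 2 ∧ discC v (α / (1 + β ^ 2)) z = r := by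
  have hgr := kronigPenneyOp_graph hl.out V α β
  constructor
  · intro hz
    by_contra hcon
    have hz' : discC v (α / (1 + β ^ 2)) z ∉ spectrum ℂ chainLaplacian := fun h =>
      hcon (mem_spectrum_chainLaplacian h)
    obtain ⟨R, hR⟩ := exists_chain_resolvent hz'
    let U := (cellEquiv l).toContinuousLinearEquiv
    refine hz (mem_resolventSet_of_graph
      ((U.symm : _ →L[ℂ] LineSpace) ∘L R ∘L (U : LineSpace →L[ℂ] _)) (fun y => ?_) fun x hx => ?_)
    · rw [hgr, mem_kronigPenneyGraph_iff hvV]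
      have h1 : cellEquiv l ((cellEquiv l).symm (R (cellEquiv l y))) = R (cellEquiv l y) :=
        (cellEquiv l).apply_symm_apply _
      change ChainRel v _ (cellEquiv l ((cellEquiv l).symm (R (cellEquiv l y))))
        (cellEquiv l (y + z • (cellEquiv l).symm (R (cellEquiv l y))))
      rw [map_add, map_smul, h1]
      exact hR _
    · rw [hgr, mem_kronigPenneyGraph_iff hvV, map_smul] at hx
      exact (cellEquiv l).injective ((chainRel_eigen_eq_zero hz' hx).trans (map_zero _).symm)
  · rintro ⟨r, hr, hz⟩
    refine mem_spec_of_approx fun ε hε => ?_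
    obtain ⟨x, y, h, hx, hle⟩ := exists_chain_approx hr hz hε
    refine ⟨(cellEquiv l).symm x, (cellEquiv l).symm y, ?_, ?_, ?_⟩
    · rw [hgr, mem_kronigPenneyGraph_iff hvV, LinearIsometryEquiv.apply_symm_apply,
        LinearIsometryEquiv.apply_symm_apply]
      exact h
    · simpa using hx
    · rw [← map_smul, ← map_sub, LinearIsometryEquiv.norm_map, LinearIsometryEquiv.norm_map]
      exact hle

/-- Division by `1 + β²` turns η into the discriminant and the interval `[-2 (1 + β²), 2 (1 + β²)]`
into `[-2, 2]`. The criterion coincides with the one for the Kronig–Penney operator, which is why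
`Σ` equals its spectrum. -/
theorem mem_sigmaPart_iff {V : ℝ → ℝ} (hvV : v =ᵐ[edgeMeasure l] fun t => (V t : ℂ)) {θ : ℝ}
    (hθ : ∃ N : ℤ, θ = N) (α β : ℝ) (z : ℂ) : z ∈ sigmaPart l V θ α β ↔
      ∃ r : ℝ, |r| ≤ 2 ∧ discC v (α / (1 + β ^ 2)) z = r := by
  have hβ : 0 < 1 + β ^ 2 := by positivity
  have hβ' : ((1 + β ^ 2 : ℝ) : ℂ) ≠ 0 := Complex.ofReal_ne_zero.mpr hβ.ne'
  have e : eta l V α β z = ((1 + β ^ 2 : ℝ) : ℂ) * discC v (α / (1 + β ^ 2)) z := by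
    rw [eta_eq v hvV, discC]
    push_cast at hβ' ⊢
    field_simp
  change eta l V α β z ∈ spectrum ℂ (magneticLaplacian θ β) ↔ _
  rw [mem_spectrum_magneticLaplacian_iff hθ, e]
  constructor
  · rintro ⟨r, hr, h⟩
    refine ⟨r / (1 + β ^ 2), ?_, ?_⟩
    · rw [abs_div, abs_of_pos hβ, div_le_iff₀ hβ]; exact hr
    · rw [Complex.ofReal_div, ← h, mul_div_cancel_left₀ _ hβ']
  · rintro ⟨r, hr, h⟩
    refine ⟨(1 + β ^ 2) * r, ?_, ?_⟩
    · rw [abs_mul, abs_of_pos hβ]; nlinarith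
    · rw [h]; push_cast; ring

end Chain

/-! ### Incidence operators of the square lattice -/

section Incidence

instance : Fintype Dir where
  elems := ⟨{Dir.right, Dir.up}, by simp⟩
  complete := by rintro (_ | _) <;> simp

theorem sum_dir {M : Type*} [AddCommMonoid M] (f : Dir → M) : ∑ D, f D = f .right + f .up := by
  change ((({Dir.right, Dir.up} : Multiset Dir).map f).sum : M) = _
  simp

/-- Values at the initial points of the edges of a function on the nodes. -/
def initMap (β : ℝ) : NodeSpace →L[ℂ] L2Sum Edge ℂ :=
  lpPull (fun e : Edge => (e.1, e.2.1)) (fun e => e.2.2)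
    (by rintro ⟨m, n, D⟩ ⟨m', n', D'⟩ h; simp at h; simp [h])
    (fun e => match e.2.2 with | .right => 1 | .up => β) (max 1 |β|)
    (by rintro ⟨m, n, (_ | _)⟩ <;> simp)

/-- Values at the terminal points of the edges of a function on the nodes. -/
def termMap (θ β : ℝ) : NodeSpace →L[ℂ] L2Sum Edge ℂ :=
  lpPull (fun e : Edge => match e.2.2 with | .right => (e.1 + 1, e.2.1) | .up => (e.1, e.2.1 + 1))
    (fun e => e.2.2)
    (by rintro ⟨m, n, (_ | _)⟩ ⟨m', n', (_ | _)⟩ h <;> simp at h <;> simp [h])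
    (fun e => match e.2.2 with | .right => phase θ e.2.1 | .up => β * phase θ (-e.1)) (max 1 |β|)
    (by rintro ⟨m, n, (_ | _)⟩ <;> simp [norm_phase])

theorem initMap_right (β : ℝ) (g : NodeSpace) (m n : ℤ) : initMap β g (m, n, .right) = g (m, n) :=
  one_mul _

theorem initMap_up (β : ℝ) (g : NodeSpace) (m n : ℤ) : initMap β g (m, n, .up) = β * g (m, n) := rfl

theorem termMap_right (θ β : ℝ) (g : NodeSpace) (m n : ℤ) :
    termMap θ β g (m, n, .right) = phase θ n * g (m + 1, n) := rfl

theorem termMap_up (θ β : ℝ) (g : NodeSpace) (m n : ℤ) :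
    termMap θ β g (m, n, .up) = β * phase θ (-m) * g (m, n + 1) := rfl

/-- The operator `b ↦ (x ↦ c x • b (x + (i, j), D))`. -/
def edgePull (i j : ℤ) (D : Dir) (c : ℤ × ℤ → ℂ) (C : ℝ) (hc : ∀ x, ‖c x‖ ≤ C) :
    L2Sum Edge ℂ →L[ℂ] NodeSpace :=
  lpPull (fun x : ℤ × ℤ => (x.1 + i, x.2 + j, D)) (fun _ => ())
    (by rintro ⟨m, n⟩ ⟨m', n'⟩ h; simp at h; simp [h]) c C hc

/-- The adjoint of `initMap`. -/
def initSum (β : ℝ) : L2Sum Edge ℂ →L[ℂ] NodeSpace :=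
  edgePull 0 0 .right (fun _ => 1) 1 (by simp) + edgePull 0 0 .up (fun _ => β) |β| (by simp)

/-- The adjoint of `termMap`. -/
def termSum (θ β : ℝ) : L2Sum Edge ℂ →L[ℂ] NodeSpace :=
  edgePull (-1) 0 .right (fun x => phase θ (-x.2)) 1 (by simp [norm_phase])
    + edgePull 0 (-1) .up (fun x => β * phase θ x.1) |β| (by simp [norm_phase])

theorem initSum_apply (β : ℝ) (b : L2Sum Edge ℂ) (m n : ℤ) :
    initSum β b (m, n) = b (m, n, .right) + β * b (m, n, .up) := by
  change 1 * b (m + 0, n + 0, .right) + β * b (m + 0, n + 0, .up) = _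
  simp

theorem termSum_apply (θ β : ℝ) (d : L2Sum Edge ℂ) (m n : ℤ) :
    termSum θ β d (m, n) = phase θ (-n) * d (m - 1, n, .right)
      + β * phase θ m * d (m, n - 1, .up) := by
  change phase θ (-n) * d (m + -1, n + 0, .right) + β * phase θ m * d (m + 0, n + -1, .up) = _
  simp [sub_eq_add_neg]

theorem initSum_initMap (β : ℝ) (g : NodeSpace) :
    initSum β (initMap β g) = ((1 + β ^ 2 : ℝ) : ℂ) • g := by
  refine lp.ext (funext fun ⟨m, n⟩ => ?_)
  rw [initSum_apply, initMap_right, initMap_up]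
  change _ = ((1 + β ^ 2 : ℝ) : ℂ) * g (m, n)
  push_cast
  ring

theorem termSum_termMap (θ β : ℝ) (g : NodeSpace) :
    termSum θ β (termMap θ β g) = ((1 + β ^ 2 : ℝ) : ℂ) • g := by
  refine lp.ext (funext fun ⟨m, n⟩ => ?_)
  rw [termSum_apply, termMap_right, termMap_up, sub_add_cancel, sub_add_cancel]
  change _ = ((1 + β ^ 2 : ℝ) : ℂ) * g (m, n)
  push_cast
  linear_combination (g (m, n)) * phase_mul_neg θ n + (β : ℂ) ^ 2 * g (m, n) * phase_mul_neg θ m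

/-- The origin of the magnetic Laplacian: carry the node values to one end of each edge and collect
them, with the adjoint weights, at the other end, in both orientations. -/
theorem initSum_termMap_add (θ β : ℝ) (g : NodeSpace) :
    initSum β (termMap θ β g) + termSum θ β (initMap β g) = magneticLaplacian θ β g := by
  refine lp.ext (funext fun ⟨m, n⟩ => ?_)
  change initSum β (termMap θ β g) (m, n) + termSum θ β (initMap β g) (m, n) = _
  rw [initSum_apply, termSum_apply, termMap_right, termMap_up, initMap_right, initMap_up,
    magneticLaplacian_apply]
  push_cast
  ring

theorem inner_edge (h b : L2Sum Edge ℂ) : inner ℂ h b =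
    ∑' x : ℤ × ℤ, b (x.1, x.2, .right) * (starRingEnd ℂ) (h (x.1, x.2, .right))
    + ∑' x : ℤ × ℤ, b (x.1, x.2, .up) * (starRingEnd ℂ) (h (x.1, x.2, .up)) := by
  have hs : Summable fun e => inner ℂ (h e) (b e) := (lp.hasSum_inner h b).summable
  rw [← (lp.hasSum_inner h b).tsum_eq]
  have hD : ∀ D : Dir, Summable fun x : ℤ × ℤ => inner ℂ (h (x.1, x.2, D)) (b (x.1, x.2, D)) :=
    fun D => hs.comp_injective (i := fun x : ℤ × ℤ => (x.1, x.2, D)) (by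
      rintro ⟨m, n⟩ ⟨m', n'⟩ h; simp at h; simp [h])
  have hs' : Summable fun p : (ℤ × ℤ) × Dir => inner ℂ (h (p.1.1, p.1.2, p.2)) (b (p.1.1, p.1.2, p.2)) :=
    (Equiv.prodAssoc ℤ ℤ Dir).summable_iff.mpr hs
  rw [← (Equiv.prodAssoc ℤ ℤ Dir).tsum_eq]
  change ∑' p : (ℤ × ℤ) × Dir, inner ℂ (h (p.1.1, p.1.2, p.2)) (b (p.1.1, p.1.2, p.2)) = _
  rw [hs'.tsum_prod]
  simp only [tsum_fintype, sum_dir]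
  rw [(hD .right).tsum_add (hD .up)]
  simp only [RCLike.inner_apply]

theorem inner_edgePull (i j : ℤ) (D : Dir) (c : ℤ × ℤ → ℂ) (C : ℝ) (hc : ∀ x, ‖c x‖ ≤ C)
    (g : NodeSpace) (b : L2Sum Edge ℂ) : inner ℂ g (edgePull i j D c C hc b) =
      ∑' x : ℤ × ℤ, b (x.1, x.2, D) * (c (x.1 - i, x.2 - j)
        * (starRingEnd ℂ) (g (x.1 - i, x.2 - j))) := by
  rw [lp.inner_eq_tsum]
  refine Eq.trans (tsum_congr fun x => ?_) ((translate i j).tsum_eq _)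
  rw [RCLike.inner_apply]
  change (c x * b (x.1 + i, x.2 + j, D)) * _ = b (x.1 + i, x.2 + j, D)
    * (c (x.1 + i - i, x.2 + j - j) * (starRingEnd ℂ) (g (x.1 + i - i, x.2 + j - j)))
  rw [add_sub_cancel_right, add_sub_cancel_right]
  ring

theorem inner_initMap (β : ℝ) (g : NodeSpace) (b : L2Sum Edge ℂ) :
    inner ℂ (initMap β g) b = inner ℂ g (initSum β b) := by
  change _ = inner ℂ g (edgePull _ _ _ _ _ _ b + edgePull _ _ _ _ _ _ b)
  rw [inner_edge, inner_add_right, inner_edgePull, inner_edgePull]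
  simp only [initMap_right, initMap_up, sub_zero, one_mul, map_mul, Complex.conj_ofReal]

theorem inner_termMap (θ β : ℝ) (g : NodeSpace) (b : L2Sum Edge ℂ) :
    inner ℂ (termMap θ β g) b = inner ℂ g (termSum θ β b) := by
  change _ = inner ℂ g (edgePull _ _ _ _ _ _ b + edgePull _ _ _ _ _ _ b)
  rw [inner_edge, inner_add_right, inner_edgePull, inner_edgePull]
  simp only [termMap_right, termMap_up, sub_zero, sub_neg_eq_add, map_mul, Complex.conj_ofReal,
    conj_phase, neg_neg]

theorem norm_le_norm_initMap (β : ℝ) (g : NodeSpace) : ‖g‖ ≤ ‖initMap β g‖ := by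
  have h1 := inner_initMap β g (initMap β g)
  rw [initSum_initMap, inner_smul_right, inner_self_eq_norm_sq_to_K, inner_self_eq_norm_sq_to_K] at h1
  have h2 : ‖initMap β g‖ ^ 2 = (1 + β ^ 2) * ‖g‖ ^ 2 :=
    Complex.ofReal_injective (by push_cast; simpa using h1)
  refine le_of_sq_le_sq ?_ (norm_nonneg _)
  rw [h2]
  nlinarith [mul_nonneg (sq_nonneg β) (sq_nonneg ‖g‖)]

end Incidence

/-! ### The Hamiltonian on the lattice in terms of boundary values -/

section Lattice

variable {l : ℝ} [hl : Fact (0 < l)] {v : EdgeSpace l}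

/-- The relation between `x` and `y = Λ x` in terms of the values `a`, `c` and the derivatives `b`,
`d` at the initial and terminal points of the edges, and the values `g` at the nodes. -/
structure LatticeRel (v : EdgeSpace l) (θ α β : ℝ) (x y : LatticeSpace l) (g : NodeSpace)
    (b d : L2Sum Edge ℂ) : Prop where
  edge : ∀ e, EdgeRel v (x e) (y e) (initMap β g e) (b e) (termMap θ β g e) (d e)
  node : initSum β b - termSum θ β d = (α : ℂ) • g

/-- With reference point `z = 0` the source is `y` itself, so `x` minus the response to `y` is a
square summable family of combinations of the two fundamental solutions. Their coefficients `a`, `b`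
are controlled uniformly by the norms, and `d` is given by the transfer matrix. -/
theorem memℓp_boundary {x y : LatticeSpace l} {a b c d : Edge → ℂ}
    (h : ∀ e, EdgeRel v (x e) (y e) (a e) (b e) (c e) (d e)) :
    Memℓp a 2 ∧ Memℓp b 2 ∧ Memℓp d 2 := by
  obtain ⟨C, hC0, hC⟩ := exists_norm_initial_le v 0
  have h1 : ∀ e, x e - lpMap (solInhom v 0) y e = a e • solTwo v 0 + b e • solOne v 0 ∧
      d e = u₂End' v 0 * a e + u₁End' v 0 * b e + lpMap (inhomEnd' v 0) y e := fun e => by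
    obtain ⟨e1, -, e3⟩ := (edgeRel_iff v 0 _ _ _ _ _ _).mp (h e)
    rw [zero_smul, sub_zero] at e1 e3
    refine ⟨?_, e3⟩
    rw [lpMap_apply]
    conv_lhs => rw [e1]
    rw [add_sub_cancel_right]
  have ma : Memℓp a 2 := memℓp_of_le (x - lpMap (solInhom v 0) y) fun e => by
    have := (hC (a e) (b e)).1
    rwa [← (h1 e).1] at this
  have mb : Memℓp b 2 := memℓp_of_le (x - lpMap (solInhom v 0) y) fun e => by
    have := (hC (a e) (b e)).2
    rwa [← (h1 e).1] at this
  refine ⟨ma, mb, ?_⟩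
  have := lp.memℓp (u₂End' v 0 • (⟨a, ma⟩ : L2Sum Edge ℂ) + u₁End' v 0 • (⟨b, mb⟩ : L2Sum Edge ℂ)
    + lpMap (inhomEnd' v 0) y)
  convert this using 1
  exact funext fun e => (h1 e).2

/-- The continuity conditions say that the values at both ends of all edges come from one function
on the nodes through `initMap` and `termMap`. The derivative condition is the single equation `node`
in `LatticeRel`. -/
theorem mem_latticeGraph_iff {V : ℝ → ℝ} (hvV : v =ᵐ[edgeMeasure l] fun t => (V t : ℂ))
    (θ α : ℝ) {β : ℝ} (hβ : β ≠ 0) (x y : LatticeSpace l) :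
    (x, y) ∈ latticeGraph l V θ α β ↔ ∃ g b d, LatticeRel v θ α β x y g b d := by
  have hβ' : (β : ℂ) ≠ 0 := Complex.ofReal_ne_zero.mpr hβ
  have e : ∀ f h : ℝ → ℂ, (fun t => -h t + v t * f t) =ᵐ[edgeMeasure l]
      fun t => -h t + (V t : ℂ) * f t := fun f h => by
    filter_upwards [hvV] with t ht
    rw [ht]
  constructor
  · rintro ⟨f, g, h, H, h1, h2, h3⟩
    have hE : ∀ e, EdgeRel v (x e) (y e) (f e 0) (g e 0) (f e l) (g e l) := fun k =>
      ⟨f k, g k, h k, H k, h1 k, (h2 k).trans (e _ _).symm, rfl, rfl, rfl, rfl⟩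
    obtain ⟨ma, mb, md⟩ := memℓp_boundary hE
    let G : NodeSpace := edgePull 0 0 .right (fun _ => 1) 1 (by simp) ⟨fun e => f e 0, ma⟩
    have hG : ∀ m n, G (m, n) = f (m, n, .right) 0 := fun m n => by
      change 1 * f (m + 0, n + 0, .right) 0 = _
      simp
    refine ⟨G, ⟨fun e => g e 0, mb⟩, ⟨fun e => g e l, md⟩, fun k => ?_, ?_⟩
    · have hi : initMap β G k = f k 0 := by
        obtain ⟨m, n, (_ | _)⟩ := k
        · rw [initMap_right, hG]
        · rw [initMap_up, hG, h3.up_zero, mul_inv_cancel_left₀ hβ']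
      have ht : termMap θ β G k = f k l := by
        obtain ⟨m, n, (_ | _)⟩ := k
        · rw [termMap_right, hG, h3.right_end, add_sub_cancel_right, ← mul_assoc, phase_mul_neg,
            one_mul]
        · have h4 := phase_mul_neg θ m
          rw [termMap_up, hG, h3.up_end, add_sub_cancel_right]
          field_simp
          linear_combination f (m, n, .up) l * h4
      rw [hi, ht]
      exact hE k
    · refine lp.ext (funext fun ⟨m, n⟩ => ?_)
      change initSum β ⟨fun e => g e 0, mb⟩ (m, n) - termSum θ β ⟨fun e => g e l, md⟩ (m, n)
        = α * G (m, n)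
      rw [initSum_apply, termSum_apply, hG]
      have := h3.deriv m n
      linear_combination this
  · rintro ⟨G, b, d, h, hn⟩
    choose f g h H h1 h2 ha hb hc hd using h
    refine ⟨f, g, h, H, h1, fun k => (h2 k).trans (e _ _), fun m n => ?_, fun m n => ?_, fun m n => ?_,
      fun m n => ?_⟩
    · rw [ha, ha, initMap_right, initMap_up, inv_mul_cancel_left₀ hβ']
    · rw [ha, hc, initMap_right, termMap_right, sub_add_cancel]
      linear_combination -(G (m, n)) * phase_mul_neg θ n
    · rw [ha, hc, initMap_right, termMap_up, sub_add_cancel]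
      field_simp
      linear_combination -(G (m, n)) * phase_mul_neg θ m
    · have := congrArg (fun w : NodeSpace => w (m, n)) hn
      change initSum β b (m, n) - termSum θ β d (m, n) = α * G (m, n) at this
      rw [initSum_apply, termSum_apply] at this
      rw [hb, hb, hd, hd, ha, initMap_right]
      linear_combination this

end Lattice

/-! ### The spectrum of the Hamiltonian on the lattice -/

section Spectrum

theorem exists_rightInverse_of_notMem_spectrum {H : Type*} [NormedAddCommGroup H]
    [InnerProductSpace ℂ H] {A : H →L[ℂ] H} {w : ℂ} (hw : w ∉ spectrum ℂ A) :
    ∃ J : H →L[ℂ] H, ∀ x, A (J x) - w • J x = x := by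
  obtain ⟨u, hu⟩ : IsUnit (algebraMap ℂ _ w - A) := not_not.mp hw
  refine ⟨-(↑u⁻¹ : H →L[ℂ] H), fun x => ?_⟩
  have e2 : (u : H →L[ℂ] H) ((↑u⁻¹ : H →L[ℂ] H) x) = x := by
    rw [← mul_apply_eq_comp, Units.mul_inv, one_apply_eq_self]
  rw [hu] at e2
  change w • (↑u⁻¹ : H →L[ℂ] H) x - A ((↑u⁻¹ : H →L[ℂ] H) x) = x at e2
  rw [neg_apply, map_neg, smul_neg, sub_neg_eq_add, neg_add_eq_sub]
  exact e2

variable {l : ℝ} [hl : Fact (0 < l)] {v : EdgeSpace l} {θ α β : ℝ}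

/-- The function `η`. -/
def etaC (v : EdgeSpace l) (α β : ℝ) (z : ℂ) : ℂ :=
  ((1 + β ^ 2 : ℝ) : ℂ) * (u₁End' v z + u₂End v z) + α * u₁End v z

theorem etaC_eq (v : EdgeSpace l) (α β : ℝ) (z : ℂ) :
    etaC v α β z = ((1 + β ^ 2 : ℝ) : ℂ) * discC v (α / (1 + β ^ 2)) z := by
  have hβ' : ((1 + β ^ 2 : ℝ) : ℂ) ≠ 0 :=
    Complex.ofReal_ne_zero.mpr (by positivity : (0 : ℝ) < 1 + β ^ 2).ne'
  rw [etaC, discC, Complex.ofReal_div]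
  field_simp

theorem edgeRel_family_iff (z : ℂ) (x y : LatticeSpace l) (a b c d : L2Sum Edge ℂ) :
    (∀ e, EdgeRel v (x e) (y e) (a e) (b e) (c e) (d e)) ↔
      x = lpTensor (solTwo v z) a + lpTensor (solOne v z) b + lpMap (solInhom v z) (y - z • x) ∧
      c = u₂End v z • a + u₁End v z • b + lpMap (inhomEnd v z) (y - z • x) ∧
      d = u₂End' v z • a + u₁End' v z • b + lpMap (inhomEnd' v z) (y - z • x) := by
  constructor
  · intro h
    have h' := fun e => (edgeRel_iff v z _ _ _ _ _ _).mp (h e)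
    refine ⟨lp.ext (funext fun e => (h' e).1.trans ?_), lp.ext (funext fun e => (h' e).2.1),
      lp.ext (funext fun e => (h' e).2.2)⟩
    rw [← lpTensor_apply, ← lpTensor_apply]
    rfl
  · rintro ⟨h1, h2, h3⟩ e
    refine (edgeRel_iff v z _ _ _ _ _ _).mpr ⟨?_, congrArg (fun w : L2Sum Edge ℂ => w e) h2,
      congrArg (fun w : L2Sum Edge ℂ => w e) h3⟩
    rw [← lpTensor_apply, ← lpTensor_apply]
    exact congrArg (fun w : LatticeSpace l => w e) h1

/-- The defect in the condition for the derivatives at the nodes. -/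
theorem node_defect (z : ℂ) (g : NodeSpace) {b d p q : L2Sum Edge ℂ}
    (hc : termMap θ β g = u₂End v z • initMap β g + u₁End v z • b + p)
    (hd : d = u₂End' v z • initMap β g + u₁End' v z • b + q) :
    u₁End v z • (initSum β b - termSum θ β d - (α : ℂ) • g) =
      magneticLaplacian θ β g - etaC v α β z • g
        - (initSum β p - u₁End' v z • termSum θ β p + u₁End v z • termSum θ β q) := by
  have W := wronskian_eq_one v z
  have h1 := congrArg (initSum β) hc
  have h2 := congrArg (termSum θ β) hc
  have h3 := congrArg (termSum θ β) hd
  simp only [map_add, map_smul, initSum_initMap, termSum_termMap] at h1 h2 h3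
  rw [h3, ← initSum_termMap_add θ β g, h1, etaC]
  set P := initSum β p
  set Q := initSum β b
  set A := termSum θ β (initMap β g)
  set B := termSum θ β b
  set P' := termSum θ β p
  -- The Wronskian trades the coefficient `u₁ u₂'` of `A` for `u₁' u₂ - 1`. The `u₁' u₂` part is
  -- removed with `h2`, and the remaining `A` is one of the two halves of the magnetic Laplacian.
  have e : A = (u₁End' v z * u₂End v z - u₁End v z * u₂End' v z) • A := by rw [W, one_smul]
  have h4 : u₁End' v z • (((1 + β ^ 2 : ℝ) : ℂ) • g) =
      u₁End' v z • (u₂End v z • A + u₁End v z • B + P') := by rw [h2]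
  linear_combination (norm := module) h4 - e

/-- Without a source `node_defect` reads `(M - η(z)) g = 0`, also when `u₁(l; z) = 0`, and the
magnetic Laplacian has no eigenvectors. -/
theorem LatticeRel.node_eq_zero (hθ : ∃ N : ℤ, θ = N) (hβ : β ≠ 0) {z : ℂ} {x : LatticeSpace l}
    {g : NodeSpace} {b d : L2Sum Edge ℂ} (h : LatticeRel v θ α β x (z • x) g b d) : g = 0 := by
  obtain ⟨-, h2, h3⟩ := (edgeRel_family_iff z x (z • x) (initMap β g) b (termMap θ β g) d).mp h.edge
  rw [sub_self, map_zero] at h2 h3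
  have h4 := node_defect (α := α) z g h2 h3
  rw [h.node, sub_self, smul_zero, map_zero, map_zero, smul_zero, smul_zero, sub_zero, add_zero,
    sub_zero] at h4
  exact eq_zero_of_magneticLaplacian_eq hθ hβ (sub_eq_zero.mp h4.symm)

/-- Eigenvectors vanish at the nodes. -/
theorem LatticeRel.eigen (hθ : ∃ N : ℤ, θ = N) (hβ : β ≠ 0) {z : ℂ} {x : LatticeSpace l}
    {g : NodeSpace} {b d : L2Sum Edge ℂ} (h : LatticeRel v θ α β x (z • x) g b d) :
    x = lpTensor (solOne v z) b ∧ u₁End v z • b = 0 ∧ initSum β b = termSum θ β d := by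
  have hg := h.node_eq_zero hθ hβ
  subst hg
  obtain ⟨h1, h2, h3⟩ := (edgeRel_family_iff z x (z • x) (initMap β 0) b (termMap θ β 0) d).mp h.edge
  have h4 := h.node
  simp only [sub_self, map_zero, zero_add, add_zero, smul_zero, sub_eq_zero] at h1 h2 h4
  exact ⟨h1, h2.symm, h4⟩

theorem LatticeRel.u₁End_eq_zero (hθ : ∃ N : ℤ, θ = N) (hβ : β ≠ 0) {z : ℂ} {x : LatticeSpace l}
    {g : NodeSpace} {b d : L2Sum Edge ℂ} (h : LatticeRel v θ α β x (z • x) g b d) (hx : x ≠ 0) :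
    u₁End v z = 0 := by
  obtain ⟨h1, h2, -⟩ := h.eigen hθ hβ
  refine (smul_eq_zero.mp h2).resolve_right fun hb => hx ?_
  rw [h1, hb, map_zero]

/-! ### Loop states at the Dirichlet eigenvalues and the resolvent elsewhere. -/

instance : DecidableEq Dir
  | .right, .right => isTrue rfl
  | .up, .up => isTrue rfl
  | .right, .up => isFalse nofun
  | .up, .right => isFalse nofun

/-- A family of edge derivatives supported on one plaquette. -/
def loopFn (β : ℝ) (s : ℂ) : L2Sum Edge ℂ :=
  lp.single 2 (0, 0, Dir.up) 1 + lp.single 2 (0, 0, Dir.right) (-(β : ℂ))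
    + lp.single 2 (0, 1, Dir.right) (β * s) + lp.single 2 (1, 0, Dir.up) (-s)

theorem loopFn_apply (β : ℝ) (s : ℂ) (e : Edge) : loopFn β s e =
    (if e = (0, 0, .up) then 1 else 0) + (if e = (0, 0, .right) then -(β : ℂ) else 0)
      + (if e = (0, 1, .right) then β * s else 0) + if e = (1, 0, .up) then -s else 0 := by
  have key : ∀ (p q : Edge) (c : ℂ), (lp.single 2 p c : L2Sum Edge ℂ) q = if q = p then c else 0 :=
    fun p q c => by
      rw [lp.single_apply]
      by_cases h : q = p
      · subst h; simp
      · rw [if_neg h, Pi.single_eq_of_ne h]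
  rw [← key, ← key, ← key, ← key]
  rfl

theorem loopFn_ne_zero (β : ℝ) (s : ℂ) : loopFn β s ≠ 0 := fun h => by
  have h1 : loopFn β s (0, 0, .up) = 0 := by rw [h]; rfl
  rw [loopFn_apply] at h1
  simp at h1

/-- The derivatives at the terminal points are `s` times those at the initial points, and the
coefficients of the loop balance the condition at the four corners of the plaquette. At `(0, 0)`,
`(1, 0)` and `(0, 1)` no phase survives; at `(1, 1)` the balance needs `phase θ 1 = phase θ (-1)`,
which holds because `θ` is an integer. -/
theorem initSum_loopFn (hθ : ∃ N : ℤ, θ = N) (s : ℂ) :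
    initSum β (loopFn β s) = s • termSum θ β (loopFn β s) := by
  have hp : phase θ 1 = phase θ (-1) := by
    have h1 := phase_two_mul hθ 1
    rw [two_mul, phase_add] at h1
    exact mul_left_cancel₀ (phase_ne_zero θ 1) (h1.trans (phase_mul_neg θ 1).symm)
  refine lp.ext (funext fun ⟨m, n⟩ => ?_)
  change _ = s * termSum θ β (loopFn β s) (m, n)
  rw [initSum_apply, termSum_apply]
  simp only [loopFn_apply, Prod.mk.injEq, reduceCtorEq, and_false, and_true, if_false, zero_add,
    add_zero, sub_eq_zero]
  by_cases m0 : m = 0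
  · subst m0
    by_cases n0 : n = 0
    · subst n0; simp
    · by_cases n1 : n = 1
      · subst n1; simp [phase_zero]; ring
      · simp [n0, n1]
  · by_cases m1 : m = 1
    · subst m1
      by_cases n0 : n = 0
      · subst n0; simp [phase_zero, mul_comm]
      · by_cases n1 : n = 1
        · subst n1; simp [hp]; ring_nf; simp
        · simp [n0, n1]
    · simp [m0, m1]

/-- Every Dirichlet eigenvalue is an eigenvalue of the Hamiltonian on the lattice. -/
theorem exists_loop_eigenvector (hθ : ∃ N : ℤ, θ = N) (α β : ℝ) {z : ℂ} (hz : u₁End v z = 0) :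
    ∃ x : LatticeSpace l, x ≠ 0 ∧ ∃ b d, LatticeRel v θ α β x (z • x) 0 b d := by
  set b := loopFn β (u₁End' v z)
  refine ⟨lpTensor (solOne v z) b, ?_, b, u₁End' v z • b, ?_, ?_⟩
  · rw [← norm_ne_zero_iff, norm_lpTensor]
    exact mul_ne_zero (norm_ne_zero_iff.mpr (solOne_ne_zero z))
      (norm_ne_zero_iff.mpr (loopFn_ne_zero β _))
  · refine (edgeRel_family_iff z _ _ (initMap β 0) b (termMap θ β 0) _).mpr ?_
    simp [hz]
  · rw [map_smul, ← initSum_loopFn hθ, sub_self, smul_zero]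

/-- When `u₁(l; z) ≠ 0`, the initial derivatives `B y` can be solved from the node values `G y`. By
`node_defect` the remaining condition is an equation for `magneticLaplacian θ β - etaC v α β z`, and
`J` inverts it. -/
theorem exists_lattice_resolvent {z : ℂ} (hz : u₁End v z ≠ 0)
    (hs : etaC v α β z ∉ spectrum ℂ (magneticLaplacian θ β)) :
    ∃ R : LatticeSpace l →L[ℂ] LatticeSpace l, ∀ y, ∃ g b d,
      LatticeRel v θ α β (R y) (y + z • R y) g b d := by
  obtain ⟨J, hJ'⟩ := exists_rightInverse_of_notMem_spectrum hs
  set P : LatticeSpace l →L[ℂ] L2Sum Edge ℂ := lpMap (inhomEnd v z) with hP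
  set Q : LatticeSpace l →L[ℂ] L2Sum Edge ℂ := lpMap (inhomEnd' v z) with hQ
  set G : LatticeSpace l →L[ℂ] NodeSpace := J ∘L (initSum β ∘L P - u₁End' v z • (termSum θ β ∘L P)
    + u₁End v z • (termSum θ β ∘L Q)) with hG
  set B : LatticeSpace l →L[ℂ] L2Sum Edge ℂ :=
    (u₁End v z)⁻¹ • (termMap θ β ∘L G - u₂End v z • (initMap β ∘L G) - P) with hB
  set R : LatticeSpace l →L[ℂ] LatticeSpace l := lpTensor (solTwo v z) ∘L initMap β ∘L G
    + lpTensor (solOne v z) ∘L B + lpMap (solInhom v z) with hR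
  have eB : ∀ y, termMap θ β (G y) = u₂End v z • initMap β (G y) + u₁End v z • B y + P y := fun y => by
    have : B y = (u₁End v z)⁻¹ • (termMap θ β (G y) - u₂End v z • initMap β (G y) - P y) := rfl
    rw [this, smul_inv_smul₀ hz]
    abel
  refine ⟨R, fun y => ?_⟩
  set d := u₂End' v z • initMap β (G y) + u₁End' v z • B y + Q y with hd
  refine ⟨G y, B y, d, ?_, ?_⟩
  · refine (edgeRel_family_iff z _ _ (initMap β (G y)) (B y) (termMap θ β (G y)) d).mpr ?_
    rw [add_sub_cancel_right]
    exact ⟨rfl, eB y, rfl⟩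
  · have h1 := node_defect (α := α) z (G y) (eB y) hd
    have h2 := hJ' (initSum β (P y) - u₁End' v z • termSum θ β (P y)
      + u₁End v z • termSum θ β (Q y))
    have h3 : magneticLaplacian θ β (G y) - etaC v α β z • G y =
      initSum β (P y) - u₁End' v z • termSum θ β (P y) + u₁End v z • termSum θ β (Q y) := h2
    rw [h3, sub_self] at h1
    exact sub_eq_zero.mp ((smul_eq_zero.mp h1).resolve_left hz)

/-! ### Solutions with prescribed node values and Weyl sequences orthogonal to the eigenvectors. -/

/-- The solution with given values at the nodes. -/
def gammaField (v : EdgeSpace l) (θ β : ℝ) (z : ℂ) : NodeSpace →L[ℂ] LatticeSpace l :=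
  lpTensor (solTwo v z) ∘L initMap β
    + lpTensor (solOne v z) ∘L ((u₁End v z)⁻¹ • (termMap θ β - u₂End v z • initMap β))

theorem gammaField_spec (α : ℝ) {z : ℂ} (hz : u₁End v z ≠ 0) (g : NodeSpace) :
    ∃ b d : L2Sum Edge ℂ, (∀ e, EdgeRel v (gammaField v θ β z g e) ((z • gammaField v θ β z g) e)
      (initMap β g e) (b e) (termMap θ β g e) (d e)) ∧
      gammaField v θ β z g = lpTensor (solTwo v z) (initMap β g) + lpTensor (solOne v z) b ∧
      initSum β b - termSum θ β d - (α : ℂ) • g =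
        (u₁End v z)⁻¹ • (magneticLaplacian θ β g - etaC v α β z • g) := by
  set b : L2Sum Edge ℂ := (u₁End v z)⁻¹ • (termMap θ β g - u₂End v z • initMap β g) with hb
  set d : L2Sum Edge ℂ := u₂End' v z • initMap β g + u₁End' v z • b with hd
  have hc : termMap θ β g = u₂End v z • initMap β g + u₁End v z • b := by
    rw [hb, smul_inv_smul₀ hz]; abel
  refine ⟨b, d, ?_, rfl, ?_⟩
  · refine (edgeRel_family_iff z _ _ (initMap β g) b (termMap θ β g) d).mpr ?_
    simp only [sub_self, map_zero, add_zero]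
    exact ⟨rfl, hc, rfl⟩
  · have h1 := node_defect (α := α) (p := 0) (q := 0) z g (by rw [add_zero]; exact hc)
      (by rw [add_zero])
    simp only [map_zero, smul_zero, sub_zero, add_zero] at h1
    rw [← h1, inv_smul_smul₀ hz]

theorem exists_norm_le_gammaField (v : EdgeSpace l) (θ β : ℝ) {z : ℂ} (hz : u₁End v z ≠ 0) :
    ∃ C > 0, ∀ g, ‖g‖ ≤ C * ‖gammaField v θ β z g‖ := by
  obtain ⟨C, hC0, hC⟩ := exists_norm_initial_le v z
  refine ⟨C, hC0, fun g => (norm_le_norm_initMap β g).trans ?_⟩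
  obtain ⟨b, d, -, h, -⟩ := gammaField_spec (θ := θ) (β := β) 0 hz g
  rw [h]
  refine norm_le_of_forall_le _ _ hC0.le fun e => ?_
  change _ ≤ C * ‖lpTensor (solTwo v z) (initMap β g) e + lpTensor (solOne v z) b e‖
  rw [lpTensor_apply, lpTensor_apply]
  exact (hC _ _).1

theorem inner_sub_inner_family (hv : IsRealPotential v) {x y x' y' : LatticeSpace l}
    {a b c d a' b' c' d' : L2Sum Edge ℂ}
    (h : ∀ e, EdgeRel v (x e) (y e) (a e) (b e) (c e) (d e))
    (h' : ∀ e, EdgeRel v (x' e) (y' e) (a' e) (b' e) (c' e) (d' e)) :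
    inner ℂ y x' - inner ℂ x y' = (inner ℂ c d' - inner ℂ d c') - (inner ℂ a b' - inner ℂ b a') := by
  have h1 : HasSum (fun e => inner ℂ (y e) (x' e)) (inner ℂ y x') := lp.hasSum_inner y x'
  have h2 : HasSum (fun e => inner ℂ (x e) (y' e)) (inner ℂ x y') := lp.hasSum_inner x y'
  have h3 : ∀ f f' : L2Sum Edge ℂ, HasSum (fun e => (starRingEnd ℂ) (f e) * f' e) (inner ℂ f f') :=
    fun f f' => (lp.hasSum_inner f f').congr_fun fun e => by rw [RCLike.inner_apply, mul_comm]
  have h4 := ((h3 c d').sub (h3 d c')).sub ((h3 a b').sub (h3 b a'))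
  exact (h1.sub h2).unique (h4.congr_fun fun e => (h e).inner_sub_inner v hv (h' e))

/-- In Green's formula the terms with node values of the eigenvector vanish, and the others cancel
because its derivatives satisfy `initSum β b = termSum θ β d`. What remains is `(w - z)` times the
inner product, and `w ≠ z` since `w` is a zero of `u₁(l; ·)` and `z` is not. -/
theorem inner_gammaField_eq_zero (hv : IsRealPotential v) (hθ : ∃ N : ℤ, θ = N) (hβ : β ≠ 0)
    {z : ℂ} (hz : u₁End v z ≠ 0) (f : NodeSpace) {w : ℂ} {x : LatticeSpace l} {g : NodeSpace}
    {b d : L2Sum Edge ℂ} (h : LatticeRel v θ α β x (w • x) g b d) :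
    inner ℂ x (gammaField v θ β z f) = 0 := by
  by_cases hx : x = 0
  · rw [hx, inner_zero_left]
  have hw := h.u₁End_eq_zero hθ hβ hx
  have hwr := conj_eq_of_u₁End_eq_zero hv hw
  have hg := h.node_eq_zero hθ hβ
  obtain ⟨-, -, hn⟩ := h.eigen hθ hβ
  subst hg
  obtain ⟨b', d', h', -, -⟩ := gammaField_spec (θ := θ) (β := β) 0 hz f
  have h1 := inner_sub_inner_family hv h.edge h'
  have h2 : inner ℂ d (termMap θ β f) = inner ℂ b (initMap β f) := by
    rw [← inner_conj_symm, inner_termMap, ← hn, ← inner_initMap, inner_conj_symm]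
  rw [map_zero, map_zero, inner_zero_left, inner_zero_left, h2, inner_smul_left, inner_smul_right,
    hwr, ← sub_mul] at h1
  have h3 : (w - z) * inner ℂ x (gammaField v θ β z f) = 0 := by rw [h1]; ring
  refine (mul_eq_zero.mp h3).resolve_left fun h4 => hz ?_
  rw [← sub_eq_zero.mp h4, hw]

theorem edgeRel_family_sub {x y x' y' : LatticeSpace l} {a b c d a' b' c' d' : L2Sum Edge ℂ}
    (h : ∀ e, EdgeRel v (x e) (y e) (a e) (b e) (c e) (d e))
    (h' : ∀ e, EdgeRel v (x' e) (y' e) (a' e) (b' e) (c' e) (d' e)) (e : Edge) :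
    EdgeRel v ((x - x') e) ((y - y') e) ((a - a') e) ((b - b') e) ((c - c') e) ((d - d') e) := by
  have h3 := (h e).add v ((h' e).smul v (-1))
  simp only [neg_one_smul, neg_one_mul, ← sub_eq_add_neg] at h3
  exact h3

/-- A single `gammaField` violates the derivative condition by a multiple of `(M - η(z)) g`.
Subtracting one for another spectral parameter with the same defect gives an element of the domain,
and both terms stay orthogonal to the eigenvectors. -/
theorem latticeRel_gammaField_sub {z z' : ℂ} (hz : u₁End v z ≠ 0) (hz' : u₁End v z' ≠ 0)
    {g g' : NodeSpace} (h : magneticLaplacian θ β g' - etaC v α β z' • g' =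
      (u₁End v z' / u₁End v z) • (magneticLaplacian θ β g - etaC v α β z • g)) :
    ∃ b d, LatticeRel v θ α β (gammaField v θ β z g - gammaField v θ β z' g')
      (z • gammaField v θ β z g - z' • gammaField v θ β z' g') (g - g') b d := by
  obtain ⟨b, d, h1, -, h2⟩ := gammaField_spec (θ := θ) (β := β) α hz g
  obtain ⟨b', d', h1', -, h2'⟩ := gammaField_spec (θ := θ) (β := β) α hz' g'
  refine ⟨b - b', d - d', fun e => ?_, ?_⟩
  · rw [map_sub, map_sub]
    exact edgeRel_family_sub h1 h1' e
  · rw [h, smul_smul, inv_mul_eq_div, div_div_cancel_left' hz'] at h2'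
    rw [map_sub, map_sub, smul_sub, ← sub_eq_zero]
    have h4 := sub_eq_zero.mpr (h2.trans h2'.symm)
    rw [← h4]
    abel

/-- A reference point for the correction: far to the left `u₁(l; ·)` is positive and the
discriminant exceeds `2`. -/
theorem exists_real_regular (hv : IsRealPotential v) (θ α β : ℝ) :
    ∃ X : ℝ, u₁End v X ≠ 0 ∧ etaC v α β X ∉ spectrum ℂ (magneticLaplacian θ β) := by
  obtain ⟨X, hX⟩ := exists_forall_left (v := v) (α / (1 + β ^ 2))
  obtain ⟨hX1, hX2⟩ := hX X le_rfl
  have hκ : 0 < 1 + β ^ 2 := by positivity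
  refine ⟨X, ?_, fun h => ?_⟩
  · rw [← ofReal_dirichletFn hv]
    exact Complex.ofReal_ne_zero.mpr hX1.ne'
  · obtain ⟨r, hr, h⟩ := mem_spectrum_magneticLaplacian h
    rw [etaC_eq, ← ofReal_disc hv, ← Complex.ofReal_mul] at h
    rw [← Complex.ofReal_injective h, abs_mul, abs_of_pos hκ] at hr
    have := le_abs_self (disc v (α / (1 + β ^ 2)) X)
    nlinarith

/-- Small corrections turn the solutions with given values at the nodes into elements of the
domain. -/
theorem exists_correction (hv : IsRealPotential v) (hθ : ∃ N : ℤ, θ = N) (hβ : β ≠ 0) {z : ℂ}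
    (hz : u₁End v z ≠ 0) : ∃ (T : NodeSpace →L[ℂ] LatticeSpace l) (X : ℂ), ∀ g q : NodeSpace,
      q = magneticLaplacian θ β g - etaC v α β z • g →
      (∃ f b d, LatticeRel v θ α β (gammaField v θ β z g - T q)
        (z • gammaField v θ β z g - X • T q) f b d) ∧
      ∀ (w : ℂ) (e : LatticeSpace l) f b d, LatticeRel v θ α β e (w • e) f b d →
        inner ℂ e (gammaField v θ β z g) = 0 ∧ inner ℂ e (T q) = 0 := by
  obtain ⟨X, hz', hs'⟩ := exists_real_regular (v := v) hv θ α β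
  obtain ⟨J, hJ⟩ := exists_rightInverse_of_notMem_spectrum hs'
  refine ⟨gammaField v θ β X ∘L ((u₁End v X / u₁End v z) • J), X, fun g q hq => ⟨?_, ?_⟩⟩
  · obtain ⟨b, d, h⟩ := latticeRel_gammaField_sub (θ := θ) (α := α) (β := β) hz hz' (g := g)
      (g' := (u₁End v X / u₁End v z) • J q) (by
        rw [map_smul, smul_comm (etaC v α β X), ← smul_sub, hJ, hq])
    exact ⟨_, b, d, h⟩
  · intro w e f b d he
    exact ⟨inner_gammaField_eq_zero hv hθ hβ hz g he, inner_gammaField_eq_zero hv hθ hβ hz' _ he⟩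

/-- Approximate eigenvectors of the Hamiltonian on the lattice that are orthogonal to all its
eigenvectors. -/
theorem exists_lattice_approx (hv : IsRealPotential v) (hθ : ∃ N : ℤ, θ = N) (hβ : β ≠ 0) {z : ℂ}
    (hz : u₁End v z ≠ 0) (hs : etaC v α β z ∈ spectrum ℂ (magneticLaplacian θ β)) {ε : ℝ}
    (hε : 0 < ε) : ∃ x y : LatticeSpace l, x ≠ 0 ∧ ‖y - z • x‖ ≤ ε * ‖x‖ ∧
      (∃ g b d, LatticeRel v θ α β x y g b d) ∧
      ∀ (w : ℂ) (e : LatticeSpace l) g b d, LatticeRel v θ α β e (w • e) g b d →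
        inner ℂ e x = 0 ∧ inner ℂ e y = 0 := by
  obtain ⟨r, hr, hzr⟩ := mem_spectrum_magneticLaplacian hs
  obtain ⟨C, hC0, hC⟩ := exists_norm_le_gammaField v θ β hz
  obtain ⟨T, X, hT⟩ := exists_correction (α := α) hv hθ hβ hz
  obtain ⟨K, hK0, hK1, hK2⟩ : ∃ K : ℝ, 0 < K ∧ ‖T‖ ≤ K ∧ ‖z - X‖ * ‖T‖ ≤ K := by
    have h1 := norm_nonneg T
    have h2 := mul_nonneg (norm_nonneg (z - X)) h1
    exact ⟨‖T‖ + ‖z - X‖ * ‖T‖ + 1, by linarith, by linarith, by linarith⟩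
  -- The first bound keeps the correction `T q` from using up more than half of the lower bound for
  -- the main term; the second makes the residual `(z - X) • T q` at most `ε` times the norm.
  obtain ⟨δ, hδ0, hδ1, hδ2⟩ : ∃ δ : ℝ, 0 < δ ∧ δ * (2 * C * K) ≤ 1 ∧ δ * (2 * C * K) ≤ ε := by
    refine ⟨min 1 ε / (2 * C * K), by positivity, ?_, ?_⟩
    · rw [div_mul_cancel₀ _ (by positivity)]; exact min_le_left _ _
    · rw [div_mul_cancel₀ _ (by positivity)]; exact min_le_right _ _
  obtain ⟨g, hg0, hg⟩ := exists_approx_eigenvector hθ hr hδ0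
  rw [← hzr] at hg
  have hgn : 0 < ‖g‖ := norm_pos_iff.mpr hg0
  obtain ⟨q, hq⟩ : ∃ q, q = magneticLaplacian θ β g - etaC v α β z • g := ⟨_, rfl⟩
  rw [← hq] at hg
  obtain ⟨h1, h2⟩ := hT g q hq
  have hTn : ‖T q‖ ≤ ‖T‖ * (δ * ‖g‖) := (T.le_opNorm q).trans (by gcongr)
  have hxn : ‖g‖ ≤ 2 * C * ‖gammaField v θ β z g - T q‖ := by
    have e1 : ‖gammaField v θ β z g‖ ≤ ‖gammaField v θ β z g - T q‖ + ‖T q‖ := by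
      simpa using norm_add_le (gammaField v θ β z g - T q) (T q)
    have e2 : C * (‖T‖ * (δ * ‖g‖)) ≤ ‖g‖ / 2 := by
      calc C * (‖T‖ * (δ * ‖g‖)) ≤ C * (K * (δ * ‖g‖)) := by gcongr
        _ = δ * (2 * C * K) * ‖g‖ / 2 := by ring
        _ ≤ 1 * ‖g‖ / 2 := by gcongr
        _ = _ := by ring
    have e3 := hC g
    nlinarith
  refine ⟨_, _, fun h => ?_, ?_, h1, fun w e f b d he => ?_⟩
  · rw [h, norm_zero, mul_zero] at hxn
    linarith
  · have e1 : z • gammaField v θ β z g - X • T q - z • (gammaField v θ β z g - T q)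
        = (z - X) • T q := by module
    rw [e1, norm_smul]
    calc ‖z - X‖ * ‖T q‖ ≤ ‖z - X‖ * (‖T‖ * (δ * ‖g‖)) := by gcongr
      _ = ‖z - X‖ * ‖T‖ * δ * ‖g‖ := by ring
      _ ≤ K * δ * (2 * C * ‖gammaField v θ β z g - T q‖) := by gcongr
      _ = δ * (2 * C * K) * ‖gammaField v θ β z g - T q‖ := by ring
      _ ≤ ε * ‖gammaField v θ β z g - T q‖ := by gcongr
  · obtain ⟨e1, e2⟩ := h2 w e f b d he
    rw [inner_sub_right, inner_sub_right, inner_smul_right, inner_smul_right, e1, e2]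
    simp

/-! ### The spectra -/

variable {V : ℝ → ℝ}

theorem isEigenvalue_latticeOp_of_zero (hvV : v =ᵐ[edgeMeasure l] fun t => (V t : ℂ))
    (hθ : ∃ N : ℤ, θ = N) (α : ℝ) (hβ : β ≠ 0) {z : ℂ} (hz : u₁End v z = 0) :
    IsEigenvalue (latticeOp l V θ α β) z := by
  rw [isEigenvalue_iff_graph, latticeOp_graph hl.out]
  obtain ⟨x, hx, b, d, h⟩ := exists_loop_eigenvector (v := v) hθ α β hz
  exact ⟨x, hx, (mem_latticeGraph_iff hvV θ α hβ _ _).mpr ⟨0, b, d, h⟩⟩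

theorem mem_spec_of_isEigenvalue {E : Type*} [NormedAddCommGroup E] [InnerProductSpace ℂ E]
    {T : E →ₗ.[ℂ] E} {z : ℂ} (h : IsEigenvalue T z) : z ∈ spec T := by
  obtain ⟨x, hx, h⟩ := (isEigenvalue_iff_graph T z).mp h
  refine mem_spec_of_approx fun ε hε => ⟨x, z • x, h, hx, ?_⟩
  rw [sub_self, norm_zero]
  positivity

theorem mem_sigmaPart_iff_etaC (hvV : v =ᵐ[edgeMeasure l] fun t => (V t : ℂ)) (z : ℂ) :
    z ∈ sigmaPart l V θ α β ↔ etaC v α β z ∈ spectrum ℂ (magneticLaplacian θ β) := by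
  have : eta l V α β z = etaC v α β z := by rw [eta_eq v hvV, etaC]; push_cast; ring
  rw [← this]
  rfl

/-- The spectrum of the Hamiltonian on the lattice. -/
theorem spec_latticeOp (hv : IsRealPotential v) (hvV : v =ᵐ[edgeMeasure l] fun t => (V t : ℂ))
    (hθ : ∃ N : ℤ, θ = N) (α : ℝ) (hβ : β ≠ 0) :
    spec (latticeOp l V θ α β) = sigmaPart l V θ α β ∪ {z | u₁End v z = 0} := by
  have hgr := latticeOp_graph hl.out V θ α β
  refine Set.Subset.antisymm (fun z hz => ?_) (fun z hz => ?_)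
  · by_contra hcon
    simp only [Set.mem_union, Set.mem_ofPred_eq, not_or] at hcon
    obtain ⟨h1, h2⟩ := hcon
    rw [mem_sigmaPart_iff_etaC hvV] at h1
    obtain ⟨R, hR⟩ := exists_lattice_resolvent h2 h1
    refine hz (mem_resolventSet_of_graph R (fun y => ?_) fun x hx => ?_)
    · rw [hgr]
      exact (mem_latticeGraph_iff hvV θ α hβ _ _).mpr (hR y)
    · rw [hgr] at hx
      obtain ⟨g, b, d, h⟩ := (mem_latticeGraph_iff hvV θ α hβ _ _).mp hx
      by_contra hx0
      exact h2 (h.u₁End_eq_zero hθ hβ hx0)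
  · by_cases h0 : u₁End v z = 0
    · exact mem_spec_of_isEigenvalue (isEigenvalue_latticeOp_of_zero hvV hθ α hβ h0)
    · have h1 := (mem_sigmaPart_iff_etaC hvV z).mp (hz.resolve_right h0)
      refine mem_spec_of_approx fun ε hε => ?_
      obtain ⟨x, y, hx, hle, h, -⟩ := exists_lattice_approx hv hθ hβ h0 h1 hε
      refine ⟨x, y, ?_, hx, hle⟩
      rw [hgr]
      exact (mem_latticeGraph_iff hvV θ α hβ _ _).mpr h

theorem partIn_graph {E : Type*} [NormedAddCommGroup E] [InnerProductSpace ℂ E] (T : E →ₗ.[ℂ] E)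
    (K : Submodule ℂ E) : (partIn T K).graph = T.graph.comap (K.subtype.prodMap K.subtype) := by
  refine Submodule.toLinearPMap_graph_eq _ ?_
  rintro ⟨x, y⟩ h rfl
  exact Subtype.ext (T.graph_fst_eq_zero_snd h rfl)

/-- Points of accumulation of `Σ` outside the Dirichlet spectrum are in the continuous spectrum. -/
theorem mem_continuousSpec_latticeOp (hv : IsRealPotential v)
    (hvV : v =ᵐ[edgeMeasure l] fun t => (V t : ℂ)) (hθ : ∃ N : ℤ, θ = N) (α : ℝ) (hβ : β ≠ 0)
    {w : ℂ} (hw : ∀ ε > 0, ∃ z ∈ sigmaPart l V θ α β, u₁End v z ≠ 0 ∧ ‖z - w‖ < ε) :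
    w ∈ continuousSpec (latticeOp l V θ α β) := by
  have hgr := latticeOp_graph hl.out V θ α β
  refine mem_spec_of_approx fun ε hε => ?_
  obtain ⟨z, hz, hz0, hzw⟩ := hw (ε / 2) (half_pos hε)
  obtain ⟨x, y, hx, hle, h, ho⟩ := exists_lattice_approx hv hθ hβ hz0
    ((mem_sigmaPart_iff_etaC hvV z).mp hz) (half_pos hε)
  have hK : ∀ f : LatticeSpace l, (∀ (w : ℂ) (e : LatticeSpace l) g b d,
      LatticeRel v θ α β e (w • e) g b d → inner ℂ e f = 0) →
      f ∈ (eigenSpan (latticeOp l V θ α β))ᗮ := fun f hf => by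
    rw [Submodule.mem_orthogonal]
    intro e he
    refine Submodule.span_induction (p := fun e _ => inner ℂ e f = 0) ?_ (inner_zero_left f)
      (fun a b _ _ ha hb => by rw [inner_add_left, ha, hb, add_zero])
      (fun c a _ ha => by rw [inner_smul_left, ha, mul_zero]) he
    rintro e ⟨c, hd, hc⟩
    have h1 : (e, c • e) ∈ (latticeOp l V θ α β).graph := by
      rw [← hc]
      exact (latticeOp l V θ α β).mem_graph ⟨e, hd⟩
    rw [hgr] at h1
    obtain ⟨g, b, d, h1⟩ := (mem_latticeGraph_iff hvV θ α hβ _ _).mp h1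
    exact hf c e g b d h1
  refine ⟨⟨x, hK x fun w e g b d h => (ho w e g b d h).1⟩,
    ⟨y, hK y fun w e g b d h => (ho w e g b d h).2⟩, ?_, fun h0 => hx (congrArg Subtype.val h0), ?_⟩
  · rw [partIn_graph, hgr]
    exact (mem_latticeGraph_iff hvV θ α hβ x y).mpr h
  · change ‖y - w • x‖ ≤ ε * ‖x‖
    have e1 : y - w • x = (y - z • x) + (z - w) • x := by module
    rw [e1]
    refine (norm_add_le _ _).trans ?_
    rw [norm_smul]
    have := mul_le_mul_of_nonneg_right hzw.le (norm_nonneg x)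
    linarith

end Spectrum

/-! ### Gaps and band edges of closed sets of real numbers -/

section Gaps

open Filter Topology

/-- The gap runs from the last point of `S` before `x` to the first one after it; both exist by
compactness, and the points `p`, `q` confine it. -/
theorem exists_isGap_of_notMem {S : Set ℝ} (hS : IsClosed S) {p x q : ℝ} (hp : p ∈ S) (hq : q ∈ S)
    (hpx : p < x) (hxq : x < q) (hx : x ∉ S) :
    ∃ a b, IsGap S a b ∧ p ≤ a ∧ a < x ∧ x < b ∧ b ≤ q := by
  obtain ⟨a, ⟨ha1, ha2⟩, ha3⟩ := (isCompact_Icc.inter_left hS (t := Set.Icc p x)).exists_isGreatest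
    ⟨p, hp, le_rfl, hpx.le⟩
  obtain ⟨b, ⟨hb1, hb2⟩, hb3⟩ := (isCompact_Icc.inter_left hS (t := Set.Icc x q)).exists_isLeast
    ⟨q, hq, hxq.le, le_rfl⟩
  have hax : a < x := lt_of_le_of_ne ha2.2 fun h => hx (h ▸ ha1)
  have hxb : x < b := lt_of_le_of_ne hb2.1 fun h => hx (h ▸ hb1)
  refine ⟨a, b, ⟨hax.trans hxb, ha1, hb1, fun y hay hyb hy => ?_⟩, ha2.1, hax, hxb, hb2.2⟩
  rcases le_total y x with h | h
  · exact absurd (ha3 ⟨hy, ha2.1.trans hay.le, h⟩) (not_le.mpr hay)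
  · exact absurd (hb3 ⟨hy, h, hyb.le.trans hb2.2⟩) (not_le.mpr hyb)

theorem exists_isGap_right {S : Set ℝ} (hS : IsClosed S) {x q : ℝ} (hx : x ∈ S) (hq : q ∈ S)
    (hxq : x < q) (h : ∀ᶠ y in 𝓝[>] x, y ∉ S) : ∃ b, IsGap S x b := by
  obtain ⟨u, hu1, hu2⟩ := (mem_nhdsGT_iff_exists_Ioo_subset' hxq).mp h
  have hxu : x < min u q := lt_min hu1 hxq
  obtain ⟨y, hy1, hy2⟩ := exists_between hxu
  obtain ⟨a, b, hab, h1, h2, -, -⟩ := exists_isGap_of_notMem hS hx hq hy1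
    (hy2.trans_le (min_le_right _ _)) (hu2 ⟨hy1, hy2.trans_le (min_le_left _ _)⟩)
  rcases h1.eq_or_lt with rfl | h1
  · exact ⟨b, hab⟩
  · exact absurd hab.2.1 (hu2 ⟨h1, h2.trans (hy2.trans_le (min_le_left _ _))⟩)

theorem exists_isGap_left {S : Set ℝ} (hS : IsClosed S) {x p : ℝ} (hx : x ∈ S) (hp : p ∈ S)
    (hpx : p < x) (h : ∀ᶠ y in 𝓝[<] x, y ∉ S) : ∃ a, IsGap S a x := by
  obtain ⟨u, hu1, hu2⟩ := (mem_nhdsLT_iff_exists_Ioo_subset' hpx).mp h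
  have hux : max u p < x := max_lt hu1 hpx
  obtain ⟨y, hy1, hy2⟩ := exists_between hux
  obtain ⟨a, b, hab, -, -, h1, h2⟩ := exists_isGap_of_notMem hS hp hx
    ((le_max_right _ _).trans_lt hy1) hy2 (hu2 ⟨(le_max_left _ _).trans_lt hy1, hy2⟩)
  rcases h2.eq_or_lt with rfl | h2
  · exact ⟨a, hab⟩
  · exact absurd hab.2.2.1 (hu2 ⟨((le_max_left _ _).trans_lt hy1).trans h1, h2⟩)

/-- With nonzero derivative `D` crosses the level `±2` strictly, so `|D| ≤ 2` holds on exactly one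
side near `x`. The level `-2` is reduced to `2` by passing to `-D`. -/
theorem isBandEdge_of_hasDerivAt {D : ℝ → ℝ} (hD : Continuous D) {x c : ℝ} (h : HasDerivAt D c x)
    (hc : c ≠ 0) (hx : |D x| = 2) : IsBandEdge {y | |D y| ≤ 2} x := by
  have key : ∀ {D : ℝ → ℝ} {c : ℝ}, Continuous D → HasDerivAt D c x → c ≠ 0 → D x = 2 →
      IsBandEdge {y | |D y| ≤ 2} x := by
    intro D c hD h hc hx
    have h1 : ∀ᶠ y in 𝓝 x, -2 < D y := hD.continuousAt.eventually (lt_mem_nhds (by linarith))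
    rcases lt_or_gt_of_ne hc with hc | hc
    · obtain ⟨ε, hε, hb⟩ := Metric.eventually_nhds_iff_ball.mp
        (h1.and (eventually_gt_of_hasDerivAt_neg h hc))
      refine ⟨ε, hε, Or.inl (Set.ext fun y => ?_)⟩
      rw [Real.ball_eq_Ioo] at hb
      constructor
      · rintro ⟨hy1, hy2⟩
        refine ⟨?_, hy2.2⟩
        by_contra hlt
        have := (hb y hy2).2.2 (not_le.mp hlt)
        have h3 : |D y| ≤ 2 := hy1
        linarith [(abs_le.mp h3).2]
      · rintro ⟨hy1, hy2⟩
        have hy : y ∈ Set.Ioo (x - ε) (x + ε) := ⟨by linarith, hy2⟩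
        refine ⟨abs_le.mpr ⟨(hb y hy).1.le, ?_⟩, hy⟩
        rcases hy1.eq_or_lt with rfl | hy1
        · exact hx.le
        · linarith [(hb y hy).2.1 hy1]
    · obtain ⟨ε, hε, hb⟩ := Metric.eventually_nhds_iff_ball.mp
        (h1.and (eventually_lt_of_hasDerivAt_pos h hc))
      refine ⟨ε, hε, Or.inr (Set.ext fun y => ?_)⟩
      rw [Real.ball_eq_Ioo] at hb
      constructor
      · rintro ⟨hy1, hy2⟩
        refine ⟨hy2.1, ?_⟩
        by_contra hlt
        have := (hb y hy2).2.1 (not_le.mp hlt)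
        have h3 : |D y| ≤ 2 := hy1
        linarith [(abs_le.mp h3).2]
      · rintro ⟨hy1, hy2⟩
        have hy : y ∈ Set.Ioo (x - ε) (x + ε) := ⟨hy1, by linarith⟩
        refine ⟨abs_le.mpr ⟨(hb y hy).1.le, ?_⟩, hy⟩
        rcases hy2.eq_or_lt with rfl | hy2
        · exact hx.le
        · linarith [(hb y hy).2.2 hy2]
  rcases (abs_eq zero_le_two).mp hx with h2 | h2
  · exact key hD h hc h2
  · have := key hD.neg h.neg (neg_ne_zero.mpr hc) (by simp [h2])
    simpa using this

theorem IsBandEdge.frequently {S : Set ℝ} {x : ℝ} (h : IsBandEdge S x) : ∃ᶠ y in 𝓝[≠] x, y ∈ S := by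
  obtain ⟨ε, hε, h | h⟩ := h
  · have h1 : ∀ᶠ y in 𝓝[>] x, y ∈ S := by
      filter_upwards [Ioo_mem_nhdsGT (by linarith : x < x + ε)] with y hy
      exact (h.superset ⟨hy.1.le, hy.2⟩).1
    exact h1.frequently.filter_mono (nhdsWithin_mono x fun y hy => ne_of_gt hy)
  · have h1 : ∀ᶠ y in 𝓝[<] x, y ∈ S := by
      filter_upwards [Ioo_mem_nhdsLT (by linarith : x - ε < x)] with y hy
      exact (h.superset ⟨hy.1, hy.2.le⟩).1
    exact h1.frequently.filter_mono (nhdsWithin_mono x fun y hy => ne_of_lt hy)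

theorem IsBandEdge.union {S Z : Set ℝ} {x : ℝ} (h : IsBandEdge S x) (hZ : ∀ᶠ y in 𝓝[≠] x, y ∉ Z) :
    IsBandEdge (S ∪ Z) x := by
  obtain ⟨ε, hε, h⟩ := h
  obtain ⟨δ, hδ, hb⟩ := Metric.eventually_nhds_iff_ball.mp (eventually_nhdsWithin_iff.mp hZ)
  rw [Real.ball_eq_Ioo] at hb
  have hm1 := min_le_left ε δ
  have hm2 := min_le_right ε δ
  have hm0 : 0 < min ε δ := lt_min hε hδ
  set m := min ε δ
  have hx : x ∈ S := by
    rcases h with h | h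
    · exact (h.superset ⟨le_rfl, by linarith⟩).1
    · exact (h.superset ⟨by linarith, le_rfl⟩).1
  have hSZ : ∀ y ∈ Set.Ioo (x - m) (x + m), y ∈ S ∪ Z → y ∈ S := by
    rintro y hy (h1 | h1)
    · exact h1
    · by_cases hyx : y = x
      · exact hyx ▸ hx
      · exact absurd h1 (hb y ⟨by linarith [hy.1], by linarith [hy.2]⟩ hyx)
  refine ⟨m, hm0, h.imp (fun h => Set.ext fun y => ?_) fun h => Set.ext fun y => ?_⟩
  · constructor
    · rintro ⟨h1, h2⟩
      exact ⟨(h.subset ⟨hSZ y h2 h1, by linarith [h2.1], by linarith [h2.2]⟩).1, h2.2⟩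
    · rintro ⟨h1, h2⟩
      exact ⟨Or.inl (h.superset ⟨h1, by linarith⟩).1, by linarith, h2⟩
  · constructor
    · rintro ⟨h1, h2⟩
      exact ⟨h2.1, (h.subset ⟨hSZ y h2 h1, by linarith [h2.1], by linarith [h2.2]⟩).2⟩
    · rintro ⟨h1, h2⟩
      exact ⟨Or.inl (h.superset ⟨by linarith, h2⟩).1, h1, by linarith⟩

/-- Each gap of `S` is cut at the first point of `Z` inside it, keeping the left end point. Since a
gap is determined by its left end point, distinct gaps of `S` give distinct gaps of the union. -/
theorem HasInfinitelyManyGaps.union {S Z : Set ℝ} (h : HasInfinitelyManyGaps S)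
    (hZ : ∀ b, (Z ∩ Set.Iic b).Finite) : HasInfinitelyManyGaps (S ∪ Z) := by
  have key : ∀ p : ℝ × ℝ, IsGap S p.1 p.2 → ∃ b, IsGap (S ∪ Z) p.1 b := by
    rintro ⟨a, b⟩ ⟨hab, ha, hb, hg⟩
    have hfin : (insert b (Z ∩ Set.Ioc a b)).Finite :=
      ((hZ b).subset fun x hx => ⟨hx.1, hx.2.2⟩).insert b
    obtain ⟨c, hc, hmin⟩ := hfin.exists_minimal ⟨b, Set.mem_insert _ _⟩
    have hmin' : ∀ y ∈ insert b (Z ∩ Set.Ioc a b), c ≤ y := fun y hy =>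
      (le_total c y).elim id fun h => hmin hy h
    have hca : a < c := by
      rcases hc with rfl | hc
      · exact hab
      · exact hc.2.1
    have hcb : c ≤ b := hmin' b (Set.mem_insert _ _)
    refine ⟨c, hca, Or.inl ha, ?_, fun y hay hyc hy => ?_⟩
    · rcases hc with rfl | hc
      · exact Or.inl hb
      · exact Or.inr hc.1
    · rcases hy with hy | hy
      · exact hg y hay (hyc.trans_le hcb) hy
      · exact absurd (hmin' y (Or.inr ⟨hy, hay, hyc.le.trans hcb⟩)) (not_le.mpr hyc)
  choose! f hf using key
  refine Set.infinite_of_injOn_mapsTo (f := fun p : ℝ × ℝ => (p.1, f p)) ?_ (fun p hp => hf p hp) h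
  rintro ⟨a, b⟩ hp ⟨a', b'⟩ hp' heq
  have ha : a = a' := (Prod.ext_iff.mp heq).1
  subst ha
  obtain ⟨h1, h2, h3, h4⟩ := hp
  obtain ⟨h1', h2', h3', h4'⟩ := hp'
  simp only at h1 h2 h3 h4 h1' h2' h3' h4'
  have : b = b' := le_antisymm (not_lt.mp fun h => h4 b' h1' h h3') (not_lt.mp fun h => h4' b h1 h h3)
  rw [this]

end Gaps

/-! ### The discriminant at the Dirichlet eigenvalues -/

section Discriminant

open Filter Topology

variable {l : ℝ} [hl : Fact (0 < l)] {v : EdgeSpace l} {V : ℝ → ℝ}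

theorem isClosed_abs_disc_le (v : EdgeSpace l) (a : ℝ) : IsClosed {x | |disc v a x| ≤ 2} :=
  isClosed_le (continuous_disc v a).abs continuous_const

theorem realSpec_kronigPenneyOp (hv : IsRealPotential v)
    (hvV : v =ᵐ[edgeMeasure l] fun t => (V t : ℂ)) (α β : ℝ) :
    realSpec (kronigPenneyOp l V α β) = {x | |disc v (α / (1 + β ^ 2)) x| ≤ 2} := by
  ext x
  change (x : ℂ) ∈ spec (kronigPenneyOp l V α β) ↔ |disc v (α / (1 + β ^ 2)) x| ≤ 2
  rw [mem_spec_kronigPenneyOp_iff hvV, ← ofReal_disc hv]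
  constructor
  · rintro ⟨r, hr, h⟩
    rwa [Complex.ofReal_injective h]
  · exact fun h => ⟨_, h, rfl⟩

theorem realSpec_latticeOp (hv : IsRealPotential v)
    (hvV : v =ᵐ[edgeMeasure l] fun t => (V t : ℂ)) {θ : ℝ} (hθ : ∃ N : ℤ, θ = N) (α : ℝ) {β : ℝ}
    (hβ : β ≠ 0) : realSpec (latticeOp l V θ α β) =
      {x | |disc v (α / (1 + β ^ 2)) x| ≤ 2} ∪ {x | dirichletFn v x = 0} := by
  ext x
  change (x : ℂ) ∈ spec (latticeOp l V θ α β) ↔ |disc v (α / (1 + β ^ 2)) x| ≤ 2 ∨ dirichletFn v x = 0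
  rw [spec_latticeOp hv hvV hθ α hβ]
  change (x : ℂ) ∈ sigmaPart l V θ α β ∨ u₁End v x = 0 ↔ _
  rw [mem_sigmaPart_iff hvV hθ, ← ofReal_disc hv, ← ofReal_dirichletFn hv, Complex.ofReal_eq_zero]
  refine or_congr_left ⟨?_, fun h => ⟨_, h, rfl⟩⟩
  rintro ⟨r, hr, h⟩
  rwa [Complex.ofReal_injective h]

theorem two_le_abs_disc (hv : IsRealPotential v) {x : ℝ} (a : ℝ) (hx : dirichletFn v x = 0) :
    2 ≤ |disc v a x| := by
  rcases disc_zero_cases hv a hx with h | h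
  · exact h.2.trans (le_abs_self _)
  · rw [abs_of_nonpos (by linarith [h.2])]; linarith [h.2]

theorem eventually_dirichletFn_ne_zero (hv : IsRealPotential v) {x : ℝ} (hx : dirichletFn v x = 0) :
    ∀ᶠ y in 𝓝[≠] x, dirichletFn v y ≠ 0 := by
  have := (hasDerivAt_dirichletFn v x).eventually_ne (c := 0) (dirichletFn'_ne_zero hv hx)
  exact this

/-- If the discriminant exceeds `2` in modulus at a Dirichlet eigenvalue, it lies in an open gap. -/
theorem exists_gap_of_two_lt (hv : IsRealPotential v)
    (hvV : v =ᵐ[edgeMeasure l] fun t => (V t : ℂ)) (a : ℝ) :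
    ∃ p : ℕ → ℝ, StrictMono p ∧ ∀ k, 2 < |disc v a (dirichletEigenvalue l V k)| →
      ∃ A B, IsGap {x | |disc v a x| ≤ 2} A B ∧ p k ≤ A ∧ A < dirichletEigenvalue l V k ∧
        dirichletEigenvalue l V k < B ∧ B ≤ p (k + 1) := by
  obtain ⟨p, hp⟩ := exists_interlacing hv hvV a
  have hp0 : ∀ k, p k ∈ {x | |disc v a x| ≤ 2} := fun k => by
    change |disc v a (p k)| ≤ 2
    rw [(hp k).2.2, abs_zero]
    exact zero_le_two
  refine ⟨p, strictMono_nat_of_lt_succ fun k => (hp k).1.trans (hp k).2.1, fun k hk => ?_⟩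
  exact exists_isGap_of_notMem (isClosed_abs_disc_le v a) (hp0 k) (hp0 (k + 1)) (hp k).1 (hp k).2.1
    (not_le.mpr hk)

theorem hasInfinitelyManyGaps_of_two_lt (hv : IsRealPotential v)
    (hvV : v =ᵐ[edgeMeasure l] fun t => (V t : ℂ)) (a : ℝ)
    (h : ∀ k, 2 < |disc v a (dirichletEigenvalue l V k)|) :
    HasInfinitelyManyGaps {x | |disc v a x| ≤ 2} := by
  obtain ⟨p, hp, hg⟩ := exists_gap_of_two_lt hv hvV a
  choose A B hAB h1 h2 h3 h4 using fun k => hg k (h k)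
  refine Set.infinite_of_injective_forall_mem (f := fun k => (A k, B k)) ?_ hAB
  have hlt : ∀ {j k}, j < k → A j < A k := fun {j k} hjk =>
    ((h2 j).trans (h3 j)).trans_le ((h4 j).trans ((hp.monotone hjk).trans (h1 k)))
  have : StrictMono A := fun j k => hlt
  exact fun j k hjk => this.injective (Prod.ext_iff.mp hjk).1

/-- At a closed gap the discriminant is `±2` and has a critical point. -/
theorem critical_of_gapClosed (hv : IsRealPotential v)
    (hvV : v =ᵐ[edgeMeasure l] fun t => (V t : ℂ)) {k : ℕ}
    (h : GapClosedNear {x | |disc v 0 x| ≤ 2} (dirichletEigenvalue l V k)) :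
    |disc v 0 (dirichletEigenvalue l V k)| = 2 ∧
      HasDerivAt (disc v 0) 0 (dirichletEigenvalue l V k) ∧
      ∃ᶠ y in 𝓝[≠] (dirichletEigenvalue l V k), |disc v 0 y| ≤ 2 := by
  set μ := dirichletEigenvalue l V k with hμ
  have hμ0 : dirichletFn v μ = 0 := dirichletFn_eigenvalue hv hvV k
  have hcl := isClosed_abs_disc_le v 0
  obtain ⟨p, hp⟩ := exists_interlacing hv hvV 0
  have hp0 : ∀ k, p k ∈ {x | |disc v 0 x| ≤ 2} := fun k => by
    change |disc v 0 (p k)| ≤ 2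
    rw [(hp k).2.2, abs_zero]
    exact zero_le_two
  have h2 : |disc v 0 μ| = 2 := by
    refine le_antisymm (not_lt.mp fun hlt => h ?_) (two_le_abs_disc hv 0 hμ0)
    obtain ⟨a, b, hab, -, ha, hb, -⟩ := exists_isGap_of_notMem hcl (hp0 k) (hp0 (k + 1)) (hp k).1
      (hp k).2.1 (not_le.mpr hlt)
    exact ⟨a, b, hab, ha.le, hb.le⟩
  have hμS : μ ∈ {x | |disc v 0 x| ≤ 2} := h2.le
  -- If the spectrum were absent on one side of `μ`, then `μ` would be an end point of a gap. The
  -- zeros `p k`, `p (k + 1)` of the discriminant guarantee that such a gap is bounded.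
  have hR : ∃ᶠ y in 𝓝[>] μ, |disc v 0 y| ≤ 2 := fun hcon => h (by
    obtain ⟨b, hb⟩ := exists_isGap_right hcl hμS (hp0 (k + 1)) (hp k).2.1 hcon
    exact ⟨μ, b, hb, le_rfl, hb.1.le⟩)
  have hL : ∃ᶠ y in 𝓝[<] μ, |disc v 0 y| ≤ 2 := fun hcon => h (by
    obtain ⟨a, ha⟩ := exists_isGap_left hcl hμS (hp0 k) (hp k).1 hcon
    exact ⟨a, μ, ha, ha.1.le, le_rfl⟩)
  refine ⟨h2, ?_, hR.filter_mono (nhdsWithin_mono μ fun y hy => ne_of_gt hy)⟩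
  have hd := (differentiable_disc v 0 μ).hasDerivAt
  suffices h0 : deriv (disc v 0) μ = 0 by rwa [h0] at hd
  by_contra hne
  -- A nonzero derivative would make `μ` a band edge, contradicting the presence of spectrum on both
  -- sides.
  obtain ⟨ε, hε, hb⟩ := isBandEdge_of_hasDerivAt (continuous_disc v 0) hd hne h2
  rcases hb with hb | hb
  · refine hL ?_
    filter_upwards [Ioo_mem_nhdsLT (by linarith : μ - ε < μ)] with y hy hle
    exact absurd (hb.subset ⟨hle, hy.1, by linarith [hy.2]⟩).1 (not_le.mpr hy.2)
  · refine hR ?_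
    filter_upwards [Ioo_mem_nhdsGT (by linarith : μ < μ + ε)] with y hy hle
    exact absurd (hb.subset ⟨hle, by linarith [hy.1], hy.2⟩).2 (not_le.mpr hy.1)

/-- At a closed gap the discriminant for coupling `0` contributes no derivative, while `a *
dirichletFn` contributes a nonzero one and leaves the value `±2` unchanged. -/
theorem isBandEdge_of_gapClosed (hv : IsRealPotential v)
    (hvV : v =ᵐ[edgeMeasure l] fun t => (V t : ℂ)) {k : ℕ}
    (h : GapClosedNear {x | |disc v 0 x| ≤ 2} (dirichletEigenvalue l V k)) {a : ℝ} (ha : a ≠ 0) :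
    IsBandEdge {x | |disc v a x| ≤ 2} (dirichletEigenvalue l V k) := by
  obtain ⟨h1, h2, -⟩ := critical_of_gapClosed hv hvV h
  set μ := dirichletEigenvalue l V k with hμ
  have hμ0 : dirichletFn v μ = 0 := dirichletFn_eigenvalue hv hvV k
  have e : disc v a = fun x => disc v 0 x + a * dirichletFn v x := funext (disc_eq_add a)
  have hd : HasDerivAt (disc v a) (0 + a * dirichletFn' v μ) μ := by
    rw [e]
    exact h2.add ((hasDerivAt_dirichletFn v μ).const_mul a)
  refine isBandEdge_of_hasDerivAt (continuous_disc v a) hd ?_ ?_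
  · rw [zero_add]
    exact mul_ne_zero ha (dirichletFn'_ne_zero hv hμ0)
  · rw [disc_eq_add, hμ0, mul_zero, add_zero, h1]

/-- The zeros of `u₁(l; ·)` are isolated, so points of `Σ` that accumulate at `x` eventually avoid
the other Dirichlet eigenvalues and carry Weyl sequences orthogonal to all eigenvectors. -/
theorem isEmbedded_of_frequently (hv : IsRealPotential v)
    (hvV : v =ᵐ[edgeMeasure l] fun t => (V t : ℂ)) {θ : ℝ} (hθ : ∃ N : ℤ, θ = N) (α : ℝ) {β : ℝ}
    (hβ : β ≠ 0) {x : ℝ} (hx : dirichletFn v x = 0)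
    (h : ∃ᶠ y in 𝓝[≠] x, |disc v (α / (1 + β ^ 2)) y| ≤ 2) :
    IsEmbeddedEigenvalue (latticeOp l V θ α β) x := by
  refine ⟨isEigenvalue_latticeOp_of_zero hvV hθ α hβ (by
    rw [← ofReal_dirichletFn hv, hx, Complex.ofReal_zero]), ?_⟩
  refine mem_continuousSpec_latticeOp hv hvV hθ α hβ fun ε hε => ?_
  have h1 : ∀ᶠ y in 𝓝[≠] x, y ∈ Metric.ball x ε :=
    nhdsWithin_le_nhds (Metric.ball_mem_nhds x hε)
  obtain ⟨y, hy1, hy2, hy3⟩ := (h.and_eventually ((eventually_dirichletFn_ne_zero hv hx).and h1)).exists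
  refine ⟨y, (mem_sigmaPart_iff hvV hθ α β y).mpr ⟨_, hy1, (ofReal_disc hv _ y).symm⟩, ?_, ?_⟩
  · rw [← ofReal_dirichletFn hv]
    exact Complex.ofReal_ne_zero.mpr hy2
  · rw [← Complex.ofReal_sub, Complex.norm_real]
    exact mem_ball_iff_norm.mp hy3

/-- By continuity the discriminant stays above `2` in norm on a complex neighbourhood of `x`, which
keeps `Σ` away; the simple zero of `u₁(l; ·)` is the only spectrum left there. -/
theorem isIsolatedPoint_of_two_lt (hv : IsRealPotential v)
    (hvV : v =ᵐ[edgeMeasure l] fun t => (V t : ℂ)) {θ : ℝ} (hθ : ∃ N : ℤ, θ = N) (α : ℝ) {β : ℝ}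
    (hβ : β ≠ 0) {x : ℝ} (hx : dirichletFn v x = 0) (h : 2 < |disc v (α / (1 + β ^ 2)) x|) :
    IsIsolatedPoint (spec (latticeOp l V θ α β)) x := by
  have hu : u₁End v x = 0 := by rw [← ofReal_dirichletFn hv, hx, Complex.ofReal_zero]
  have h1 : ∀ᶠ z in 𝓝 (x : ℂ), z ∉ sigmaPart l V θ α β := by
    have hc : ContinuousAt (fun z => ‖discC v (α / (1 + β ^ 2)) z‖) (x : ℂ) :=
      (continuous_discC v _).norm.continuousAt
    have h2 : 2 < ‖discC v (α / (1 + β ^ 2)) x‖ := by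
      rwa [← ofReal_disc hv, Complex.norm_real, Real.norm_eq_abs]
    filter_upwards [hc.eventually (lt_mem_nhds h2)] with z hz hmem
    obtain ⟨r, hr, e⟩ := (mem_sigmaPart_iff hvV hθ α β z).mp hmem
    rw [e, Complex.norm_real, Real.norm_eq_abs] at hz
    linarith
  have h2 : ∀ᶠ z in 𝓝[≠] (x : ℂ), u₁End v z ≠ 0 := by
    refine (hasDerivAt_u₁End v x).eventually_ne (c := 0) fun h0 => dirichletFn'_ne_zero hv hx ?_
    rw [dirichletFn', h0, Complex.zero_re]
  obtain ⟨ε, hε, hb⟩ := Metric.eventually_nhds_iff_ball.mp (h1.and (eventually_nhdsWithin_iff.mp h2))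
  refine ⟨ε, hε, Set.ext fun z => ?_⟩
  rw [spec_latticeOp hv hvV hθ α hβ]
  constructor
  · rintro ⟨h3, h4⟩
    have h5 : u₁End v z = 0 := h3.resolve_left (hb z h4).1
    by_contra hne
    exact (hb z h4).2 hne h5
  · rintro rfl
    exact ⟨Or.inr hu, Metric.mem_ball_self hε⟩

end Discriminant

/-! ### Convex potentials -/

section Convex

open Filter Topology

variable {l : ℝ} [hl : Fact (0 < l)] {v : EdgeSpace l} {V : ℝ → ℝ}

theorem hasDerivAt_of_eq_integral {u φ : ℝ → ℂ} (hφ : ContinuousOn φ (Set.Icc 0 l))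
    (hu : ∀ t ∈ Set.Icc 0 l, u t = u 0 + ∫ s in 0..t, φ s) {t : ℝ} (ht : t ∈ Set.Ioo 0 l) :
    HasDerivAt u (φ t) t := by
  have hnhds : Set.Icc 0 l ∈ 𝓝 t := Icc_mem_nhds ht.1 ht.2
  have h1 : IntervalIntegrable φ volume 0 t := by
    refine (hφ.mono ?_).intervalIntegrable
    rw [Set.uIcc_of_le ht.1.le]
    exact Set.Icc_subset_Icc_right ht.2.le
  have h2 := intervalIntegral.integral_hasDerivAt_right h1
    (hφ.stronglyMeasurableAtFilter_nhdsWithin measurableSet_Icc t |>.filter_mono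
      (by rw [nhdsWithin_eq_nhds.mpr hnhds])) (hφ.continuousAt hnhds)
  refine (h2.const_add (u 0)).congr_of_eventuallyEq ?_
  filter_upwards [hnhds] with s hs
  exact hu s hs

/-- A monotone function with equal end values is constant. -/
theorem deriv_eq_zero_of_monotone {φ φ' : ℝ → ℝ} (hc : ContinuousOn φ (Set.Icc 0 l))
    (hd : ∀ t ∈ Set.Ioo 0 l, HasDerivAt φ (φ' t) t) (h0 : ∀ t ∈ Set.Ioo 0 l, 0 ≤ φ' t)
    (he : φ 0 = φ l) {t : ℝ} (ht : t ∈ Set.Ioo 0 l) : φ' t = 0 := by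
  have hm : MonotoneOn φ (Set.Icc 0 l) := by
    refine monotoneOn_of_deriv_nonneg (convex_Icc 0 l) hc ?_ ?_
    · rw [interior_Icc]
      exact fun s hs => (hd s hs).differentiableAt.differentiableWithinAt
    · rw [interior_Icc]
      intro s hs
      rw [(hd s hs).deriv]
      exact h0 s hs
  have hconst : φ =ᶠ[𝓝 t] fun _ => φ 0 := by
    filter_upwards [Icc_mem_nhds ht.1 ht.2] with s hs
    exact le_antisymm ((hm hs ⟨hl.out.le, le_rfl⟩ hs.2).trans he.ge)
      (hm ⟨le_rfl, hl.out.le⟩ hs hs.1)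
  exact (hd t ht).unique ((hasDerivAt_const t (φ 0)).congr_of_eventuallyEq hconst)

/-- For a smooth potential without critical points the gaps are open. -/
theorem two_lt_abs_disc (hv : IsRealPotential v) (hvV : v =ᵐ[edgeMeasure l] fun t => (V t : ℂ))
    (hV : ContinuousOn V (Set.Icc 0 l)) (hd : ∀ t ∈ Set.Ioo 0 l, DifferentiableAt ℝ V t)
    (hne : ∀ t ∈ Set.Ioo 0 l, deriv V t ≠ 0) (a : ℝ) {x : ℝ} (hx : dirichletFn v x = 0) :
    2 < |disc v a x| := by
  have hl0 := hl.out
  refine lt_of_le_of_ne (two_le_abs_disc hv a hx) fun h2 => ?_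
  obtain ⟨hs0, hs⟩ := disc_eq_of_zero hv a hx
  set s := (u₁End' v x).re with hsdef
  have hs1 : s ^ 2 = 1 := by
    have h3 : (s + s⁻¹) ^ 2 = 4 := by rw [← hs, ← sq_abs, ← h2]; norm_num
    have h4 : (s ^ 2 - 1) ^ 2 = 0 := by
      have : s * s⁻¹ = 1 := mul_inv_cancel₀ hs0
      have e : s ^ 2 * (s + s⁻¹) ^ 2 = (s ^ 2 + 1) ^ 2 := by
        rw [← mul_pow, mul_add, this]; ring
      rw [h3] at e
      linarith
    have := pow_eq_zero_iff (two_ne_zero) |>.mp h4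
    linarith
  obtain ⟨f, g, h, H, e, hf0, hg0⟩ := exists_isH2_solution v (x : ℂ) 0 1
  have hend := isH2_end v H e
  rw [hf0, hg0, ← ofReal_dirichletFn hv, hx] at hend
  simp only [mul_zero, Complex.ofReal_zero, mul_one, zero_add] at hend
  have hφ : ContinuousOn (fun t => ((V t : ℂ) - x) * f t) (Set.Icc 0 l) :=
    ((Complex.continuous_ofReal.comp_continuousOn hV).sub continuousOn_const).mul H.continuousOn_fst
  have e' : h =ᵐ[edgeMeasure l] fun t => ((V t : ℂ) - x) * f t := by
    filter_upwards [e, hvV] with t h1 h2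
    rw [h1, h2]
  have hg : ∀ t ∈ Set.Icc 0 l, g t = g 0 + ∫ s in 0..t, ((V s : ℂ) - x) * f s := fun t ht => by
    rw [H.eq_snd t ht, integral_congr_edge e' ht]
  have df : ∀ t ∈ Set.Ioo 0 l, HasDerivAt (fun t => (f t).re) (g t).re t := fun t ht =>
    Complex.reCLM.hasFDerivAt.comp_hasDerivAt t
      (hasDerivAt_of_eq_integral H.continuousOn_snd H.eq_fst ht)
  have dg : ∀ t ∈ Set.Ioo 0 l, HasDerivAt (fun t => (g t).re) ((V t - x) * (f t).re) t := fun t ht => by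
    have h1 : HasDerivAt (fun t => (g t).re) (((V t : ℂ) - x) * f t).re t :=
      Complex.reCLM.hasFDerivAt.comp_hasDerivAt t (hasDerivAt_of_eq_integral hφ hg ht)
    refine h1.congr_deriv ?_
    rw [← Complex.ofReal_sub, Complex.re_ofReal_mul]
  have cF : ContinuousOn (fun t => (f t).re) (Set.Icc 0 l) :=
    Complex.continuous_re.comp_continuousOn H.continuousOn_fst
  have cG : ContinuousOn (fun t => (g t).re) (Set.Icc 0 l) :=
    Complex.continuous_re.comp_continuousOn H.continuousOn_snd
  -- By the equation the derivative of `Q` is `-V' f²`. As `f` vanishes at both ends, `Q` equals the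
  -- squared derivative of `f` there, which is `1` at `0` and `s² = 1` at `l`.
  set Q : ℝ → ℝ := fun t => (g t).re ^ 2 - (V t - x) * (f t).re ^ 2 with hQ
  have cQ : ContinuousOn Q (Set.Icc 0 l) := (cG.pow 2).sub ((hV.sub continuousOn_const).mul (cF.pow 2))
  have dQ : ∀ t ∈ Set.Ioo 0 l, HasDerivAt Q (-(deriv V t * (f t).re ^ 2)) t := fun t ht => by
    refine (((dg t ht).pow 2).sub (((hd t ht).hasDerivAt.sub_const x).mul ((df t ht).pow 2))).congr_deriv ?_
    simp only [Pi.pow_apply]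
    push_cast
    ring
  have Q0 : Q 0 = 1 := by simp [hQ, hf0, hg0]
  have Ql : Q l = 1 := by
    simp only [hQ]
    rw [hend.1, hend.2, ← hsdef, hs1]
    simp
  have hzero : ∀ t ∈ Set.Ioo 0 l, (f t).re = 0 := fun t ht => by
    have h4 : deriv V t * (f t).re ^ 2 = 0 := by
      -- By Darboux's theorem a derivative without zeros has constant sign, so `Q` is monotone with
      -- equal end values.
      rcases hasDerivWithinAt_forall_lt_or_forall_gt_of_forall_ne (convex_Ioo 0 l)
        (fun s hs => (hd s hs).hasDerivAt.hasDerivWithinAt) hne with hsgn | hsgn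
      · have := deriv_eq_zero_of_monotone cQ dQ (fun s hs => by
          have := hsgn s hs
          nlinarith [sq_nonneg (f s).re]) (by rw [Q0, Ql]) ht
        linarith
      · have := deriv_eq_zero_of_monotone cQ.neg (fun s hs => (dQ s hs).neg) (fun s hs => by
          have := hsgn s hs
          rw [neg_neg]
          positivity) (by simp [Q0, Ql]) ht
        linarith
    exact pow_eq_zero_iff two_ne_zero |>.mp ((mul_eq_zero.mp h4).resolve_left (hne t ht))
  have hzero' : ∀ t ∈ Set.Ioo 0 l, (g t).re = 0 := fun t ht => by
    refine (df t ht).unique ((hasDerivAt_const t (0 : ℝ)).congr_of_eventuallyEq ?_)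
    filter_upwards [Ioo_mem_nhds ht.1 ht.2] with s hs
    exact hzero s hs
  -- The solution is zero on the open interval; by continuity its derivative vanishes at `0`,
  -- against the initial value `1`.
  have hcl : (0 : ℝ) ∈ closure (Set.Ioo 0 l) := by
    rw [closure_Ioo hl0.ne]; exact ⟨le_rfl, hl0.le⟩
  have hlim : (g 0).re = 0 := by
    have h5 : Tendsto (fun t => (g t).re) (𝓝[Set.Ioo 0 l] 0) (𝓝 (g 0).re) :=
      (cG 0 ⟨le_rfl, hl0.le⟩).mono_left (nhdsWithin_mono 0 Set.Ioo_subset_Icc_self)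
    have := mem_closure_iff_nhdsWithin_neBot.mp hcl
    refine tendsto_nhds_unique h5 (tendsto_const_nhds.congr' ?_)
    filter_upwards [self_mem_nhdsWithin] with t ht
    exact (hzero' t ht).symm
  rw [hg0] at hlim
  simp at hlim

end Convex

/-! ### The free case -/

section Free

variable {l : ℝ} [hl : Fact (0 < l)] {v : EdgeSpace l}

theorem free_end (hv0 : v =ᵐ[edgeMeasure l] 0) {κ : ℂ} (hκ : κ ≠ 0) :
    u₁End v (κ ^ 2) = Complex.sin (κ * l) / κ ∧ u₁End' v (κ ^ 2) = Complex.cos (κ * l) ∧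
      u₂End v (κ ^ 2) = Complex.cos (κ * l) := by
  have hll : l ∈ Set.Icc 0 l := ⟨hl.out.le, le_rfl⟩
  have hint : ∀ (K : ℝ → ℂ) (f : ℝ → ℂ), ∫ s in 0..l, K s * (v s * f s) = 0 := fun K f => by
    have : (fun s => K s * (v s * f s)) =ᵐ[edgeMeasure l] fun _ => 0 := by
      filter_upwards [hv0] with s hs
      simp [hs]
    rw [integral_congr_edge this hll]
    simp
  obtain ⟨f, g, h, H, e, hf0, hg0⟩ := exists_isH2_solution v (κ ^ 2) 0 1
  obtain ⟨f', g', h', H', e', hf0', hg0'⟩ := exists_isH2_solution v (κ ^ 2) 1 0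
  have h1 := isH2_end v H e
  have h2 := variation_of_constants v H hκ e hll
  have h1' := isH2_end v H' e'
  have h2' := variation_of_constants v H' hκ e' hll
  rw [hint, hint, hf0, hg0] at h2
  rw [hint, hint, hf0', hg0'] at h2'
  rw [hf0, hg0] at h1
  rw [hf0', hg0'] at h1'
  simp only [mul_zero, mul_one, zero_add, add_zero, sub_zero] at h1 h2 h1' h2'
  exact ⟨h1.1.symm.trans h2.1, h1.2.symm.trans h2.2, h1'.1.symm.trans h2'.1⟩

/-- For `x > 0` the discriminant is `2 cos (√x l)`. -/
theorem abs_disc_le_of_free (hv0 : v =ᵐ[edgeMeasure l] 0) {x : ℝ} (hx : 0 < x) :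
    |disc v 0 x| ≤ 2 := by
  have hκ : ((√x : ℝ) : ℂ) ≠ 0 := Complex.ofReal_ne_zero.mpr (Real.sqrt_pos.mpr hx).ne'
  obtain ⟨-, h2, h3⟩ := free_end hv0 hκ
  have e : ((√x : ℝ) : ℂ) ^ 2 = x := by rw [← Complex.ofReal_pow, Real.sq_sqrt hx.le]
  rw [e] at h2 h3
  rw [disc, discC, h2, h3, ← Complex.ofReal_mul, ← Complex.ofReal_cos]
  have h4 := Real.abs_cos_le_one (√x * l)
  rw [abs_le] at h4 ⊢
  simp only [Complex.ofReal_zero, zero_mul, add_zero, Complex.add_re, Complex.ofReal_re]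
  constructor <;> linarith [h4.1, h4.2]

/-- For `x = 0` the solution `u₁` is `t`, and for `x = -k²` its end value is `sinh (k l) / k`;
neither vanishes at `l`. -/
theorem pos_of_dirichletFn_eq_zero_of_free (hv : IsRealPotential v) (hv0 : v =ᵐ[edgeMeasure l] 0)
    {x : ℝ} (hx : dirichletFn v x = 0) : 0 < x := by
  have hu : u₁End v x = 0 := by rw [← ofReal_dirichletFn hv, hx, Complex.ofReal_zero]
  by_contra hcon
  rcases (not_lt.mp hcon).eq_or_lt with rfl | hneg
  · have d1 : ∀ s : ℝ, HasDerivAt (fun t : ℝ => (t : ℂ)) 1 s := fun s => Complex.ofRealCLM.hasDerivAt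
    have H : IsH2 0 l (fun t => (t : ℂ)) (fun _ => 1) fun _ => 0 :=
      ⟨MemLp.zero, fun t _ => eq_add_integral_of_hasDerivAt d1 continuous_const t, fun t _ => by simp⟩
    have h1 := (isH2_end v H (z := 0) (by
      filter_upwards [hv0] with t ht
      simp [ht])).1
    rw [Complex.ofReal_zero] at hu
    rw [hu] at h1
    simp only [Complex.ofReal_zero, mul_zero, zero_mul, add_zero, Complex.ofReal_eq_zero] at h1
    exact hl.out.ne' h1
  · have hk : 0 < √(-x) := Real.sqrt_pos.mpr (by linarith)
    have hκ : (√(-x) : ℂ) * Complex.I ≠ 0 :=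
      mul_ne_zero (Complex.ofReal_ne_zero.mpr hk.ne') Complex.I_ne_zero
    have h1 := (free_end hv0 hκ).1
    have e : ((√(-x) : ℝ) * Complex.I : ℂ) ^ 2 = x := by
      rw [mul_pow, Complex.I_sq, ← Complex.ofReal_pow, Real.sq_sqrt (by linarith)]
      push_cast
      ring
    rw [e, hu, eq_comm, div_eq_zero_iff] at h1
    have h2 := h1.resolve_right hκ
    rw [mul_right_comm, Complex.sin_mul_I] at h2
    have h3 := (mul_eq_zero.mp h2).resolve_right Complex.I_ne_zero
    rw [← Complex.ofReal_mul, ← Complex.ofReal_sinh, Complex.ofReal_eq_zero, Real.sinh_eq_zero] at h3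
    exact (mul_pos hk hl.out).ne' h3

end Free

end QuantumGraph

/-! ### The theorem. -/

open QuantumGraph in
theorem corollaryc2 (l : ℝ) (hl : 0 < l) (V : ℝ → ℝ)
    (hV : MemLp V 2 (volume.restrict (Set.Icc 0 l)))
    (β : ℝ) (hβ : β ≠ 0) (θ : ℝ) (hθ : ∃ N : ℤ, θ = N) :
    -- the numbers `μ k` are the eigenvalues of `D` in increasing order
    (StrictMono (dirichletEigenvalue l V) ∧
      ∀ z : ℂ, IsEigenvalue (dirichletOp l V) z ↔ ∃ k, z = dirichletEigenvalue l V k) ∧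
    -- (A)
    (∀ α : ℝ,
      sigmaPart l V θ α β ⊆ spec (latticeOp l V θ α β) ∧
      sigmaPart l V θ α β = spec (kronigPenneyOp l V α β) ∧
      (HasInfinitelyManyGaps (realSpec (kronigPenneyOp l V α β)) →
        HasInfinitelyManyGaps (realSpec (latticeOp l V θ α β)))) ∧
    -- (B)
    (ContDiffOn ℝ ∞ V (Set.Icc 0 l) → ConvexOn ℝ (Set.Icc 0 l) V →
      (∀ t ∈ Set.Ioo 0 l, deriv V t ≠ 0) →
      ∀ α : ℝ,
        (∀ k, GapOpenNear (realSpec (kronigPenneyOp l V α β)) (dirichletEigenvalue l V k)) ∧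
        HasInfinitelyManyGaps (realSpec (kronigPenneyOp l V α β)) ∧
        HasInfinitelyManyGaps (realSpec (latticeOp l V θ α β)) ∧
        ∀ k, IsIsolatedPoint (spec (latticeOp l V θ α β)) (dirichletEigenvalue l V k)) ∧
    -- (C)
    (∀ k, GapClosedNear (realSpec (kronigPenneyOp l V 0 β)) (dirichletEigenvalue l V k) →
      ∀ α : ℝ,
        IsEmbeddedEigenvalue (latticeOp l V θ α β) (dirichletEigenvalue l V k) ∧
        (α ≠ 0 →
          IsBandEdge (realSpec (kronigPenneyOp l V α β)) (dirichletEigenvalue l V k) ∧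
          IsBandEdge (realSpec (latticeOp l V θ α β)) (dirichletEigenvalue l V k))) ∧
    (V =ᵐ[volume.restrict (Set.Icc 0 l)] 0 →
      ∀ k,
        GapClosedNear (realSpec (kronigPenneyOp l V 0 β)) (dirichletEigenvalue l V k) ∧
        IsEmbeddedEigenvalue (latticeOp l V θ 0 β) (dirichletEigenvalue l V k)) := by
  have : Fact (0 < l) := ⟨hl⟩
  obtain ⟨v, hvV⟩ : ∃ v : EdgeSpace l, v =ᵐ[edgeMeasure l] fun t => (V t : ℂ) :=
    ⟨hV.ofReal.toLp, hV.ofReal.coeFn_toLp⟩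
  have hv : IsRealPotential v := by
    filter_upwards [hvV] with t ht
    rw [ht, Complex.conj_ofReal]
  have hμ := dirichletFn_eigenvalue hv hvV
  have hfin : ∀ b, ({x | dirichletFn v x = 0} ∩ Set.Iic b).Finite := finite_zeros hv
  have hκ : 0 < 1 + β ^ 2 := by positivity
  have hK := realSpec_kronigPenneyOp hv hvV
  have hL := fun α => realSpec_latticeOp hv hvV hθ α hβ
  have hinf : ∀ α, HasInfinitelyManyGaps (realSpec (kronigPenneyOp l V α β)) →
      HasInfinitelyManyGaps (realSpec (latticeOp l V θ α β)) := fun α h => by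
    rw [hK] at h
    rw [hL]
    exact h.union hfin
  have hemb : ∀ k, GapClosedNear (realSpec (kronigPenneyOp l V 0 β)) (dirichletEigenvalue l V k) →
      ∀ α, IsEmbeddedEigenvalue (latticeOp l V θ α β) (dirichletEigenvalue l V k) := by
    intro k h α
    rw [hK, zero_div] at h
    refine isEmbedded_of_frequently hv hvV hθ α hβ (hμ k) ?_
    -- For `α = 0` the closed gap itself has spectrum accumulating at `μₖ`; for `α ≠ 0` the band
    -- edge provides it.
    by_cases hα : α = 0
    · rw [hα, zero_div]
      exact (critical_of_gapClosed hv hvV h).2.2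
    · exact (isBandEdge_of_gapClosed hv hvV h (div_ne_zero hα hκ.ne')).frequently
  refine ⟨⟨(dirichletEigenvalue_enumerates hv hvV).1, fun z => ?_⟩, fun α => ⟨?_, ?_, hinf α⟩,
    fun hs _ hne α => ?_, fun k h α => ⟨hemb k h α, fun hα => ?_⟩, fun h0 k => ?_⟩
  · rw [isEigenvalue_dirichletOp_iff hvV, u₁End_eq_zero_iff hv hvV]
  · rw [spec_latticeOp hv hvV hθ α hβ]
    exact Set.subset_union_left
  · ext z
    rw [mem_sigmaPart_iff hvV hθ, mem_spec_kronigPenneyOp_iff hvV]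
  · have hd : ∀ t ∈ Set.Ioo 0 l, DifferentiableAt ℝ V t := fun t ht =>
      ((hs.differentiableOn (by simp)) t ⟨ht.1.le, ht.2.le⟩).differentiableAt
        (Icc_mem_nhds ht.1 ht.2)
    have h2 : ∀ k, 2 < |disc v (α / (1 + β ^ 2)) (dirichletEigenvalue l V k)| := fun k =>
      two_lt_abs_disc hv hvV hs.continuousOn hd hne _ (hμ k)
    have hi : HasInfinitelyManyGaps (realSpec (kronigPenneyOp l V α β)) := by
      rw [hK]
      exact hasInfinitelyManyGaps_of_two_lt hv hvV _ h2
    refine ⟨fun k => ?_, hi, hinf α hi, fun k => isIsolatedPoint_of_two_lt hv hvV hθ α hβ (hμ k) (h2 k)⟩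
    rw [hK]
    obtain ⟨p, -, hp⟩ := exists_gap_of_two_lt hv hvV (α / (1 + β ^ 2))
    obtain ⟨A, B, hAB, -, hA, hB, -⟩ := hp k (h2 k)
    exact ⟨A, B, hAB, hA.le, hB.le⟩
  · rw [hK, zero_div] at h
    have hb := isBandEdge_of_gapClosed hv hvV h (div_ne_zero hα hκ.ne')
    rw [hK, hL]
    exact ⟨hb, hb.union (eventually_dirichletFn_ne_zero hv (hμ k))⟩
  · have hv0 : v =ᵐ[edgeMeasure l] 0 := by
      filter_upwards [hvV, h0] with t h1 h2
      rw [h1, h2]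
      simp
    have hc : GapClosedNear (realSpec (kronigPenneyOp l V 0 β)) (dirichletEigenvalue l V k) := by
      rintro ⟨a, b, ⟨hab, -, -, hg⟩, -, hb⟩
      have hpos := pos_of_dirichletFn_eq_zero_of_free hv hv0 (hμ k)
      -- A gap whose closure contains the positive number `μₖ` has a positive right end point, so it
      -- contains some `y > 0`; but all such `y` belong to the spectrum.
      obtain ⟨y, hy1, hy2⟩ := exists_between (max_lt hab (hpos.trans_le hb))
      refine hg y ((le_max_left _ _).trans_lt hy1) hy2 ?_
      rw [hK, zero_div]
      exact abs_disc_le_of_free hv0 ((le_max_right _ _).trans_lt hy1)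
    exact ⟨hc, hemb k hc 0⟩

end
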